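/- **Setting.** Let $d\ge 0$, let $\mathcal S$ be the closed unit ball of $\mathbb R^d$ (states) and $\mathcal A=\mathbb R^d$ (actions). Let $\Theta$ be a finite nonempty set and $N_\theta:\mathbb R^d\to\mathbb R^d$ ($\theta\in\Theta$) measurable maps with $\|N_\theta(s+a)\|_2\le 1$ for all $s\in\mathcal S$, $a\in\mathcal A$; the deterministic dynamics are $T_\theta(s,a)=N_\theta(s+a)$. Let $H$ be the horizon, $\mu_1$ a probability distribution on $\mathcal S$ (initial state), and $r:\mathcal S\times\mathcal A\to[0,1]$ a reward with $|r(s_1,a_1)-r(s_2,a_2)|\le L_r(\|s_1-s_2\|_2+\|a_1-a_2\|_2)$, $L_r\ge 0$. Let $\sigma>0$ and, for $\psi\in\mathbb R^{d\times d}$, let $\pi_\psi(\cdot\mid s)=\mathcal N(\psi s,\sigma^2 I)$. Put $\Psi=\{\psi:\|\psi\|_{op}\le 1\}$. Let $V^\psi_\theta(s_h)=\mathbb E\big[\sum_{h'=h}^H r(s_{h'},a_{h'})\big]$ with $a_{h'}\sim\pi_\psi(\cdot\mid s_{h'})$, $s_{h'+1}=T_\theta(s_{h'},a_{h'})$ (the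 value at step $h$, with $V=0$ at step $H+1$) and $\eta(\theta,\psi)=\mathbb E_{s_1\sim\mu_1}V^\psi_\theta(s_1)$. Gradients and Hessians are taken in $\psi\in\mathbb R^{d\times d}$ with the Euclidean (Frobenius) structure; $\|\cdot\|_{sp}$ is the spectral norm, and for a fourth-order tensor $A$ the injective norm $\sup_{\|u\|_2=1}\langle A,u^{\otimes 4}\rangle$. **Claim.** There is a polynomial $P$ in four variables, not depending on $d$, $\Theta$ or any other datum, such that with $C=P(\sigma,1/\sigma,H,L_r)$ the following hold. (1) There are constants $\zeta_g,\zeta_h,\zeta_{3rd},L_0,L_1,L_2,\chi_g,\chi_f,\chi_h\le C$ such that * for all $\theta$, $\eta(\theta,\cdot)$ is $C^2$ on $\mathbb R^{d\times d}$, and for all $\psi,\psi_1,\psi_2\in\mathbb R^{d\times d}$: $\|\nabla_\psi\eta(\theta,\psi)\|_2\le\zeta_g$, $\|\nabla^2_\psi\eta(\theta,\psi)\|_{sp}\le\zeta_h$, $\|\nabla^2_\psi\eta(\theta,\psi_1)-\nabla^2_\psi\eta(\theta,\psi_2)\|_{sp}\le\zeta_{3rd}\|\psi_1-\psi_2\|_2$;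 * for all $\theta$, every time step and all $s,s'\in\mathcal S$, $V^\psi_\theta(s)$ is $C^2$ in $\psi$, and for all $\psi\in\Psi$: $|V^\psi_\theta(s)-V^\psi_\theta(s')|\le L_0\|s-s'\|_2$, $\|\nabla_\psi V^\psi_\theta(s)-\nabla_\psi V^\psi_\theta(s')\|_2\le L_1\|s-s'\|_2$, $\|\nabla^2_\psi V^\psi_\theta(s)-\nabla^2_\psi V^\psi_\theta(s')\|_{sp}\le L_2\|s-s'\|_2$; * for all $\psi\in\Psi$, $s\in\mathcal S$, with $g=\nabla_\psi\log\pi_\psi(a\mid s)$, $G=\nabla^2_\psi\log\pi_\psi(a\mid s)$ and $a\sim\pi_\psi(\cdot\mid s)$: $\|\mathbb E[gg^\top]\|_{sp}\le\chi_g$, $\|\mathbb E[g^{\otimes 4}]\|_{sp}\le\chi_f$, $\|\mathbb E[GG^\top]\|_{sp}\le\chi_h$ (all expectations exist). (2) *Dimension-free local regret.* An online learner $\mathcal R$ maps the data of previous rounds measurably to a distribution on $\Theta$. A data point is a pair of $H$-step trajectories of transitions $(s,a,s')$ with $s,s'\in\mathcal S$, and the loss of $\theta$ on it is the sum of $\|T_\theta(s,a)-s'\|_2^2$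 over all its transitions. The regret of $\mathcal R$ on data points $z_1,\dots,z_T$, with $p_t=\mathcal R(z_1,\dots,z_{t-1})$, is $\sum_{t\le T}\mathbb E_{\theta\sim p_t}[\ell(z_t;\theta)]-\min_\theta\sum_{t\le T}\ell(z_t;\theta)$. Let $\mathfrak R_T=\sup_{z}\mathbb E_{e}\big[\max_\theta\sum_{t\le T}e_t\,\ell(z_t(e_1,\dots,e_{t-1});\theta)\big]$ be the sequential Rademacher complexity ($e_t$ independent uniform signs, supremum over depth-$T$ trees of data points). Given the unknown $\theta^\star\in\Theta$, the algorithm starts from a parameter $\psi_0$ and in round $t=1,2,\dots,T$ lets $\mathcal R$ compute $p_t$ from the data of the previous rounds, takes for $\psi_t$ any maximiser of $\psi\mapsto\mathbb E_{\theta\sim p_t}[\eta(\theta,\psi)]$ over $\mathbb R^{d\times d}$, and samples a trajectory of $\pi_{\psi_t}$ and one of $\pi_{\psi_{t-1}}$ under $T_{\theta^\star}$, which (with the true next states) form the data point of the round. Suppose that all parameters used satisfy $\|\psi_t\|_{op}\le 1$, $0\le t\le T$. For $\Psi\subseteq D\subseteq\mathbb R^{d\times d}$ let $\mathfrak A_{D}$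 be the set of $\psi\in D$ with $\|\nabla_\psi\eta(\theta^\star,\psi)\|_2\le\epsilon$ and $\lambda_{\max}(\nabla^2_\psi\eta(\theta^\star,\psi))\le\sqrt\epsilon$, and suppose $\mathfrak A_D\ne\emptyset$ (one may take $D=\Psi$ or $D=\mathbb R^{d\times d}$). Consider the bound $$\mathbb E\Big[\sum_{t=1}^T\Big(\inf_{\psi\in\mathfrak A_D}\eta(\theta^\star,\psi)-\eta(\theta^\star,\psi_t)\Big)\Big]\le C\,T^{3/4}(\log|\Theta|)^{1/4}\epsilon^{-2}.\qquad(*)$$ For every $T$: * every online learner whose regret is at most $2\mathfrak R_T$ on all sequences of $T$ data points satisfies $(*)$ for all $\theta^\star\in\Theta$, all $\epsilon\in(0,1]$, all such $D$ and all such runs; * there is an online learner (not depending on $\theta^\star$) whose regret is at most $C\sqrt{T\log|\Theta|}$ on all sequences of $T$ data points and that satisfies $(*)$ in the same sense. -/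

import Mathlib

universe u v

open MeasureTheory ProbabilityTheory
open scoped RealInnerProductSpace

noncomputable section

namespace ModelRL

/-! ### States, actions and policy parameters -/

/-- States and actions live in `ℝ^d` with the Euclidean norm. -/
abbrev E (d : ℕ) := EuclideanSpace ℝ (Fin d)

/-- Policy parameters: `d × d` real matrices, with the Euclidean (Frobenius) inner product of the
vectorised matrix. -/
abbrev Param (d : ℕ) := EuclideanSpace ℝ (Fin d × Fin d)

/-- The state space: the closed unit ball of `ℝ^d`. -/
def stateSpace (d : ℕ) : Set (E d) := Metric.closedBall 0 1

/-- The linear map `s ↦ ψ s` on `ℝ^d` given by the matrix `ψ`; its norm is the operator norm of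
the matrix. -/
def act {d : ℕ} (ψ : Param d) : E d →L[ℝ] E d :=
  Matrix.toEuclideanCLM (n := Fin d) (𝕜 := ℝ) (Matrix.of fun i j => ψ (i, j))

/-- The parameters `ψ` with `‖ψ‖_op ≤ 1`. -/
def policyClass (d : ℕ) : Set (Param d) := {ψ | ‖act ψ‖ ≤ 1}

/-! ### Gaussian policies -/

/-- The law `N(0, σ² I)` on `ℝ^d`. -/
def gaussianNoise (d : ℕ) (σ : ℝ) : Measure (E d) :=
  multivariateGaussian 0 (σ ^ 2 • (1 : Matrix (Fin d) (Fin d) ℝ))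

/-- The policy `π_ψ(· ∣ s) = N(ψ s, σ² I)`. -/
def policy {d : ℕ} (σ : ℝ) (ψ : Param d) (s : E d) : Measure (E d) :=
  multivariateGaussian (act ψ s) (σ ^ 2 • (1 : Matrix (Fin d) (Fin d) ℝ))

/-- The density `π_ψ(a ∣ s)` of the policy with respect to Lebesgue measure. -/
def policyDensity {d : ℕ} (σ : ℝ) (ψ : Param d) (s a : E d) : ℝ :=
  (√(2 * Real.pi * σ ^ 2))⁻¹ ^ d * Real.exp (-‖a - act ψ s‖ ^ 2 / (2 * σ ^ 2))

/-- An action `a ∼ π_ψ(· ∣ s)` is `ψ s + u` with `u ∼ N(0, σ² I)`. -/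
theorem map_gaussianNoise_eq_policy {d : ℕ} (σ : ℝ) (ψ : Param d) (s : E d) :
    (gaussianNoise d σ).map (fun u => act ψ s + u) = policy σ ψ s := by
  unfold gaussianNoise policy multivariateGaussian
  rw [Measure.map_map (by fun_prop) (by fun_prop)]
  congr 1
  funext x
  simp

/-! ### Trajectories -/

/-- A trajectory of `k` steps: the list of transitions `(s_h, a_h, s_{h+1})`. -/
abbrev Traj (d k : ℕ) := Fin k → E d × E d × E d

/-- The trajectory of `k` steps from state `s` under the dynamics `T(s, a) = f (s + a)` when the
policy noise is `u`, that is, `a_h = ψ s_h + u_h`. -/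
def rollout {d : ℕ} (f : E d → E d) (ψ : Param d) :
    (k : ℕ) → E d → (Fin k → E d) → Traj d k
  | 0, _, _ => Fin.elim0
  | k + 1, s, u =>
      Fin.cons (s, act ψ s + u 0, f (s + (act ψ s + u 0)))
        (rollout f ψ k (f (s + (act ψ s + u 0))) (Fin.tail u))

/-! ### The class of instances -/

/-- An instance: horizon `H`, noise level `σ`, a model `N_θ` for each `θ` in the finite
class `Θ`, a reward function `r` with Lipschitz constant `Lr`, and the law `μ₁` of the initial
state. -/
structure Instance (d : ℕ) (Θ : Type*) where
  H : ℕ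
  σ : ℝ
  Lr : ℝ
  N : Θ → E d → E d
  r : E d → E d → ℝ
  μ₁ : Measure (E d)
  σ_pos : 0 < σ
  Lr_nonneg : 0 ≤ Lr
  N_meas : ∀ θ, Measurable (N θ)
  N_bound : ∀ θ, ∀ s ∈ stateSpace d, ∀ a, ‖N θ (s + a)‖ ≤ 1
  r_mem : ∀ s ∈ stateSpace d, ∀ a, r s a ∈ Set.Icc (0 : ℝ) 1
  r_lip : ∀ s₁ ∈ stateSpace d, ∀ s₂ ∈ stateSpace d, ∀ a₁ a₂,
    |r s₁ a₁ - r s₂ a₂| ≤ Lr * (‖s₁ - s₂‖ + ‖a₁ - a₂‖)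
  μ₁_prob : IsProbabilityMeasure μ₁
  μ₁_supp : ∀ᵐ s ∂μ₁, s ∈ stateSpace d

namespace Instance

variable {d : ℕ} {Θ : Type*} (M : Instance d Θ)

/-- The value `V^ψ_θ` of a state at which `k` steps remain (`k = H - h + 1` at time step `h`):
the expected total reward of the remaining steps. -/
def value (θ : Θ) (ψ : Param d) (k : ℕ) (s : E d) : ℝ :=
  ∫ u, ∑ i, M.r (rollout (M.N θ) ψ k s u i).1 (rollout (M.N θ) ψ k s u i).2.1
    ∂(Measure.pi fun _ : Fin k => gaussianNoise d M.σ)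

/-- The expected return `η(θ, ψ) = E_{s₁ ∼ μ₁} V^ψ_θ(s₁)`. -/
def eta (θ : Θ) (ψ : Param d) : ℝ := ∫ s, M.value θ ψ M.H s ∂M.μ₁

end Instance

/-! ### The regularity assumptions -/

/-- The Hessian, as a linear map on the parameter space. -/
def hessian {d : ℕ} (f : Param d → ℝ) (ψ : Param d) : Param d →L[ℝ] Param d :=
  fderiv ℝ (gradient f) ψ

/-- Lipschitzness of the total return, its gradient and its Hessian. -/
structure ReturnLipschitz {d : ℕ} {Θ : Type*} (η : Θ → Param d → ℝ) (ζg ζh ζ3 : ℝ) : Prop where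
  contDiff : ∀ θ, ContDiff ℝ 2 (η θ)
  grad_le : ∀ θ ψ, ‖gradient (η θ) ψ‖ ≤ ζg
  hess_le : ∀ θ ψ, ‖hessian (η θ) ψ‖ ≤ ζh
  hess_lip : ∀ θ ψ₁ ψ₂, ‖hessian (η θ) ψ₁ - hessian (η θ) ψ₂‖ ≤ ζ3 * ‖ψ₁ - ψ₂‖

/-- Lipschitzness in the state of the value function and of its gradient and Hessian in `ψ`, at
every time step (the number `k ≤ H` of remaining steps). -/
structure ValueLipschitz {d : ℕ} {Θ : Type*} (V : Θ → Param d → ℕ → E d → ℝ)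
    (Ψ : Set (Param d)) (S : Set (E d)) (H : ℕ) (L0 L1 L2 : ℝ) : Prop where
  contDiff : ∀ θ, ∀ k ≤ H, ∀ s ∈ S, ContDiff ℝ 2 fun ψ => V θ ψ k s
  value_lip : ∀ θ, ∀ ψ ∈ Ψ, ∀ k ≤ H, ∀ s ∈ S, ∀ s' ∈ S,
    |V θ ψ k s - V θ ψ k s'| ≤ L0 * ‖s - s'‖
  grad_lip : ∀ θ, ∀ ψ ∈ Ψ, ∀ k ≤ H, ∀ s ∈ S, ∀ s' ∈ S,
    ‖gradient (fun φ => V θ φ k s) ψ - gradient (fun φ => V θ φ k s') ψ‖ ≤ L1 * ‖s - s'‖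
  hess_lip : ∀ θ, ∀ ψ ∈ Ψ, ∀ k ≤ H, ∀ s ∈ S, ∀ s' ∈ S,
    ‖hessian (fun φ => V θ φ k s) ψ - hessian (fun φ => V θ φ k s') ψ‖ ≤ L2 * ‖s - s'‖

/-- The injective norm `sup_{‖u‖ = 1} ⟨A, u^{⊗4}⟩` of a fourth-order tensor. -/
def injectiveNorm {ι : Type*} [Fintype ι] (A : (Fin 4 → ι) → ℝ) : ℝ :=
  ⨆ u : Metric.sphere (0 : EuclideanSpace ℝ ι) 1, ∑ i, A i * ∏ k, u.1 (i k)

/-- `∇_ψ log π_ψ(a ∣ s)`. -/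
def score {d : ℕ} (σ : ℝ) (ψ : Param d) (s a : E d) : Param d :=
  gradient (fun φ => Real.log (policyDensity σ φ s a)) ψ

/-- `∇²_ψ log π_ψ(a ∣ s)`. -/
def scoreHessian {d : ℕ} (σ : ℝ) (ψ : Param d) (s a : E d) : Param d →L[ℝ] Param d :=
  hessian (fun φ => Real.log (policyDensity σ φ s a)) ψ

/-- Moment bounds for the score of the stochastic policies. Here `rankOne g g` is `g gᵀ`. -/
structure PolicySmooth {d : ℕ} (σ : ℝ) (Ψ : Set (Param d)) (S : Set (E d)) (χg χf χh : ℝ) :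
    Prop where
  contDiff : ∀ s ∈ S, ∀ a, ContDiff ℝ 2 fun ψ : Param d => Real.log (policyDensity σ ψ s a)
  second_integrable : ∀ ψ ∈ Ψ, ∀ s ∈ S,
    Integrable (fun a => InnerProductSpace.rankOne ℝ (score σ ψ s a) (score σ ψ s a))
      (policy σ ψ s)
  second_le : ∀ ψ ∈ Ψ, ∀ s ∈ S,
    ‖∫ a, InnerProductSpace.rankOne ℝ (score σ ψ s a) (score σ ψ s a) ∂(policy σ ψ s)‖ ≤ χg
  fourth_integrable : ∀ ψ ∈ Ψ, ∀ s ∈ S, ∀ i : Fin 4 → Fin d × Fin d,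
    Integrable (fun a => ∏ k, score σ ψ s a (i k)) (policy σ ψ s)
  fourth_le : ∀ ψ ∈ Ψ, ∀ s ∈ S,
    injectiveNorm (fun i : Fin 4 → Fin d × Fin d =>
      ∫ a, ∏ k, score σ ψ s a (i k) ∂(policy σ ψ s)) ≤ χf
  hess_integrable : ∀ ψ ∈ Ψ, ∀ s ∈ S,
    Integrable (fun a => scoreHessian σ ψ s a ∘L (scoreHessian σ ψ s a).adjoint) (policy σ ψ s)
  hess_le : ∀ ψ ∈ Ψ, ∀ s ∈ S,
    ‖∫ a, scoreHessian σ ψ s a ∘L (scoreHessian σ ψ s a).adjoint ∂(policy σ ψ s)‖ ≤ χh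

/-! ### Online learners and sequential Rademacher complexity -/

/-- An online learner: from the data points of the previous rounds it computes a distribution over
the finite class `Θ`. -/
structure Learner (Z Θ : Type*) [MeasurableSpace Z] [Fintype Θ] where
  dist : (t : ℕ) → (Fin t → Z) → Θ → ℝ
  dist_mem : ∀ t h, dist t h ∈ stdSimplex ℝ Θ
  dist_meas : ∀ t, Measurable (dist t)

/-- The sequential Rademacher complexity of the losses `ℓ θ`, the supremum being over trees of
depth `T` with values in `A`. -/
def seqRademacher {Z Θ : Type*} (ℓ : Θ → Z → ℝ) (A : Set Z) (T : ℕ) : ℝ :=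
  ⨆ z : (t : Fin T) → (Fin t → Bool) → A,
    ((2 : ℝ) ^ T)⁻¹ * ∑ e : Fin T → Bool,
      ⨆ θ, ∑ t, (if e t then 1 else -1) * ℓ θ (z t fun i => e (Fin.castLE t.2.le i))

/-- The online learning regret of `R` on the data points `z`. -/
def Learner.regret {Z Θ : Type*} [MeasurableSpace Z] [Fintype Θ] (R : Learner Z Θ)
    (ℓ : Θ → Z → ℝ) {T : ℕ} (z : Fin T → Z) : ℝ :=
  ∑ t : Fin T, ∑ θ, R.dist t (fun i => z (Fin.castLE t.2.le i)) θ * ℓ θ (z t)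
    - ⨅ θ, ∑ t, ℓ θ (z t)

/-- `R` has online learning regret at most twice the sequential Rademacher complexity over `T`
rounds, whatever the data points in `A`. -/
def Learner.RademacherRegret {Z Θ : Type*} [MeasurableSpace Z] [Fintype Θ] (R : Learner Z Θ)
    (ℓ : Θ → Z → ℝ) (A : Set Z) (T : ℕ) : Prop :=
  ∀ z : Fin T → Z, (∀ t, z t ∈ A) → R.regret ℓ z ≤ 2 * seqRademacher ℓ A T

/-! ### Local regret -/

/-- The `(εg, εh)`-approximate local maxima of `f`: the gradient has norm at most `εg` and the
largest eigenvalue of the Hessian is at most `εh`. -/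
def approxLocalMax {d : ℕ} (f : Param d → ℝ) (εg εh : ℝ) : Set (Param d) :=
  {ψ | ‖gradient f ψ‖ ≤ εg ∧ ∀ v, ⟪hessian f ψ v, v⟫ ≤ εh * ‖v‖ ^ 2}

/-- The `(εg, εh)`-local regret over `T` rounds of the parameters `ψ 1, …, ψ T`, relative to the
approximate local maxima in `D`. -/
def localRegret {d : ℕ} (f : Param d → ℝ) (D : Set (Param d)) (εg εh : ℝ) (T : ℕ)
    (ψ : ℕ → Param d) : ℝ :=
  ∑ t ∈ Finset.range T, (sInf (f '' (approxLocalMax f εg εh ∩ D)) - f (ψ (t + 1)))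

/-! ### The algorithm -/

namespace Instance

variable {d : ℕ} {Θ : Type*} (M : Instance d Θ)

/-- What the learner observes in a round: two trajectories. -/
abbrev Data := Traj d M.H × Traj d M.H

/-- The data points that may occur: all states of the trajectories lie in the state space. -/
def dataSet : Set M.Data :=
  {z | (∀ i, (z.1 i).1 ∈ stateSpace d ∧ (z.1 i).2.2 ∈ stateSpace d) ∧
    ∀ i, (z.2 i).1 ∈ stateSpace d ∧ (z.2 i).2.2 ∈ stateSpace d}

/-- The loss of the model `θ`: the total squared error of its one-step predictions. -/
def loss (θ : Θ) (z : M.Data) : ℝ :=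
  ∑ i, ‖M.N θ ((z.1 i).1 + (z.1 i).2.1) - (z.1 i).2.2‖ ^ 2 +
    ∑ i, ‖M.N θ ((z.2 i).1 + (z.2 i).2.1) - (z.2 i).2.2‖ ^ 2

/-- The randomness of one trajectory: the initial state and the noise of the policy. -/
abbrev TrajNoise := E d × (Fin M.H → E d)

/-- The law of the randomness of one trajectory. -/
def trajNoiseLaw : Measure M.TrajNoise :=
  M.μ₁.prod (Measure.pi fun _ => gaussianNoise d M.σ)

/-- The virtual return `E_{θ ∼ p} η(θ, ψ)`. -/
def virtualReturn [Fintype Θ] (p : Θ → ℝ) (ψ : Param d) : ℝ := ∑ θ, p θ * M.eta θ ψ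

/-- The pair of trajectories observed in round `t + 1`: the first one is sampled with `ψ (t + 1)`,
the second one with `ψ t`, both under the dynamics of `θ`. -/
def roundData (θ : Θ) {Ω : Type*} (ξ : ℕ → Ω → M.TrajNoise × M.TrajNoise)
    (ψ : ℕ → Ω → Param d) (t : ℕ) (ω : Ω) : M.Data :=
  (rollout (M.N θ) (ψ (t + 1) ω) M.H (ξ t ω).1.1 (ξ t ω).1.2,
    rollout (M.N θ) (ψ t ω) M.H (ξ t ω).2.1 (ξ t ω).2.2)

/-- `ψ 0, …, ψ T` is a run over `T` rounds of virtual ascent with the online learner `R` when the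
true model is `θ`. The first `t` rounds are described by `ℱ t`; round `t + 1` runs the learner on
the data of the earlier rounds, takes for `ψ (t + 1)` any maximiser of the virtual return over all
parameters, and samples two trajectories with the fresh randomness `ξ t`. All the parameters used
are in `policyClass d`. -/
structure IsRun [Fintype Θ] (θ : Θ) (R : Learner M.Data Θ) (T : ℕ) {Ω : Type*}
    [mΩ : MeasurableSpace Ω] (P : Measure Ω) (ℱ : Filtration ℕ mΩ)
    (ξ : ℕ → Ω → M.TrajNoise × M.TrajNoise) (ψ : ℕ → Ω → Param d) : Prop where
  noise_meas : ∀ t < T, Measurable[ℱ (t + 1)] (ξ t)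
  noise_law : ∀ t < T, P.map (ξ t) = M.trajNoiseLaw.prod M.trajNoiseLaw
  noise_indep : ∀ t < T, Indep (MeasurableSpace.comap (ξ t) inferInstance) (ℱ t) P
  init_meas : Measurable[ℱ 0] (ψ 0)
  param_meas : ∀ t < T, Measurable[ℱ t] (ψ (t + 1))
  param_mem : ∀ t ≤ T, ∀ ω, ψ t ω ∈ policyClass d
  ascent : ∀ t < T, ∀ ω φ,
    M.virtualReturn (R.dist t fun i => M.roundData θ ξ ψ i ω) φ ≤
      M.virtualReturn (R.dist t fun i => M.roundData θ ξ ψ i ω) (ψ (t + 1) ω)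

/-- With the learner `R`, for every true model `θ`, every `ε ∈ (0, 1]` and every run over `T`
rounds, the expected `(ε, √ε)`-local regret is at most `B ε`. The approximate local maxima may be
taken in any set `D` of parameters that contains `policyClass d`, so in `policyClass d` itself or
in the set of all parameters. -/
def LocalRegretLE {d : ℕ} {Θ : Type u} [Fintype Θ] (M : Instance d Θ)
    (R : Learner M.Data Θ) (T : ℕ) (B : ℝ → ℝ) : Prop :=
  ∀ (θ : Θ) (ε : ℝ), 0 < ε → ε ≤ 1 →
  ∀ D : Set (Param d), policyClass d ⊆ D → (approxLocalMax (M.eta θ) ε (√ε) ∩ D).Nonempty →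
  ∀ (Ω : Type v) [mΩ : MeasurableSpace Ω] (P : Measure Ω) [IsProbabilityMeasure P]
    (ℱ : Filtration ℕ mΩ) (ξ : ℕ → Ω → M.TrajNoise × M.TrajNoise) (ψ : ℕ → Ω → Param d),
  M.IsRun θ R T P ℱ ξ ψ →
    Integrable (fun ω => localRegret (M.eta θ) D ε (√ε) T fun t => ψ t ω) P ∧
    ∫ ω, localRegret (M.eta θ) D ε (√ε) T (fun t => ψ t ω) ∂P ≤ B ε

end Instance

end ModelRL

end

open ModelRL

open scoped ENNReal NNReal
set_option maxSynthPendingDepth 3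

/-! ### The Cameron–Martin formula for the policy noise -/

namespace ModelRL

/-! The dynamics are merely measurable, so all regularity must come from the Gaussian noise, and
every constant must be free of the dimension. By the Cameron–Martin formula applied step by step
(`lintegral_rollout`), the trajectory law of the policy `ψ` has, relative to that of the policy `0`,
the density `exp (b ψ - q ψ ψ / 2)`, with `b` linear and `q` quadratic in `ψ`. Since states lie in
the unit ball, `ψ ↦ ψ s` has norm at most one, so `q` is bounded by `lam ^ 2 ‖ψ‖ ^ 2` with `lam` of
order `H / σ`. Derivatives of expected costs fall on the density only and become moments of the
score. Tilting the density by `v / lam` bounds the moment generating function of the score in each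
direction `v`, hence all directional moments (`integral_rho_mul_score_pow_le`); operator norms are
suprema over directions, so `smoothBound_integral` is dimension-free. This gives the bounds for the
return.

For the dependence on the state, the next state is a function of `s + a`, which is Gaussian with
mean `s + ψ s`. Treating this mean as a further parameter, the value is a smooth function of `(ψ, s
+ ψ s)` plus the expected reward of the first step (`expCost_succ_eq`). Lipschitz bounds in `s` then
follow from derivatives in the parameters and from the Lipschitz reward.

For the regret, the telescoping argument `abs_expCost_sub_le` bounds the difference of the returns
of two models by the one-step errors along trajectories of the true model. A second-moment change of
measure (`QuadFamily.sq_integral_le`) moves this expectation to any policy within distance of order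
`σ / H`. The virtual and the true return of every policy near the previous one are thus close up to
the prediction error on sampled trajectories, and no gradients or Hessians of the models need
comparing. If `ψ_t` is not an approximate local maximum, a nearby policy gains at least a multiple
of `ε ^ 2` (`exists_ascent`); the maximiser `ψ_{t+1}` of the virtual return inherits the gain up to
the error. If `ψ_t` is an approximate local maximum, `ψ_{t+1}` is not worse than it up to the error.
The gap to the infimum over the approximate local maxima therefore contracts, and its sum is at most
of order `ε⁻²` times one plus the sum of the errors (`sum_gap_le`).

The expected squared prediction errors equal the expected learner losses, because the noise of a
round is independent of its policies and beliefs. The true model has loss zero, so their sum is at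
most the regret, of order `√(T log |Θ|)` for exponential weights and, by a finite-class maximal
inequality on trees, for any learner within twice the sequential Rademacher complexity. Passing from
squared errors to errors gives `√(T √(T log |Θ|)) = T ^ (3/4) (log |Θ|) ^ (1/4)`. -/

/-- The shift of a real centred Gaussian law has the expected exponential density. -/
theorem gaussianReal_map_const_add_eq_withDensity {v : ℝ≥0} (hv : v ≠ 0) (c : ℝ) :
    (gaussianReal 0 v).map (fun x => c + x) =
      (gaussianReal 0 v).withDensity
        fun x => ENNReal.ofReal (Real.exp ((c * x - c ^ 2 / 2) / v)) := by
  rw [gaussianReal_map_const_add, gaussianReal_of_var_ne_zero _ hv,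
    gaussianReal_of_var_ne_zero _ hv,
    ← withDensity_mul _ (measurable_gaussianPDF _ _) (by fun_prop)]
  congr 1
  funext x
  have hv' : (v : ℝ) ≠ 0 := by exact_mod_cast hv
  rw [Pi.mul_apply, gaussianPDF, gaussianPDF, ← ENNReal.ofReal_mul (gaussianPDFReal_nonneg _ _ _)]
  simp only [gaussianPDFReal, mul_assoc, ← Real.exp_add]
  congr 4
  field_simp
  ring

theorem lintegral_pi_prod {ι : Type*} [Fintype ι] {X : ι → Type*} [∀ i, MeasurableSpace (X i)]
    (μ : ∀ i, Measure (X i)) [∀ i, IsProbabilityMeasure (μ i)] {f : ∀ i, X i → ℝ≥0∞}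
    (hf : ∀ i, Measurable (f i)) :
    ∫⁻ x, ∏ i, f i (x i) ∂(Measure.pi μ) = ∏ i, ∫⁻ x, f i x ∂(μ i) := by
  refine (lintegral_prod_eq_prod_lintegral_of_indepFun Finset.univ
    (fun i (x : ∀ i, X i) => f i (x i))
    (iIndepFun_pi fun i => (hf i).aemeasurable)
    (fun i => (hf i).comp (measurable_pi_apply i))).trans ?_
  refine Finset.prod_congr rfl fun i _ => ?_
  exact (measurePreserving_eval μ i).lintegral_comp (hf i)

/-- Both measures are compared on boxes: the indicator of a box is a product of indicators, so the
integral of the product density factorises. -/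
theorem pi_withDensity {ι : Type*} [Fintype ι] {X : ι → Type*} [∀ i, MeasurableSpace (X i)]
    (μ : ∀ i, Measure (X i)) [∀ i, IsProbabilityMeasure (μ i)] {f : ∀ i, X i → ℝ≥0∞}
    (hf : ∀ i, Measurable (f i)) [∀ i, SigmaFinite ((μ i).withDensity (f i))] :
    Measure.pi (fun i => (μ i).withDensity (f i)) =
      (Measure.pi μ).withDensity fun x => ∏ i, f i (x i) := by
  classical
  refine Measure.pi_eq fun s hs => ?_
  rw [withDensity_apply _ (MeasurableSet.univ_pi hs),
    ← lintegral_indicator (MeasurableSet.univ_pi hs)]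
  have : (Set.univ.pi s).indicator (fun x => ∏ i, f i (x i)) =
      fun x => ∏ i, (s i).indicator (f i) (x i) := by
    funext x
    by_cases hx : x ∈ Set.univ.pi s
    · rw [Set.indicator_of_mem hx]
      exact Finset.prod_congr rfl fun i _ => (Set.indicator_of_mem (hx i trivial) _).symm
    · rw [Set.indicator_of_notMem hx]
      simp only [Set.mem_univ_pi, not_forall] at hx
      obtain ⟨i, hi⟩ := hx
      exact (Finset.prod_eq_zero (Finset.mem_univ i) (Set.indicator_of_notMem hi _)).symm
  rw [this, lintegral_pi_prod μ fun i => (hf i).indicator (hs i)]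
  refine Finset.prod_congr rfl fun i _ => ?_
  rw [withDensity_apply _ (hs i), lintegral_indicator (hs i)]

/-- The characteristic functions agree; this reduces the shift formula to one coordinate at a time.
-/
theorem gaussianNoise_eq_map_pi (d : ℕ) (σ : ℝ) :
    gaussianNoise d σ =
      (Measure.pi fun _ : Fin d => gaussianReal 0 (σ ^ 2).toNNReal).map (WithLp.toLp 2) := by
  have : IsFiniteMeasure (gaussianNoise d σ) := by unfold gaussianNoise; infer_instance
  apply Measure.ext_of_charFun (E := EuclideanSpace ℝ (Fin d))
  ext t
  have hS : (σ ^ 2 • (1 : Matrix (Fin d) (Fin d) ℝ)).PosSemidef :=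
    Matrix.PosSemidef.one.smul (sq_nonneg σ)
  rw [gaussianNoise, charFun_multivariateGaussian hS]
  simp_rw [charFun_pi, charFun_gaussianReal, ← Complex.exp_sum]
  congr 1
  simp [Matrix.smul_mulVec, dotProduct, Finset.sum_div, Real.coe_toNNReal _ (sq_nonneg σ),
    ← Finset.sum_neg_distrib]
  refine Finset.sum_congr rfl fun i _ => ?_
  ring

instance isProbabilityMeasure_gaussianNoise (d : ℕ) (σ : ℝ) :
    IsProbabilityMeasure (gaussianNoise d σ) := by
  unfold gaussianNoise; infer_instance

instance isProbabilityMeasure_policy {d : ℕ} (σ : ℝ) (ψ : Param d) (s : E d) :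
    IsProbabilityMeasure (policy σ ψ s) := by
  unfold policy; infer_instance

/-- The Cameron–Martin exponent. -/
noncomputable def cmExp {d : ℕ} (σ : ℝ) (m u : E d) : ℝ := (⟪m, u⟫ - ‖m‖ ^ 2 / 2) / σ ^ 2

theorem continuous_cmExp {d : ℕ} (σ : ℝ) :
    Continuous fun p : E d × E d => cmExp σ p.1 p.2 := by
  unfold cmExp; fun_prop

/-- The Cameron–Martin formula. In coordinates the noise is a product of real Gaussians, and the
exponents of the coordinate shifts add up to `cmExp`. Working with nonnegative functions avoids
integrability conditions. -/
theorem lintegral_gaussianNoise_shift {d : ℕ} {σ : ℝ} (hσ : 0 < σ) (m : E d) {f : E d → ℝ≥0∞}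
    (hf : Measurable f) :
    ∫⁻ u, f (m + u) ∂(gaussianNoise d σ) =
      ∫⁻ u, f u * ENNReal.ofReal (Real.exp (cmExp σ m u)) ∂(gaussianNoise d σ) := by
  set v : ℝ≥0 := (σ ^ 2).toNNReal with hvdef
  have hv : v ≠ 0 := by
    rw [hvdef, Ne, Real.toNNReal_eq_zero, not_le]; positivity
  have hvr : (v : ℝ) = σ ^ 2 := Real.coe_toNNReal _ (sq_nonneg σ)
  set μ : Measure (Fin d → ℝ) := Measure.pi fun _ : Fin d => gaussianReal 0 v with hμ
  have hcm : ∀ m : E d, Continuous (cmExp σ m) := fun m => by unfold cmExp; fun_prop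
  have key : μ.map (fun x i => m i + x i) = μ.withDensity fun x =>
      ENNReal.ofReal (Real.exp (cmExp σ m (WithLp.toLp 2 x))) := by
    rw [hμ, Measure.pi_map_pi (fun i => by fun_prop)]
    simp_rw [gaussianReal_map_const_add_eq_withDensity hv]
    have : ∀ i : Fin d, SigmaFinite ((gaussianReal 0 v).withDensity fun x =>
        ENNReal.ofReal (Real.exp ((m i * x - m i ^ 2 / 2) / v))) := fun i => by
      rw [← gaussianReal_map_const_add_eq_withDensity hv]
      have := Measure.isProbabilityMeasure_map (μ := gaussianReal 0 v) (f := fun x => m i + x)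
        (by fun_prop)
      infer_instance
    rw [pi_withDensity _ (fun i => by fun_prop)]
    congr 1
    funext x
    rw [← ENNReal.ofReal_prod_of_nonneg (fun i _ => (Real.exp_pos _).le), ← Real.exp_sum]
    congr 2
    rw [cmExp, EuclideanSpace.real_norm_sq_eq, hvr, ← Finset.sum_div, Finset.sum_sub_distrib]
    simp [PiLp.inner_apply, Finset.sum_div, mul_comm]
  rw [gaussianNoise_eq_map_pi, lintegral_map (by fun_prop) (by fun_prop),
    lintegral_map (by have := hcm m; fun_prop) (by fun_prop)]
  have h1 : ∀ x : Fin d → ℝ, f (m + WithLp.toLp 2 x) =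
      (fun y : Fin d → ℝ => f (WithLp.toLp 2 y)) (fun i => m i + x i) := fun x => rfl
  simp_rw [h1]
  rw [← hμ, ← lintegral_map (μ := μ) (f := fun y : Fin d → ℝ => f (WithLp.toLp 2 y))
    (g := fun x i => m i + x i) (by fun_prop) (by fun_prop), key,
    lintegral_withDensity_eq_lintegral_mul _ (by have := hcm m; fun_prop)
      (by fun_prop)]
  simp [mul_comm]

end ModelRL

namespace ModelRL

/-! ### Exponential families with quadratic log-likelihood -/

/-- `exp (b y - q y y / 2)` is a family of probability densities, where `b` is a random functional
and `q` a random positive semidefinite form bounded by `lam ^ 2`. -/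
structure QuadFamily (Y : Type*) {Ω : Type*} [NormedAddCommGroup Y] [NormedSpace ℝ Y]
    [MeasurableSpace Ω] (P : Measure Ω) (lam : ℝ) where
  b : Ω → Y →L[ℝ] ℝ
  q : Ω → Y →L[ℝ] Y →L[ℝ] ℝ
  lam_pos : 0 < lam
  b_meas : StronglyMeasurable b
  q_meas : StronglyMeasurable q
  symm : ∀ ω v w, q ω v w = q ω w v
  nonneg : ∀ ω v, 0 ≤ q ω v v
  le : ∀ ω v, q ω v v ≤ lam ^ 2 * ‖v‖ ^ 2
  mass : ∀ y, ∫⁻ ω, ENNReal.ofReal (Real.exp (b ω y - q ω y y / 2)) ∂P = 1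

/-- `f` is `C²`, with the given bounds for the first two derivatives and for the Lipschitz constant
of the second. -/
structure SmoothBound {Y : Type*} [NormedAddCommGroup Y] [NormedSpace ℝ Y] (f : Y → ℝ)
    (B1 B2 B3 : ℝ) : Prop where
  contDiff : ContDiff ℝ 2 f
  d1 : ∀ y, ‖fderiv ℝ f y‖ ≤ B1
  d2 : ∀ y, ‖fderiv ℝ (fderiv ℝ f) y‖ ≤ B2
  d3 : ∀ y y', ‖fderiv ℝ (fderiv ℝ f) y - fderiv ℝ (fderiv ℝ f) y'‖ ≤ B3 * ‖y - y'‖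

/-- `T` grows at most exponentially in `b`, locally uniformly in the parameter. -/
def ExpBdd {Y Ω Z B : Type*} [NormedAddCommGroup Y] [NormedAddCommGroup B] [NormedAddCommGroup Z]
    (b : Ω → B) (T : Ω → Y → Z) : Prop :=
  ∀ R : ℝ, ∃ C : ℝ, 0 ≤ C ∧ ∀ ω y, ‖y‖ ≤ R → ‖T ω y‖ ≤ C * Real.exp (C * ‖b ω‖)

namespace ExpBdd

variable {Y Ω Z Z' Z'' B : Type*} [NormedAddCommGroup Y] [NormedAddCommGroup B]
  [NormedAddCommGroup Z] [NormedAddCommGroup Z'] [NormedAddCommGroup Z''] {b : Ω → B}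

theorem of_le {T : Ω → Y → Z} {T' : Ω → Y → Z'} {T'' : Ω → Y → Z''} (h : ExpBdd b T)
    (h' : ExpBdd b T') (K : ℝ) (hle : ∀ ω y, ‖T'' ω y‖ ≤ K * (‖T ω y‖ * ‖T' ω y‖)) :
    ExpBdd b T'' := by
  intro R
  obtain ⟨C, hC0, hC⟩ := h R
  obtain ⟨C', hC0', hC'⟩ := h' R
  refine ⟨max (|K| * (C * C')) (C + C'), by positivity, fun ω y hy => (hle ω y).trans ?_⟩
  calc K * (‖T ω y‖ * ‖T' ω y‖)
      ≤ |K| * ((C * Real.exp (C * ‖b ω‖)) * (C' * Real.exp (C' * ‖b ω‖))) := by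
        gcongr
        · exact le_abs_self K
        · exact hC ω y hy
        · exact hC' ω y hy
    _ = (|K| * (C * C')) * Real.exp ((C + C') * ‖b ω‖) := by
        rw [add_mul, Real.exp_add]; ring
    _ ≤ _ := by
        gcongr
        · exact le_max_left _ _
        · exact le_max_right _ _

theorem add {T T' : Ω → Y → Z} (h : ExpBdd b T) (h' : ExpBdd b T') :
    ExpBdd b fun ω y => T ω y + T' ω y := by
  intro R
  obtain ⟨C, hC0, hC⟩ := h R
  obtain ⟨C', hC0', hC'⟩ := h' R
  refine ⟨C + C', by positivity, fun ω y hy => (norm_add_le _ _).trans ?_⟩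
  rw [add_mul]
  gcongr
  · refine (hC ω y hy).trans ?_
    gcongr; linarith
  · refine (hC' ω y hy).trans ?_
    gcongr; linarith

theorem const (c : Z) : ExpBdd b fun (_ : Ω) (_ : Y) => c := fun _ =>
  ⟨‖c‖, norm_nonneg _, fun ω _ _ => le_mul_of_one_le_right (norm_nonneg _)
    (Real.one_le_exp (by positivity))⟩

theorem mono {T : Ω → Y → Z} {T' : Ω → Y → Z'} (h : ExpBdd b T)
    (hle : ∀ ω y, ‖T' ω y‖ ≤ ‖T ω y‖) : ExpBdd b T' := fun R => by
  obtain ⟨C, hC0, hC⟩ := h R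
  exact ⟨C, hC0, fun ω y hy => (hle ω y).trans (hC ω y hy)⟩

theorem base : ExpBdd b fun ω (_ : Y) => b ω := fun _ =>
  ⟨1, zero_le_one, fun ω _ _ => by
    have := Real.add_one_le_exp (1 * ‖b ω‖)
    rw [one_mul] at *
    change ‖b ω‖ ≤ _
    rw [one_mul]
    linarith⟩

theorem param : ExpBdd b fun _ (y : Y) => y := fun R =>
  ⟨|R|, abs_nonneg R, fun ω y hy => (hy.trans (le_abs_self R)).trans
    (le_mul_of_one_le_right (abs_nonneg R) (Real.one_le_exp (by positivity)))⟩

theorem smul [NormedSpace ℝ Z] {T : Ω → Y → ℝ} {T' : Ω → Y → Z} (h : ExpBdd b T)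
    (h' : ExpBdd b T') : ExpBdd b fun ω y => T ω y • T' ω y :=
  of_le h h' 1 fun ω y => by rw [norm_smul, one_mul]

theorem bilin [NormedSpace ℝ Z] [NormedSpace ℝ Z'] [NormedSpace ℝ Z''] (L : Z →L[ℝ] Z' →L[ℝ] Z'')
    {T : Ω → Y → Z} {T' : Ω → Y → Z'} (h : ExpBdd b T)
    (h' : ExpBdd b T') : ExpBdd b fun ω y => L (T ω y) (T' ω y) :=
  of_le h h' ‖L‖ fun ω y => by rw [← mul_assoc]; exact L.le_opNorm₂ _ _

end ExpBdd

/-- The sign pattern of `x` itself contributes the left side, and the other terms are positive. This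
replaces the exponential of a norm by finitely many exponentials of linear functionals. -/
theorem exp_sum_abs_le {ι : Type*} [Fintype ι] [DecidableEq ι] (x : ι → ℝ) :
    Real.exp (∑ i, |x i|) ≤ ∑ e : ι → Bool, Real.exp (∑ i, (if e i then 1 else -1) * x i) := by
  classical
  refine le_trans (le_of_eq ?_) (Finset.single_le_sum
    (f := fun e : ι → Bool => Real.exp (∑ i, (if e i then 1 else -1) * x i))
    (fun e _ => (Real.exp_pos _).le) (Finset.mem_univ fun i => decide (0 ≤ x i)))
  congr 1
  refine Finset.sum_congr rfl fun i _ => ?_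
  by_cases h : 0 ≤ x i
  · simp [h, abs_of_nonneg h]
  · simp [h, abs_of_neg (not_le.1 h)]

/-- A single term of the exponential series of `|x|` is below its sum; this turns exponential
moments into polynomial ones. -/
theorem abs_pow_le_exp_add (x : ℝ) (n : ℕ) :
    |x| ^ n ≤ n.factorial * (Real.exp x + Real.exp (-x)) := by
  have h := Real.pow_div_factorial_le_exp |x| (abs_nonneg x) n
  rw [div_le_iff₀ (by positivity), mul_comm] at h
  refine h.trans ?_
  gcongr
  rcases abs_cases x with ⟨h, _⟩ | ⟨h, _⟩ <;> rw [h] <;>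
    linarith [Real.exp_pos x, Real.exp_pos (-x)]

theorem opNorm_le_of_le_one {Y Z : Type*} [NormedAddCommGroup Y] [NormedSpace ℝ Y]
    [NormedAddCommGroup Z] [NormedSpace ℝ Z] {L : Y →L[ℝ] Z} {C : ℝ} (hC : 0 ≤ C)
    (h : ∀ v, ‖v‖ ≤ 1 → ‖L v‖ ≤ C) : ‖L‖ ≤ C :=
  ContinuousLinearMap.opNorm_le_of_unit_norm hC fun v hv => h v hv.le

/-! ### Derivatives of the likelihood ratio and dimension-free moments of the score. -/

namespace QuadFamily

variable {Y Ω : Type*} [NormedAddCommGroup Y] [NormedSpace ℝ Y] [MeasurableSpace Ω]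
  {P : Measure Ω} {lam : ℝ} (𝓕 : QuadFamily Y P lam)

/-- The likelihood ratio. -/
noncomputable def rho (ω : Ω) (y : Y) : ℝ := Real.exp (𝓕.b ω y - 𝓕.q ω y y / 2)

/-- The score functional. -/
noncomputable def score (ω : Ω) (y : Y) : Y →L[ℝ] ℝ := 𝓕.b ω - 𝓕.q ω y

/-- The second derivative of the likelihood ratio divided by the likelihood ratio. -/
noncomputable def score2 (ω : Ω) (y : Y) : Y →L[ℝ] Y →L[ℝ] ℝ :=
  ContinuousLinearMap.smulRightL ℝ Y (Y →L[ℝ] ℝ) (𝓕.score ω y) (𝓕.score ω y) - 𝓕.q ω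

/-- The third derivative of the likelihood ratio divided by the likelihood ratio. -/
noncomputable def score3 (ω : Ω) (y : Y) : Y →L[ℝ] Y →L[ℝ] Y →L[ℝ] ℝ :=
  ContinuousLinearMap.smulRightL ℝ Y (Y →L[ℝ] Y →L[ℝ] ℝ) (𝓕.score ω y) (𝓕.score2 ω y) +
    ((ContinuousLinearMap.smulRightL ℝ Y (Y →L[ℝ] ℝ)).precompR Y (𝓕.score ω y) (-𝓕.q ω) +
      (ContinuousLinearMap.smulRightL ℝ Y (Y →L[ℝ] ℝ)).precompL Y (-𝓕.q ω) (𝓕.score ω y))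

theorem score2_apply (ω : Ω) (y v w : Y) :
    𝓕.score2 ω y v w = 𝓕.score ω y v * 𝓕.score ω y w - 𝓕.q ω v w := by
  simp [score2]

theorem score3_apply (ω : Ω) (y u v w : Y) :
    𝓕.score3 ω y u v w = 𝓕.score ω y u * 𝓕.score2 ω y v w
      - (𝓕.score ω y v * 𝓕.q ω u w + 𝓕.q ω u v * 𝓕.score ω y w) := by
  simp [score3]
  ring

theorem rho_pos (ω : Ω) (y : Y) : 0 < 𝓕.rho ω y := Real.exp_pos _

theorem hasFDerivAt_rho (ω : Ω) (y : Y) :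
    HasFDerivAt (𝓕.rho ω) (𝓕.rho ω y • 𝓕.score ω y) y := by
  have h1 : HasFDerivAt (fun y => 𝓕.q ω y y) ((𝓕.q ω).precompR Y y (ContinuousLinearMap.id ℝ Y) +
      (𝓕.q ω).precompL Y (ContinuousLinearMap.id ℝ Y) y) y :=
    (𝓕.q ω).hasFDerivAt_of_bilinear (hasFDerivAt_id y) (hasFDerivAt_id y)
  have h2 := (((𝓕.b ω).hasFDerivAt (x := y)).sub (h1.mul_const (2⁻¹ : ℝ))).exp
  simp only [← div_eq_mul_inv] at h2
  refine h2.congr_fderiv ?_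
  ext v
  simp [rho, score, 𝓕.symm ω v y]
  ring

theorem hasFDerivAt_score (ω : Ω) (y : Y) : HasFDerivAt (𝓕.score ω) (-𝓕.q ω) y :=
  ((𝓕.q ω).hasFDerivAt (x := y)).const_sub (𝓕.b ω)

theorem hasFDerivAt_rho_score (ω : Ω) (y : Y) :
    HasFDerivAt (fun y => 𝓕.rho ω y • 𝓕.score ω y) (𝓕.rho ω y • 𝓕.score2 ω y) y := by
  refine ((𝓕.hasFDerivAt_rho ω y).smul (𝓕.hasFDerivAt_score ω y)).congr_fderiv ?_
  ext v w
  simp [score2_apply]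
  ring

theorem hasFDerivAt_rho_score2 (ω : Ω) (y : Y) :
    HasFDerivAt (fun y => 𝓕.rho ω y • 𝓕.score2 ω y) (𝓕.rho ω y • 𝓕.score3 ω y) y := by
  have h := ((ContinuousLinearMap.smulRightL ℝ Y (Y →L[ℝ] ℝ)).hasFDerivAt_of_bilinear
    (𝓕.hasFDerivAt_score ω y) (𝓕.hasFDerivAt_score ω y)).sub_const (𝓕.q ω)
  refine ((𝓕.hasFDerivAt_rho ω y).smul h).congr_fderiv ?_
  ext u v w
  simp [score2_apply, score3_apply]
  ring

/-- Positivity of `q` at `v + w` and `v - w` bounds `2 |q v w|` by `q v v + q w w`. -/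
theorem abs_q_le (ω : Ω) {v w : Y} (hv : ‖v‖ ≤ 1) (hw : ‖w‖ ≤ 1) : |𝓕.q ω v w| ≤ lam ^ 2 := by
  have h1 := 𝓕.nonneg ω (v + w)
  have h2 := 𝓕.nonneg ω (v - w)
  have h3 := 𝓕.le ω v
  have h4 := 𝓕.le ω w
  have h5 : lam ^ 2 * ‖v‖ ^ 2 ≤ lam ^ 2 * 1 := by gcongr; exact pow_le_one₀ (norm_nonneg v) hv
  have h6 : lam ^ 2 * ‖w‖ ^ 2 ≤ lam ^ 2 * 1 := by gcongr; exact pow_le_one₀ (norm_nonneg w) hw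
  simp only [map_add, map_sub, add_apply, sub_apply,
    𝓕.symm ω w v] at h1 h2
  rw [abs_le]; constructor <;> linarith

theorem norm_q_le (ω : Ω) : ‖𝓕.q ω‖ ≤ lam ^ 2 :=
  opNorm_le_of_le_one (sq_nonneg _) fun _ hv => opNorm_le_of_le_one (sq_nonneg _) fun _ hw =>
    𝓕.abs_q_le ω hv hw

theorem expBdd_q : ExpBdd 𝓕.b fun ω (_ : Y) => 𝓕.q ω :=
  (ExpBdd.const (lam ^ 2)).mono fun ω _ => by
    rw [Real.norm_of_nonneg (sq_nonneg lam)]; exact 𝓕.norm_q_le ω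

theorem expBdd_rho : ExpBdd 𝓕.b 𝓕.rho := by
  intro R
  refine ⟨max 1 R, by positivity, fun ω y hy => ?_⟩
  rw [Real.norm_of_nonneg (𝓕.rho_pos ω y).le]
  refine le_trans ?_ (le_mul_of_one_le_left (Real.exp_pos _).le (le_max_left 1 R))
  refine Real.exp_le_exp.2 ?_
  have h1 := (le_abs_self _).trans ((𝓕.b ω).le_opNorm y)
  have h2 : ‖𝓕.b ω‖ * ‖y‖ ≤ ‖𝓕.b ω‖ * max 1 R := by gcongr; exact hy.trans (le_max_right _ _)
  linarith [𝓕.nonneg ω y]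

theorem expBdd_score : ExpBdd 𝓕.b 𝓕.score := by
  have h : ExpBdd 𝓕.b fun ω y => 𝓕.q ω y :=
    (ExpBdd.of_le 𝓕.expBdd_q ExpBdd.param 1 fun ω y => by
      rw [one_mul]; exact (𝓕.q ω).le_opNorm y)
  exact (ExpBdd.base.add (h.mono (T' := fun ω y => -𝓕.q ω y) (by simp))).mono (by
    simp [score, sub_eq_add_neg])

theorem expBdd_score2 : ExpBdd 𝓕.b 𝓕.score2 := by
  have h := ExpBdd.bilin (ContinuousLinearMap.smulRightL ℝ Y (Y →L[ℝ] ℝ)) 𝓕.expBdd_score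
    𝓕.expBdd_score
  exact (h.add (𝓕.expBdd_q.mono (T' := fun ω _ => -𝓕.q ω) (by simp))).mono (by
    simp [score2, sub_eq_add_neg])

theorem expBdd_score3 : ExpBdd 𝓕.b 𝓕.score3 := by
  have h1 := ExpBdd.bilin (ContinuousLinearMap.smulRightL ℝ Y (Y →L[ℝ] Y →L[ℝ] ℝ)) 𝓕.expBdd_score
    𝓕.expBdd_score2
  have hq : ExpBdd 𝓕.b fun ω (_ : Y) => -𝓕.q ω := 𝓕.expBdd_q.mono (by simp)
  exact h1.add (((ExpBdd.bilin ((ContinuousLinearMap.smulRightL ℝ Y (Y →L[ℝ] ℝ)).precompR Y)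
    𝓕.expBdd_score hq)).add
      (ExpBdd.bilin ((ContinuousLinearMap.smulRightL ℝ Y (Y →L[ℝ] ℝ)).precompL Y) hq
        𝓕.expBdd_score))

theorem stronglyMeasurable_score (y : Y) : StronglyMeasurable fun ω => 𝓕.score ω y :=
  𝓕.b_meas.sub
    (_root_.StronglyMeasurable.apply_continuousLinearMap 𝓕.q_meas y)

theorem stronglyMeasurable_score_apply (y v : Y) : StronglyMeasurable fun ω => 𝓕.score ω y v :=
  _root_.StronglyMeasurable.apply_continuousLinearMap (𝓕.stronglyMeasurable_score y) v

theorem stronglyMeasurable_rho (y : Y) : StronglyMeasurable fun ω => 𝓕.rho ω y :=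
  Real.continuous_exp.comp_stronglyMeasurable
    ((_root_.StronglyMeasurable.apply_continuousLinearMap 𝓕.b_meas y).sub
      ((continuous_id.div_const 2).comp_stronglyMeasurable
        (_root_.StronglyMeasurable.apply_continuousLinearMap
          (_root_.StronglyMeasurable.apply_continuousLinearMap 𝓕.q_meas y) y)))

theorem stronglyMeasurable_bilin {Z Z' Z'' : Type*} [NormedAddCommGroup Z] [NormedSpace ℝ Z]
    [NormedAddCommGroup Z'] [NormedSpace ℝ Z'] [NormedAddCommGroup Z''] [NormedSpace ℝ Z'']
    (L : Z →L[ℝ] Z' →L[ℝ] Z'') {f : Ω → Z} {g : Ω → Z'} (hf : StronglyMeasurable f)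
    (hg : StronglyMeasurable g) : StronglyMeasurable fun ω => L (f ω) (g ω) :=
  L.continuous₂.comp_stronglyMeasurable (hf.prodMk hg)

theorem stronglyMeasurable_score2 (y : Y) : StronglyMeasurable fun ω => 𝓕.score2 ω y :=
  (stronglyMeasurable_bilin _ (𝓕.stronglyMeasurable_score y) (𝓕.stronglyMeasurable_score y)).sub
    𝓕.q_meas

theorem stronglyMeasurable_score3 (y : Y) : StronglyMeasurable fun ω => 𝓕.score3 ω y :=
  (stronglyMeasurable_bilin _ (𝓕.stronglyMeasurable_score y)
    (𝓕.stronglyMeasurable_score2 y)).add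
    ((stronglyMeasurable_bilin _ (𝓕.stronglyMeasurable_score y) 𝓕.q_meas.neg).add
      (stronglyMeasurable_bilin _ 𝓕.q_meas.neg (𝓕.stronglyMeasurable_score y)))

theorem lintegral_rho (y : Y) : ∫⁻ ω, ENNReal.ofReal (𝓕.rho ω y) ∂P = 1 := 𝓕.mass y

theorem integrable_rho (y : Y) : Integrable (fun ω => 𝓕.rho ω y) P := by
  refine ⟨(𝓕.stronglyMeasurable_rho y).aestronglyMeasurable, ?_⟩
  rw [hasFiniteIntegral_iff_ofReal (.of_forall fun ω => (𝓕.rho_pos ω y).le), 𝓕.lintegral_rho]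
  exact ENNReal.one_lt_top

theorem integral_rho (y : Y) : ∫ ω, 𝓕.rho ω y ∂P = 1 := by
  rw [integral_eq_lintegral_of_nonneg_ae (.of_forall fun ω => (𝓕.rho_pos ω y).le)
    (𝓕.stronglyMeasurable_rho y).aestronglyMeasurable, 𝓕.lintegral_rho, ENNReal.toReal_one]

/-- Re-centring the family at `y` replaces `b` by the score at `y` and leaves `q` unchanged. Every
moment estimate below rests on this identity. -/
theorem rho_add (ω : Ω) (y z : Y) :
    𝓕.rho ω (y + z) = 𝓕.rho ω y * Real.exp (𝓕.score ω y z - 𝓕.q ω z z / 2) := by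
  rw [rho, rho, ← Real.exp_add]
  congr 1
  simp [score, 𝓕.symm ω z y]
  ring

/-- The exponential of `b y` is the density times `exp (q y y / 2)`, and `q` is bounded. -/
theorem integrable_exp_b (y : Y) : Integrable (fun ω => Real.exp (𝓕.b ω y)) P := by
  refine ((𝓕.integrable_rho y).const_mul (Real.exp (lam ^ 2 * ‖y‖ ^ 2 / 2))).mono'
    (Real.continuous_exp.comp_stronglyMeasurable
      (_root_.StronglyMeasurable.apply_continuousLinearMap 𝓕.b_meas y)).aestronglyMeasurable
    (.of_forall fun ω => ?_)
  rw [Real.norm_of_nonneg (Real.exp_pos _).le, rho, ← Real.exp_add]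
  exact Real.exp_le_exp.2 (by linarith [𝓕.le ω y])

/-- The norm of `b` is controlled by its values on a basis. The resulting bound depends on the
dimension, but it serves only as a dominating function for differentiation under the integral and
never enters the final constants. -/
theorem integrable_exp_norm_b [FiniteDimensional ℝ Y] (c : ℝ) :
    Integrable (fun ω => Real.exp (c * ‖𝓕.b ω‖)) P := by
  let v := Module.finBasis ℝ Y
  obtain ⟨K, hK, hle⟩ := v.exists_opNorm_le (F := ℝ)
  have hint : Integrable (fun ω => ∑ e : Fin (Module.finrank ℝ Y) → Bool,
      Real.exp (𝓕.b ω (∑ i, ((if e i then 1 else -1) * (|c| * K) : ℝ) • v i))) P :=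
    integrable_finsetSum _ fun e _ => 𝓕.integrable_exp_b _
  refine hint.mono' (Real.continuous_exp.comp_stronglyMeasurable
    (𝓕.b_meas.norm.const_mul c)).aestronglyMeasurable (.of_forall fun ω => ?_)
  rw [Real.norm_of_nonneg (Real.exp_pos _).le]
  have h1 : ‖𝓕.b ω‖ ≤ K * ∑ i, |𝓕.b ω (v i)| :=
    hle (Finset.sum_nonneg fun i _ => abs_nonneg _) fun i =>
      Finset.single_le_sum (f := fun i => |𝓕.b ω (v i)|) (fun i _ => abs_nonneg _)
        (Finset.mem_univ i)
  have h2 : c * ‖𝓕.b ω‖ ≤ ∑ i, |(|c| * K) * 𝓕.b ω (v i)| := by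
    simp_rw [abs_mul, ← Finset.mul_sum, abs_abs, abs_of_pos hK]
    calc c * ‖𝓕.b ω‖ ≤ |c| * (K * ∑ i, |𝓕.b ω (v i)|) := by
          gcongr; exact le_abs_self c
      _ = _ := by ring
  refine (Real.exp_le_exp.2 h2).trans ((exp_sum_abs_le _).trans (le_of_eq ?_))
  refine Finset.sum_congr rfl fun e _ => ?_
  congr 1
  rw [map_sum]
  refine Finset.sum_congr rfl fun i _ => ?_
  rw [map_smul, smul_eq_mul]; ring

/-- Differentiation under the integral sign. -/
theorem hasFDerivAt_integral [FiniteDimensional ℝ Y] {Z : Type*} [NormedAddCommGroup Z]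
    [NormedSpace ℝ Z] {F : Ω → ℝ} (hF : StronglyMeasurable F) {K : ℝ} (hK : ∀ ω, |F ω| ≤ K)
    {T : Ω → Y → Z} {T' : Ω → Y → Y →L[ℝ] Z} (hT : ExpBdd 𝓕.b T) (hT' : ExpBdd 𝓕.b T')
    (hTm : ∀ y, StronglyMeasurable fun ω => T ω y)
    (hTm' : ∀ y, StronglyMeasurable fun ω => T' ω y)
    (hd : ∀ ω y, HasFDerivAt (T ω) (T' ω y) y) (y : Y) :
    HasFDerivAt (fun y => ∫ ω, F ω • T ω y ∂P) (∫ ω, F ω • T' ω y ∂P) y := by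
  obtain ⟨C, hC0, hC⟩ := hT ‖y‖
  obtain ⟨C', hC0', hC'⟩ := hT' (‖y‖ + 1)
  refine hasFDerivAt_integral_of_dominated_of_fderiv_le (Metric.ball_mem_nhds y one_pos)
    (bound := fun ω => K * (C' * Real.exp (C' * ‖𝓕.b ω‖)))
    (.of_forall fun z => (hF.smul (hTm z)).aestronglyMeasurable) ?_
    (hF.smul (hTm' y)).aestronglyMeasurable (.of_forall fun ω z hz => ?_)
    (((𝓕.integrable_exp_norm_b C').const_mul _).const_mul _)
    (.of_forall fun ω z _ => (hd ω z).const_smul (F ω))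
  · refine (((𝓕.integrable_exp_norm_b C).const_mul C).const_mul K).mono'
      (hF.smul (hTm y)).aestronglyMeasurable (.of_forall fun ω => ?_)
    change ‖F ω • T ω y‖ ≤ _
    rw [norm_smul]
    have := hK ω
    exact mul_le_mul this (hC ω y le_rfl) (norm_nonneg _) ((abs_nonneg _).trans this)
  · rw [norm_smul]
    have := hK ω
    refine mul_le_mul this (hC' ω z ?_) (norm_nonneg _) ((abs_nonneg _).trans this)
    have h := norm_le_norm_add_norm_sub y z
    rw [Metric.mem_ball, dist_eq_norm, norm_sub_rev] at hz
    linarith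

theorem _root_.ModelRL.ExpBdd.integrable [FiniteDimensional ℝ Y] {Z : Type*} [NormedAddCommGroup Z]
    {T : Ω → Y → Z} (hT : ExpBdd 𝓕.b T) (y : Y)
    (hTm : AEStronglyMeasurable (fun ω => T ω y) P) : Integrable (fun ω => T ω y) P := by
  obtain ⟨C, hC0, hC⟩ := hT ‖y‖
  exact ((𝓕.integrable_exp_norm_b C).const_mul C).mono' hTm (.of_forall fun ω => hC ω y le_rfl)

/-- Multiplying by the exponential of the score in direction `v / lam` moves the density from `y` to
`y + v / lam`, up to the factor `exp (q z z / 2) ≤ exp (1 / 2) ≤ 2` with `z = v / lam`. The shifted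
density again has mass one, whatever the dimension. -/
theorem integral_rho_mul_exp_score_le [FiniteDimensional ℝ Y] (y : Y) {v : Y}
    (hv : ‖v‖ ≤ 1) :
    Integrable (fun ω => 𝓕.rho ω y * Real.exp (𝓕.score ω y v / lam)) P ∧
    ∫ ω, 𝓕.rho ω y * Real.exp (𝓕.score ω y v / lam) ∂P ≤ 2 := by
  have hl := 𝓕.lam_pos
  set z := lam⁻¹ • v with hz
  have hle : ∀ ω, 𝓕.rho ω y * Real.exp (𝓕.score ω y v / lam) ≤ 2 * 𝓕.rho ω (y + z) := by
    intro ω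
    have h2 : Real.exp (𝓕.q ω z z / 2) ≤ 2 := by
      have h3 : 𝓕.q ω z z ≤ 1 := by
        refine (𝓕.le ω z).trans ?_
        rw [hz, norm_smul, norm_inv, Real.norm_of_nonneg hl.le, mul_pow, ← mul_assoc, ← mul_pow,
          mul_inv_cancel₀ hl.ne', one_pow, one_mul]
        exact pow_le_one₀ (norm_nonneg v) hv
      calc Real.exp (𝓕.q ω z z / 2) ≤ Real.exp (1 / 2) := Real.exp_le_exp.2 (by linarith)
        _ ≤ 2 := by
          rw [← Real.le_log_iff_exp_le two_pos]
          linarith [Real.log_two_gt_d9]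
    have h4 : 𝓕.score ω y v / lam = (𝓕.score ω y z - 𝓕.q ω z z / 2) + 𝓕.q ω z z / 2 := by
      rw [hz]; simp; ring
    rw [h4, Real.exp_add, ← mul_assoc, ← rho_add, mul_comm]
    exact mul_le_mul_of_nonneg_right h2 (𝓕.rho_pos _ _).le
  have hint : Integrable (fun ω => 𝓕.rho ω y * Real.exp (𝓕.score ω y v / lam)) P := by
    refine ((𝓕.integrable_rho (y + z)).const_mul 2).mono'
      ((𝓕.stronglyMeasurable_rho y).mul (Real.continuous_exp.comp_stronglyMeasurable
        ((continuous_id.div_const lam).comp_stronglyMeasurable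
          (𝓕.stronglyMeasurable_score_apply y v)))).aestronglyMeasurable (.of_forall fun ω => ?_)
    rw [Real.norm_of_nonneg (mul_pos (𝓕.rho_pos _ _) (Real.exp_pos _)).le]
    exact hle ω
  refine ⟨hint, (integral_mono hint ((𝓕.integrable_rho (y + z)).const_mul 2) hle).trans ?_⟩
  rw [integral_const_mul, 𝓕.integral_rho, mul_one]

/-- All moments of the score are bounded, independently of the dimension. -/
theorem integral_rho_mul_score_pow_le [FiniteDimensional ℝ Y] (y : Y) {v : Y}
    (hv : ‖v‖ ≤ 1) (n : ℕ) :
    Integrable (fun ω => 𝓕.rho ω y * |𝓕.score ω y v| ^ n) P ∧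
    ∫ ω, 𝓕.rho ω y * |𝓕.score ω y v| ^ n ∂P ≤ 4 * n.factorial * lam ^ n := by
  have hl := 𝓕.lam_pos
  obtain ⟨hi1, h1⟩ := 𝓕.integral_rho_mul_exp_score_le y hv
  obtain ⟨hi2, h2⟩ := 𝓕.integral_rho_mul_exp_score_le y (v := -v) (by rwa [norm_neg])
  -- The exponential moments in the directions `v` and `-v` are each at most 2, whence the factor 4.
  have hle : ∀ ω, 𝓕.rho ω y * |𝓕.score ω y v| ^ n ≤
      (n.factorial * lam ^ n) * (𝓕.rho ω y * Real.exp (𝓕.score ω y v / lam) +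
        𝓕.rho ω y * Real.exp (𝓕.score ω y (-v) / lam)) := by
    intro ω
    have h := abs_pow_le_exp_add (𝓕.score ω y v / lam) n
    rw [abs_div, div_pow, abs_of_pos hl, div_le_iff₀ (by positivity)] at h
    refine (mul_le_mul_of_nonneg_left h (𝓕.rho_pos ω y).le).trans (le_of_eq ?_)
    rw [map_neg, neg_div]; ring
  have hint : Integrable (fun ω => 𝓕.rho ω y * |𝓕.score ω y v| ^ n) P := by
    refine ((hi1.add hi2).const_mul (n.factorial * lam ^ n)).mono'
      ((𝓕.stronglyMeasurable_rho y).mul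
        ((𝓕.stronglyMeasurable_score_apply y v).norm.pow n)).aestronglyMeasurable
      (.of_forall fun ω => ?_)
    rw [Real.norm_of_nonneg (mul_nonneg (𝓕.rho_pos _ _).le (by positivity))]
    exact hle ω
  refine ⟨hint, (integral_mono hint ((hi1.add hi2).const_mul _) hle).trans ?_⟩
  rw [integral_const_mul, integral_add' hi1 hi2]
  have : 0 ≤ n.factorial * lam ^ n := by positivity
  nlinarith

variable {F : Ω → ℝ} {K : ℝ}

theorem three_mul_mul_mul_le {a b c : ℝ} (ha : 0 ≤ a) (hb : 0 ≤ b) (hc : 0 ≤ c) :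
    3 * (a * b * c) ≤ a ^ 3 + b ^ 3 + c ^ 3 := by
  have h := mul_nonneg (add_nonneg (add_nonneg ha hb) hc)
    (add_nonneg (add_nonneg (sq_nonneg (a - b)) (sq_nonneg (b - c))) (sq_nonneg (a - c)))
  linarith

theorem integral_add_add {Ω : Type*} [MeasurableSpace Ω] {P : Measure Ω} {f g h : Ω → ℝ}
    (hf : Integrable f P) (hg : Integrable g P) (hh : Integrable h P) :
    Integrable (fun ω => f ω + g ω + h ω) P ∧
    ∫ ω, f ω + g ω + h ω ∂P = ∫ ω, f ω ∂P + ∫ ω, g ω ∂P + ∫ ω, h ω ∂P := by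
  have hs : Integrable (fun ω => f ω + g ω) P := hf.add hg
  exact ⟨hs.add hh, by rw [integral_add hs hh, integral_add hf hg]⟩

theorem abs_integral_mul_le {Ω : Type*} [MeasurableSpace Ω] {P : Measure Ω} {F : Ω → ℝ} {K : ℝ}
    (hK0 : 0 ≤ K) (hK : ∀ ω, |F ω| ≤ K) {g h : Ω → ℝ}
    (hh : Integrable h P) (hgh : ∀ ω, |g ω| ≤ h ω) {B : ℝ} (hB : ∫ ω, h ω ∂P ≤ B) :
    |∫ ω, F ω * g ω ∂P| ≤ K * B := by
  calc |∫ ω, F ω * g ω ∂P| ≤ ∫ ω, K * h ω ∂P := by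
        rw [← Real.norm_eq_abs]
        refine norm_integral_le_of_norm_le (hh.const_mul K) (.of_forall fun ω => ?_)
        rw [Real.norm_eq_abs, abs_mul]
        exact mul_le_mul (hK ω) (hgh ω) (abs_nonneg _) hK0
    _ ≤ K * B := by rw [integral_const_mul]; gcongr

/-- The integral of a bounded function against an exponential family is `C²` in the parameter,
with bounds that do not depend on the dimension. -/
theorem smoothBound_integral [FiniteDimensional ℝ Y] (hF : StronglyMeasurable F) (hK0 : 0 ≤ K)
    (hK : ∀ ω, |F ω| ≤ K) :
    SmoothBound (fun y => ∫ ω, F ω * 𝓕.rho ω y ∂P) (36 * K * lam) (36 * K * lam ^ 2)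
      (36 * K * lam ^ 3) := by
  have hl := 𝓕.lam_pos
  have e1 := 𝓕.expBdd_rho.smul 𝓕.expBdd_score
  have e2 := 𝓕.expBdd_rho.smul 𝓕.expBdd_score2
  have e3 := 𝓕.expBdd_rho.smul 𝓕.expBdd_score3
  have m1 := fun y => (𝓕.stronglyMeasurable_rho y).smul (𝓕.stronglyMeasurable_score y)
  have m2 := fun y => (𝓕.stronglyMeasurable_rho y).smul (𝓕.stronglyMeasurable_score2 y)
  have m3 := fun y => (𝓕.stronglyMeasurable_rho y).smul (𝓕.stronglyMeasurable_score3 y)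
  -- All derivatives fall on the likelihood ratio, so `F` needs no regularity beyond being bounded
  -- and measurable.
  have d1 : ∀ y, HasFDerivAt (fun y => ∫ ω, F ω * 𝓕.rho ω y ∂P)
      (∫ ω, F ω • 𝓕.rho ω y • 𝓕.score ω y ∂P) y := fun y =>
    𝓕.hasFDerivAt_integral hF hK 𝓕.expBdd_rho e1 𝓕.stronglyMeasurable_rho m1
      𝓕.hasFDerivAt_rho y
  have d2 : ∀ y, HasFDerivAt (fun y => ∫ ω, F ω • 𝓕.rho ω y • 𝓕.score ω y ∂P)
      (∫ ω, F ω • 𝓕.rho ω y • 𝓕.score2 ω y ∂P) y := fun y =>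
    𝓕.hasFDerivAt_integral hF hK e1 e2 m1 m2 𝓕.hasFDerivAt_rho_score y
  have d3 : ∀ y, HasFDerivAt (fun y => ∫ ω, F ω • 𝓕.rho ω y • 𝓕.score2 ω y ∂P)
      (∫ ω, F ω • 𝓕.rho ω y • 𝓕.score3 ω y ∂P) y := fun y =>
    𝓕.hasFDerivAt_integral hF hK e2 e3 m2 m3 𝓕.hasFDerivAt_rho_score2 y
  have eF : ∀ {Z : Type _} [NormedAddCommGroup Z] [NormedSpace ℝ Z] {T : Ω → Y → Z},
      ExpBdd 𝓕.b T → (∀ y, StronglyMeasurable fun ω => T ω y) → ∀ y,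
      Integrable (fun ω => F ω • T ω y) P := fun hT hTm y =>
    (hT.integrable 𝓕 y (hTm y).aestronglyMeasurable).bdd_smul K hF.aestronglyMeasurable
      (.of_forall hK)
  have i1 := eF e1 m1
  have i2 := eF e2 m2
  have i3 := eF e3 m3
  have f1 : fderiv ℝ (fun y => ∫ ω, F ω * 𝓕.rho ω y ∂P) =
      fun y => ∫ ω, F ω • 𝓕.rho ω y • 𝓕.score ω y ∂P := funext fun y => (d1 y).fderiv
  have f2 : fderiv ℝ (fun y => ∫ ω, F ω • 𝓕.rho ω y • 𝓕.score ω y ∂P) =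
      fun y => ∫ ω, F ω • 𝓕.rho ω y • 𝓕.score2 ω y ∂P := funext fun y => (d2 y).fderiv
  refine ⟨?_, ?_, ?_, ?_⟩
  · rw [show (2 : WithTop ℕ∞) = ((1 : ℕ) : WithTop ℕ∞) + 1 by norm_num,
      contDiff_succ_iff_hasFDerivAt]
    refine ⟨_, ?_, d1⟩
    rw [Nat.cast_one, contDiff_one_iff_hasFDerivAt]
    -- The second derivative is continuous because a third one exists.
    exact ⟨_, continuous_iff_continuousAt.2 fun y => (d3 y).continuousAt, d2⟩
  · intro y
    rw [f1]
    refine opNorm_le_of_le_one (by positivity) fun v hv => ?_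
    rw [ContinuousLinearMap.integral_apply (i1 y)]
    obtain ⟨hi, hb⟩ := 𝓕.integral_rho_mul_score_pow_le y hv 1
    refine (abs_integral_mul_le hK0 hK hi (fun ω => ?_) hb).trans ?_
    · simp [abs_mul, abs_of_pos (𝓕.rho_pos ω y)]
    · norm_num
      nlinarith [mul_nonneg hK0 hl.le]
  · intro y
    rw [f1, f2]
    refine opNorm_le_of_le_one (by positivity) fun v hv =>
      opNorm_le_of_le_one (by positivity) fun w hw => ?_
    rw [ContinuousLinearMap.integral_apply (i2 y),
      ContinuousLinearMap.integral_apply ((i2 y).apply_continuousLinearMap v)]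
    obtain ⟨hi, hb⟩ := 𝓕.integral_rho_mul_score_pow_le y hv 2
    obtain ⟨hi', hb'⟩ := 𝓕.integral_rho_mul_score_pow_le y hw 2
    have hr := 𝓕.integrable_rho y
    refine (abs_integral_mul_le hK0 hK (g := fun ω => 𝓕.rho ω y * 𝓕.score2 ω y v w)
      (h := fun ω => 𝓕.rho ω y * |𝓕.score ω y v| ^ 2 + 𝓕.rho ω y * |𝓕.score ω y w| ^ 2 +
        lam ^ 2 * 𝓕.rho ω y) (B := 36 * lam ^ 2)
      ((hi.add hi').add (hr.const_mul _)) (fun ω => ?_) ?_).trans (le_of_eq (by ring))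
    · rw [abs_mul, abs_of_pos (𝓕.rho_pos ω y), score2_apply]
      have h1 := abs_sub (𝓕.score ω y v * 𝓕.score ω y w) (𝓕.q ω v w)
      have h2 := 𝓕.abs_q_le ω hv hw
      rw [abs_mul] at h1
      have h3 := two_mul_le_add_sq |𝓕.score ω y v| |𝓕.score ω y w|
      have h4 : |𝓕.score ω y v * 𝓕.score ω y w - 𝓕.q ω v w| ≤
          |𝓕.score ω y v| ^ 2 + |𝓕.score ω y w| ^ 2 + lam ^ 2 := by
        have h5 := mul_nonneg (abs_nonneg (𝓕.score ω y v)) (abs_nonneg (𝓕.score ω y w))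
        linarith
      refine (mul_le_mul_of_nonneg_left h4 (𝓕.rho_pos ω y).le).trans (le_of_eq (by ring))
    · rw [(integral_add_add hi hi' (hr.const_mul _)).2, integral_const_mul, 𝓕.integral_rho]
      norm_num [Nat.factorial] at hb hb' ⊢
      linarith [sq_nonneg lam]
  · intro y y'
    rw [f1, f2]
    refine Convex.norm_image_sub_le_of_norm_hasFDerivWithin_le (s := Set.univ)
      (fun z _ => (d3 z).hasFDerivWithinAt) (fun z _ => ?_) convex_univ trivial trivial
    refine opNorm_le_of_le_one (by positivity) fun u hu =>
      opNorm_le_of_le_one (by positivity) fun v hv =>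
      opNorm_le_of_le_one (by positivity) fun w hw => ?_
    rw [ContinuousLinearMap.integral_apply (i3 z),
      ContinuousLinearMap.integral_apply ((i3 z).apply_continuousLinearMap u),
      ContinuousLinearMap.integral_apply
        (((i3 z).apply_continuousLinearMap u).apply_continuousLinearMap v)]
    obtain ⟨hi, hb⟩ := 𝓕.integral_rho_mul_score_pow_le z hu 3
    obtain ⟨hi', hb'⟩ := 𝓕.integral_rho_mul_score_pow_le z hv 3
    obtain ⟨hi'', hb''⟩ := 𝓕.integral_rho_mul_score_pow_le z hw 3
    obtain ⟨gi, gb⟩ := 𝓕.integral_rho_mul_score_pow_le z hu 1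
    obtain ⟨gi', gb'⟩ := 𝓕.integral_rho_mul_score_pow_le z hv 1
    obtain ⟨gi'', gb''⟩ := 𝓕.integral_rho_mul_score_pow_le z hw 1
    -- The product of three scores is split by the arithmetic-geometric mean inequality into single
    -- directions. The third moments contribute `4 * 3! = 24` and the three first moments `3 * 4 =
    -- 12`, in total 36; the lower orders need only 4 and 17.
    refine (abs_integral_mul_le hK0 hK (g := fun ω => 𝓕.rho ω z * 𝓕.score3 ω z u v w)
      (h := fun ω => 3⁻¹ * (𝓕.rho ω z * |𝓕.score ω z u| ^ 3 + 𝓕.rho ω z * |𝓕.score ω z v| ^ 3 +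
        𝓕.rho ω z * |𝓕.score ω z w| ^ 3) + lam ^ 2 * (𝓕.rho ω z * |𝓕.score ω z u| ^ 1 +
          𝓕.rho ω z * |𝓕.score ω z v| ^ 1 + 𝓕.rho ω z * |𝓕.score ω z w| ^ 1))
      (B := 36 * lam ^ 3) ((((hi.add hi').add hi'').const_mul _).add
        (((gi.add gi').add gi'').const_mul _)) (fun ω => ?_) ?_).trans (le_of_eq (by ring))
    · rw [abs_mul, abs_of_pos (𝓕.rho_pos ω z), score3_apply, score2_apply]
      have q1 := 𝓕.abs_q_le ω hv hw
      have q2 := 𝓕.abs_q_le ω hu hw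
      have q3 := 𝓕.abs_q_le ω hu hv
      set x := 𝓕.score ω z u
      set y := 𝓕.score ω z v
      set t := 𝓕.score ω z w
      have h1 : |x * (y * t - 𝓕.q ω v w) - (y * 𝓕.q ω u w + 𝓕.q ω u v * t)| ≤
          |x| * |y| * |t| + lam ^ 2 * (|x| + |y| + |t|) := by
        have a1 := abs_sub (x * (y * t - 𝓕.q ω v w)) (y * 𝓕.q ω u w + 𝓕.q ω u v * t)
        have a2 := abs_sub (y * t) (𝓕.q ω v w)
        have a3 := abs_add_le (y * 𝓕.q ω u w) (𝓕.q ω u v * t)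
        rw [abs_mul] at a1 a2
        rw [abs_mul, abs_mul] at a3
        have k1 := mul_le_mul_of_nonneg_left q1 (abs_nonneg x)
        have k2 := mul_le_mul_of_nonneg_left q2 (abs_nonneg y)
        have k3 := mul_le_mul_of_nonneg_right q3 (abs_nonneg t)
        have k4 := mul_le_mul_of_nonneg_left a2 (abs_nonneg x)
        linarith
      have h2 := three_mul_mul_mul_le (abs_nonneg x) (abs_nonneg y) (abs_nonneg t)
      have h3 : |x * (y * t - 𝓕.q ω v w) - (y * 𝓕.q ω u w + 𝓕.q ω u v * t)| ≤
          3⁻¹ * (|x| ^ 3 + |y| ^ 3 + |t| ^ 3) + lam ^ 2 * (|x| + |y| + |t|) := by linarith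
      refine (mul_le_mul_of_nonneg_left h3 (𝓕.rho_pos ω z).le).trans (le_of_eq (by ring))
    · obtain ⟨j, hj⟩ := integral_add_add hi hi' hi''
      obtain ⟨k, hk⟩ := integral_add_add gi gi' gi''
      rw [integral_add (j.const_mul _) (k.const_mul _),
        integral_const_mul, integral_const_mul, hj, hk]
      norm_num [Nat.factorial] at hb hb' hb'' gb gb' gb'' ⊢
      have e0 : lam ^ 3 = lam ^ 2 * lam := by ring
      have k1 := mul_le_mul_of_nonneg_left gb (sq_nonneg lam)
      have k2 := mul_le_mul_of_nonneg_left gb' (sq_nonneg lam)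
      have k3 := mul_le_mul_of_nonneg_left gb'' (sq_nonneg lam)
      rw [mul_add (lam ^ 2), mul_add (lam ^ 2)]
      linarith

/-- A bound for expectations under one member of the family by second moments under another. -/
theorem sq_integral_le (hF : StronglyMeasurable F) (hK : ∀ ω, |F ω| ≤ K) (y z : Y) :
    (∫ ω, F ω * 𝓕.rho ω (y + z) ∂P) ^ 2 ≤
      Real.exp (lam ^ 2 * ‖z‖ ^ 2) * ∫ ω, F ω ^ 2 * 𝓕.rho ω y ∂P := by
  -- The square of the density at `y + z` over that at `y` is the density at `y + 2 z` up to the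
  -- factor `exp (q z z)`, so its integral is controlled by the mass of the family.
  have hle : ∀ ω, 𝓕.rho ω (y + z) ^ 2 ≤
      Real.exp (lam ^ 2 * ‖z‖ ^ 2) * 𝓕.rho ω (y + (2 : ℝ) • z) * 𝓕.rho ω y := by
    intro ω
    rw [𝓕.rho_add, 𝓕.rho_add, mul_pow, ← Real.exp_nat_mul]
    calc 𝓕.rho ω y ^ 2 * Real.exp ((2 : ℕ) * (𝓕.score ω y z - 𝓕.q ω z z / 2))
        ≤ 𝓕.rho ω y ^ 2 * Real.exp (lam ^ 2 * ‖z‖ ^ 2 +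
            (𝓕.score ω y ((2 : ℝ) • z) - 𝓕.q ω ((2 : ℝ) • z) ((2 : ℝ) • z) / 2)) := by
          refine mul_le_mul_of_nonneg_left (Real.exp_le_exp.2 ?_) (sq_nonneg _)
          have := 𝓕.le ω z
          simp only [map_smul, smul_apply, smul_eq_mul]
          push_cast
          linarith
      _ = _ := by rw [Real.exp_add]; ring
  have i1 : Integrable (fun ω => F ω * 𝓕.rho ω (y + z)) P :=
    (𝓕.integrable_rho _).bdd_mul (c := K) hF.aestronglyMeasurable (.of_forall hK)
  have i2 : Integrable (fun ω => F ω ^ 2 * 𝓕.rho ω y) P :=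
    (𝓕.integrable_rho _).bdd_mul (c := K ^ 2) (hF.pow 2).aestronglyMeasurable
      (.of_forall fun ω => by
        rw [norm_pow]; exact pow_le_pow_left₀ (norm_nonneg _) (hK ω) 2)
  have i3 := (𝓕.integrable_rho (y + (2 : ℝ) • z)).const_mul (Real.exp (lam ^ 2 * ‖z‖ ^ 2))
  -- Cauchy–Schwarz through a discriminant: pointwise, the quadratic dominates the square of `t F
  -- ρ(y) - ρ(y + z)` divided by `ρ(y)`.
  have hq : ∀ t : ℝ, 0 ≤ (∫ ω, F ω ^ 2 * 𝓕.rho ω y ∂P) * (t * t) +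
      (-2 * ∫ ω, F ω * 𝓕.rho ω (y + z) ∂P) * t + Real.exp (lam ^ 2 * ‖z‖ ^ 2) := by
    intro t
    have h0 : ∀ ω, 0 ≤ t ^ 2 * (F ω ^ 2 * 𝓕.rho ω y) + (-2 * t) * (F ω * 𝓕.rho ω (y + z)) +
        Real.exp (lam ^ 2 * ‖z‖ ^ 2) * 𝓕.rho ω (y + (2 : ℝ) • z) := by
      intro ω
      have hp := 𝓕.rho_pos ω y
      refine nonneg_of_mul_nonneg_left (b := 𝓕.rho ω y) ?_ hp
      nlinarith [hle ω, sq_nonneg (t * F ω * 𝓕.rho ω y - 𝓕.rho ω (y + z))]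
    obtain ⟨-, hs⟩ := integral_add_add (i2.const_mul (t ^ 2)) (i1.const_mul (-2 * t)) i3
    have h1 := integral_nonneg (μ := P) (Pi.le_def.2 h0)
    rw [hs, integral_const_mul, integral_const_mul, integral_const_mul, 𝓕.integral_rho] at h1
    linarith
  have := discrim_le_zero hq
  rw [discrim] at this
  linarith

end QuadFamily

/-! ### Smooth functions composed with affine maps. -/

namespace SmoothBound

variable {Y Y' : Type*} [NormedAddCommGroup Y] [NormedSpace ℝ Y] [NormedAddCommGroup Y']
  [NormedSpace ℝ Y'] {f : Y → ℝ} {B1 B2 B3 : ℝ}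

theorem hasFDerivAt (h : SmoothBound f B1 B2 B3) (y : Y) : HasFDerivAt f (fderiv ℝ f y) y :=
  (h.contDiff.differentiable (by norm_num) y).hasFDerivAt

theorem hasFDerivAt_fderiv (h : SmoothBound f B1 B2 B3) (y : Y) :
    HasFDerivAt (fderiv ℝ f) (fderiv ℝ (fderiv ℝ f) y) y :=
  ((h.contDiff.fderiv_right (m := 1) (by norm_num)).differentiable (by norm_num) y).hasFDerivAt

theorem lip (h : SmoothBound f B1 B2 B3) (y y' : Y) : |f y - f y'| ≤ B1 * ‖y - y'‖ :=
  Convex.norm_image_sub_le_of_norm_fderiv_le (s := Set.univ) (𝕜 := ℝ)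
    (fun z _ => (h.hasFDerivAt z).differentiableAt) (fun z _ => h.d1 z) convex_univ trivial trivial

theorem lip_fderiv (h : SmoothBound f B1 B2 B3) (y y' : Y) :
    ‖fderiv ℝ f y - fderiv ℝ f y'‖ ≤ B2 * ‖y - y'‖ :=
  Convex.norm_image_sub_le_of_norm_fderiv_le (s := Set.univ) (𝕜 := ℝ)
    (fun z _ => (h.hasFDerivAt_fderiv z).differentiableAt) (fun z _ => h.d2 z) convex_univ trivial
      trivial

/-- The second derivative of the composition of `f` with an affine map. -/
noncomputable def pull (L : Y' →L[ℝ] Y) (D : Y →L[ℝ] Y →L[ℝ] ℝ) : Y' →L[ℝ] Y' →L[ℝ] ℝ :=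
  ((ContinuousLinearMap.compL ℝ Y' Y ℝ).flip L).comp (D.comp L)

@[simp] theorem pull_apply (L : Y' →L[ℝ] Y) (D : Y →L[ℝ] Y →L[ℝ] ℝ) (v w : Y') :
    pull L D v w = D (L v) (L w) := rfl

theorem fderiv_comp_affine (h : SmoothBound f B1 B2 B3) (L : Y' →L[ℝ] Y) (c : Y) :
    fderiv ℝ (fun y => f (L y + c)) = fun y => (fderiv ℝ f (L y + c)).comp L := by
  funext y
  exact ((h.hasFDerivAt _).comp y (L.hasFDerivAt.add_const c)).fderiv

theorem fderiv_fderiv_comp_affine (h : SmoothBound f B1 B2 B3) (L : Y' →L[ℝ] Y) (c : Y) (y : Y') :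
    fderiv ℝ (fderiv ℝ fun y => f (L y + c)) y =
      pull L (fderiv ℝ (fderiv ℝ f) (L y + c)) := by
  rw [h.fderiv_comp_affine]
  have h1 : HasFDerivAt (fun y => fderiv ℝ f (L y + c))
      ((fderiv ℝ (fderiv ℝ f) (L y + c)).comp L) y :=
    (h.hasFDerivAt_fderiv _).comp y (L.hasFDerivAt.add_const c)
  exact ((((ContinuousLinearMap.compL ℝ Y' Y ℝ).flip L).hasFDerivAt).comp y h1).fderiv

theorem contDiff_comp_affine (h : SmoothBound f B1 B2 B3) (L : Y' →L[ℝ] Y) (c : Y) :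
    ContDiff ℝ 2 fun y => f (L y + c) :=
  h.contDiff.comp (L.contDiff.add contDiff_const)

end SmoothBound

end ModelRL

namespace ModelRL

/-! ### Policy parameters as linear maps -/

variable {d : ℕ}

/-- `act` as a bilinear map. -/
noncomputable def actL (d : ℕ) : Param d →L[ℝ] E d →L[ℝ] E d :=
  LinearMap.toContinuousLinearMap
    { toFun := act
      map_add' := fun ψ φ => by
        unfold act
        rw [← map_add]
        rfl
      map_smul' := fun c ψ => by
        unfold act
        rw [RingHom.id_apply, ← map_smul]
        rfl }

@[simp] theorem actL_apply (ψ : Param d) : actL d ψ = act ψ := rfl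

theorem act_add (ψ φ : Param d) : act (ψ + φ) = act ψ + act φ := (actL d).map_add ψ φ

@[simp] theorem act_zero : act (0 : Param d) = 0 := (actL d).map_zero

theorem continuous_act : Continuous fun p : Param d × E d => act p.1 p.2 :=
  (actL d).continuous₂

/-- Cauchy–Schwarz in each row: the operator norm is at most the Frobenius norm. -/
theorem norm_act_le (ψ : Param d) : ‖act ψ‖ ≤ ‖ψ‖ := by
  refine ContinuousLinearMap.opNorm_le_bound _ (norm_nonneg _) fun s => ?_
  refine le_of_sq_le_sq ?_ (by positivity)
  rw [mul_pow, EuclideanSpace.real_norm_sq_eq, EuclideanSpace.real_norm_sq_eq,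
    EuclideanSpace.real_norm_sq_eq, Fintype.sum_prod_type, Finset.sum_mul]
  refine Finset.sum_le_sum fun i _ => ?_
  exact Finset.sum_mul_sq_le_sq_mul_sq Finset.univ (fun j => ψ (i, j)) s

/-- The linear map `ψ ↦ ψ s`. -/
noncomputable def evalAt (s : E d) : Param d →L[ℝ] E d := (actL d).flip s

@[simp] theorem evalAt_apply (s : E d) (ψ : Param d) : evalAt s ψ = act ψ s := rfl

theorem continuous_evalAt : Continuous fun s : E d => evalAt s := (actL d).flip.continuous

/-- The source of dimension-freeness: for a state in the unit ball, the mean of the action is a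
contraction of the matrix in Frobenius norm. -/
theorem norm_evalAt_le (s : E d) : ‖evalAt s‖ ≤ ‖s‖ :=
  ContinuousLinearMap.opNorm_le_bound _ (norm_nonneg _) fun ψ => by
    rw [evalAt_apply, mul_comm]
    exact ((act ψ).le_opNorm s).trans (by gcongr; exact norm_act_le ψ)

/-- The inner product as a bilinear map. -/
noncomputable def innerL (d : ℕ) : E d →L[ℝ] E d →L[ℝ] ℝ := innerSL ℝ

@[simp] theorem innerL_apply (v w : E d) : innerL d v w = ⟪v, w⟫ := rfl

/-! ### Likelihood ratios of sequences of Gaussian steps -/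

section Steps

variable {Y Ω : Type*} [NormedAddCommGroup Y] [NormedSpace ℝ Y] [MeasurableSpace Ω]

/-- The linear part of the log-likelihood of a Gaussian step. -/
noncomputable def stepB (σ : ℝ) (a : E d) (L : Y →L[ℝ] E d) : Y →L[ℝ] ℝ :=
  (σ ^ 2)⁻¹ • (innerL d a).comp L

/-- The quadratic part of the log-likelihood of a Gaussian step. -/
noncomputable def stepQ (σ : ℝ) (L : Y →L[ℝ] E d) : Y →L[ℝ] Y →L[ℝ] ℝ :=
  (σ ^ 2)⁻¹ • SmoothBound.pull L (innerL d)

theorem stepB_apply (σ : ℝ) (a : E d) (L : Y →L[ℝ] E d) (v : Y) :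
    stepB σ a L v = (σ ^ 2)⁻¹ * ⟪a, L v⟫ := rfl

theorem stepQ_apply (σ : ℝ) (L : Y →L[ℝ] E d) (v w : Y) :
    stepQ σ L v w = (σ ^ 2)⁻¹ * ⟪L v, L w⟫ := rfl

/-- A mean linear in the parameter makes the Cameron–Martin exponent a linear term minus half a
quadratic form, the shape of `QuadFamily`. -/
theorem cmExp_eq (σ : ℝ) (a : E d) (L : Y →L[ℝ] E d) (v : Y) :
    cmExp σ (L v) a = stepB σ a L v - stepQ σ L v v / 2 := by
  rw [stepB_apply, stepQ_apply, cmExp, real_inner_self_eq_norm_sq, real_inner_comm]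
  ring

theorem continuous_stepB (σ : ℝ) :
    Continuous fun p : E d × (Y →L[ℝ] E d) => stepB σ p.1 p.2 := by
  have h : Continuous fun p : E d × (Y →L[ℝ] E d) => (innerL d p.1).comp p.2 :=
    ((innerL d).continuous.comp continuous_fst).clm_comp continuous_snd
  exact (continuous_const_smul (σ ^ 2)⁻¹).comp h

theorem continuous_stepQ (σ : ℝ) :
    Continuous fun L : Y →L[ℝ] E d => stepQ σ L := by
  have h1 : Continuous fun L : Y →L[ℝ] E d => (ContinuousLinearMap.compL ℝ Y (E d) ℝ).flip L :=
    (ContinuousLinearMap.compL ℝ Y (E d) ℝ).flip.continuous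
  have h2 : Continuous fun L : Y →L[ℝ] E d => (innerL d).comp L :=
    continuous_const.clm_comp continuous_id
  have h : Continuous fun L : Y →L[ℝ] E d => SmoothBound.pull L (innerL d) := h1.clm_comp h2
  exact (continuous_const_smul (σ ^ 2)⁻¹).comp h

variable {P : Measure Ω} {σ : ℝ} {n : ℕ}

theorem sum_cmExp_eq (A : Fin n → Y →L[ℝ] E d) (a : Fin n → E d) (y : Y) :
    ∑ i, cmExp σ (A i y) (a i) =
      (∑ i, stepB σ (a i) (A i)) y - (∑ i, stepQ σ (A i)) y y / 2 := by
  simp only [sum_apply, cmExp_eq]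
  rw [Finset.sum_sub_distrib, Finset.sum_div]

/-- Each step contributes at most `‖v‖ ^ 2 / σ ^ 2`. The factor `n` is weakened to `(n + 1) ^ 2` so
that the length scale is positive even without steps. -/
theorem sum_stepQ_le (hσ : 0 < σ) {A : Fin n → Y →L[ℝ] E d} (hA1 : ∀ i, ‖A i‖ ≤ 1) (v : Y) :
    (∑ i, stepQ σ (A i)) v v ≤ ((n + 1) / σ) ^ 2 * ‖v‖ ^ 2 := by
  simp only [sum_apply, stepQ_apply, real_inner_self_eq_norm_sq]
  calc ∑ i, (σ ^ 2)⁻¹ * ‖A i v‖ ^ 2 ≤ ∑ _i : Fin n, (σ ^ 2)⁻¹ * ‖v‖ ^ 2 := by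
        refine Finset.sum_le_sum fun i _ => ?_
        gcongr
        exact ((A i).le_opNorm v).trans
          (mul_le_of_le_one_left (norm_nonneg v) (hA1 i))
    _ = (n / σ ^ 2) * ‖v‖ ^ 2 := by
        rw [Finset.sum_const, Finset.card_univ, Fintype.card_fin, nsmul_eq_mul]; ring
    _ ≤ ((n + 1) / σ) ^ 2 * ‖v‖ ^ 2 := by
        rw [div_pow]
        gcongr
        nlinarith [(Nat.cast_nonneg n : (0 : ℝ) ≤ n)]

theorem stronglyMeasurable_sum_stepB (σ : ℝ) {A : Ω → Fin n → Y →L[ℝ] E d}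
    {a : Ω → Fin n → E d} (hA : ∀ i, StronglyMeasurable fun ω => A ω i)
    (ha : ∀ i, Measurable fun ω => a ω i) :
    StronglyMeasurable fun ω => ∑ i, stepB σ (a ω i) (A ω i) := by
  have h : ∀ i, StronglyMeasurable fun ω => stepB σ (a ω i) (A ω i) := fun i => by
    have h0 : StronglyMeasurable fun ω => a ω i := (ha i).stronglyMeasurable
    have h1 : StronglyMeasurable fun ω => (a ω i, A ω i) := StronglyMeasurable.prodMk h0 (hA i)
    have h2 := (continuous_stepB (Y := Y) (d := d) σ).comp_stronglyMeasurable h1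
    exact h2
  exact Finset.stronglyMeasurable_fun_sum _ fun i _ => h i

theorem stronglyMeasurable_sum_stepQ (σ : ℝ) {A : Ω → Fin n → Y →L[ℝ] E d}
    (hA : ∀ i, StronglyMeasurable fun ω => A ω i) :
    StronglyMeasurable fun ω => ∑ i, stepQ σ (A ω i) := by
  have h : ∀ i, StronglyMeasurable fun ω => stepQ σ (A ω i) := fun i =>
    (continuous_stepQ σ).comp_stronglyMeasurable (hA i)
  exact Finset.stronglyMeasurable_fun_sum _ fun i _ => h i

/-- The exponential family of finitely many Gaussian steps whose means are linear in the
parameter. -/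
noncomputable def QuadFamily.ofSteps (hσ : 0 < σ)
    (A : Ω → Fin n → Y →L[ℝ] E d) (a : Ω → Fin n → E d)
    (hA : ∀ i, StronglyMeasurable fun ω => A ω i) (ha : ∀ i, Measurable fun ω => a ω i)
    (hA1 : ∀ ω i, ‖A ω i‖ ≤ 1)
    (mass : ∀ y, ∫⁻ ω, ENNReal.ofReal (Real.exp (∑ i, cmExp σ (A ω i y) (a ω i))) ∂P = 1) :
    QuadFamily Y P ((n + 1) / σ) where
  b ω := ∑ i, stepB σ (a ω i) (A ω i)
  q ω := ∑ i, stepQ σ (A ω i)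
  lam_pos := by positivity
  b_meas := stronglyMeasurable_sum_stepB σ hA ha
  q_meas := stronglyMeasurable_sum_stepQ σ hA
  symm ω v w := by
    simp only [sum_apply, stepQ_apply, real_inner_comm]
  nonneg ω v := by
    simp only [sum_apply, stepQ_apply, real_inner_self_eq_norm_sq]
    exact Finset.sum_nonneg fun i _ => mul_nonneg (inv_nonneg.2 (sq_nonneg σ)) (sq_nonneg _)
  le ω v := sum_stepQ_le hσ (hA1 ω) v
  mass y := by
    rw [← mass y]
    exact lintegral_congr fun ω => by rw [sum_cmExp_eq]

theorem QuadFamily.ofSteps_rho (hσ : 0 < σ)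
    (A : Ω → Fin n → Y →L[ℝ] E d) (a : Ω → Fin n → E d) (hA) (ha) (hA1) (mass) (ω : Ω) (y : Y) :
    (QuadFamily.ofSteps (P := P) hσ A a hA ha hA1 mass).rho ω y =
      Real.exp (∑ i, cmExp σ (A ω i y) (a ω i)) := by
  rw [sum_cmExp_eq]
  rfl

end Steps

end ModelRL

namespace ModelRL

/-! ### Trajectories -/

variable {d : ℕ} {f : E d → E d}

attribute [local irreducible] act gaussianNoise cmExp

/-- Measurability is joint in the policy parameter as well, since the parameters of a run are
random. -/
theorem measurable_rollout (hf : Measurable f) (k : ℕ) :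
    Measurable fun p : Param d × E d × (Fin k → E d) => rollout f p.1 k p.2.1 p.2.2 := by
  induction k with
  | zero => exact measurable_pi_lambda _ fun i => i.elim0
  | succ k ih =>
    have ha : Measurable fun p : Param d × E d × (Fin (k + 1) → E d) =>
        act p.1 p.2.1 + p.2.2 0 := by
      refine Measurable.add ?_ (by fun_prop)
      exact continuous_act.measurable.comp
        (measurable_fst.prodMk (measurable_fst.comp measurable_snd))
    have hs : Measurable fun p : Param d × E d × (Fin (k + 1) → E d) =>
        f (p.2.1 + (act p.1 p.2.1 + p.2.2 0)) :=
      hf.comp ((measurable_fst.comp measurable_snd).add ha)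
    refine measurable_pi_lambda _ fun i => ?_
    refine Fin.cases ?_ (fun j => ?_) i
    · simp only [rollout, Fin.cons_zero]
      exact (measurable_fst.comp measurable_snd).prodMk (ha.prodMk hs)
    · simp only [rollout, Fin.cons_succ]
      refine (measurable_pi_apply j).comp (ih.comp (measurable_fst.prodMk (hs.prodMk ?_)))
      exact measurable_pi_lambda _ fun l =>
        (measurable_pi_apply l.succ).comp (measurable_snd.comp measurable_snd)

theorem rollout_mem (hf : ∀ x, f x ∈ stateSpace d) (ψ : Param d) (k : ℕ) {s : E d}
    (hs : s ∈ stateSpace d) (u : Fin k → E d) (i : Fin k) :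
    (rollout f ψ k s u i).1 ∈ stateSpace d ∧ (rollout f ψ k s u i).2.2 ∈ stateSpace d := by
  induction k generalizing s with
  | zero => exact i.elim0
  | succ k ih =>
    refine Fin.cases ?_ (fun j => ?_) i
    · exact ⟨hs, hf _⟩
    · exact ih (hf _) _ j

theorem rollout_next (ψ : Param d) (k : ℕ) (s : E d) (u : Fin k → E d) (i : Fin k) :
    (rollout f ψ k s u i).2.2 = f ((rollout f ψ k s u i).1 + (rollout f ψ k s u i).2.1) := by
  induction k generalizing s with
  | zero => exact i.elim0
  | succ k ih =>
    refine Fin.cases rfl (fun j => ?_) i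
    exact ih _ _ j

/-- The law of the noise of `k` steps. -/
noncomputable abbrev noise (d : ℕ) (σ : ℝ) (k : ℕ) : Measure (Fin k → E d) :=
  Measure.pi fun _ : Fin k => gaussianNoise d σ

theorem lintegral_noise_succ (σ : ℝ) (k : ℕ) {g : (Fin (k + 1) → E d) → ℝ≥0∞}
    (hg : Measurable g) :
    ∫⁻ u, g u ∂(noise d σ (k + 1)) =
      ∫⁻ x, ∫⁻ u, g (Fin.cons x u) ∂(noise d σ k) ∂(gaussianNoise d σ) := by
  have h := (measurePreserving_piFinSuccAbove (fun _ : Fin (k + 1) => gaussianNoise d σ) 0).symm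
  rw [← h.lintegral_comp hg]
  refine (lintegral_prod (μ := gaussianNoise d σ) (ν := noise d σ k) _
    (hg.comp h.measurable).aemeasurable).trans ?_
  refine lintegral_congr fun x => lintegral_congr fun u => ?_
  change g (Fin.insertNth 0 x u) = _
  rw [Fin.insertNth_zero']

/-- The log-likelihood ratio of the policy `ψ` with respect to the policy `0`. -/
noncomputable def logLik (f : E d → E d) (σ : ℝ) (ψ : Param d) (k : ℕ) (s : E d)
    (a : Fin k → E d) : ℝ :=
  -- Under the policy `0` the actions are the noise itself, so each factor compares a Gaussian of
  -- mean `ψ s_i` with the centred one.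
  ∑ i, cmExp σ (act ψ (rollout f 0 k s a i).1) (a i)

theorem measurable_cons {α : Type*} [MeasurableSpace α] (k : ℕ) :
    Measurable fun p : α × (Fin k → α) => (Fin.cons p.1 p.2 : Fin (k + 1) → α) :=
  measurable_pi_lambda _ fun i => by
    refine Fin.cases ?_ (fun j => ?_) i
    · exact measurable_fst
    · exact (measurable_pi_apply j).comp measurable_snd

theorem measurable_logLik (hf : Measurable f) (σ : ℝ) (ψ : Param d) (k : ℕ) :
    Measurable fun p : E d × (Fin k → E d) => logLik f σ ψ k p.1 p.2 := by
  unfold logLik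
  refine Finset.measurable_sum _ fun i _ => ?_
  have h1 : Measurable fun p : E d × (Fin k → E d) => (rollout f 0 k p.1 p.2 i).1 :=
    measurable_fst.comp ((measurable_pi_apply i).comp
      ((measurable_rollout hf k).comp (measurable_const.prodMk measurable_id)))
  exact (continuous_cmExp σ).measurable.comp
    (((act ψ).continuous.measurable.comp h1).prodMk
      ((measurable_pi_apply i).comp measurable_snd))

theorem logLik_succ (f : E d → E d) (σ : ℝ) (ψ : Param d) (k : ℕ) (s x : E d)
    (a : Fin k → E d) :
    logLik f σ ψ (k + 1) s (Fin.cons x a) =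
      cmExp σ (act ψ s) x + logLik f σ ψ k (f (s + x)) a := by
  simp [logLik, Fin.sum_univ_succ, rollout]

/-- Change of measure for trajectories. -/
theorem lintegral_rollout (hf : Measurable f) {σ : ℝ} (hσ : 0 < σ) (ψ : Param d) (k : ℕ) (s : E d)
    {Φ : Traj d k → ℝ≥0∞} (hΦ : Measurable Φ) :
    ∫⁻ u, Φ (rollout f ψ k s u) ∂(noise d σ k) =
      ∫⁻ a, Φ (rollout f 0 k s a) * ENNReal.ofReal (Real.exp (logLik f σ ψ k s a))
        ∂(noise d σ k) := by
  induction k generalizing s with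
  | zero =>
    refine lintegral_congr fun u => ?_
    rw [logLik, Finset.univ_eq_empty, Finset.sum_empty, Real.exp_zero, ENNReal.ofReal_one, mul_one]
    rfl
  | succ k ih =>
    have hr : ∀ ψ : Param d, ∀ j, Measurable fun p : E d × (Fin j → E d) =>
        rollout f ψ j p.1 p.2 := fun ψ j =>
      (measurable_rollout hf j).comp (measurable_const.prodMk measurable_id)
    have hrs : ∀ ψ : Param d, ∀ j, Measurable (rollout f ψ j s) := fun ψ j =>
      (hr ψ j).comp (measurable_const.prodMk measurable_id)
    have hl : Measurable (logLik f σ ψ (k + 1) s) :=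
      (measurable_logLik hf σ ψ (k + 1)).comp (measurable_const.prodMk measurable_id)
    rw [lintegral_noise_succ σ k (g := fun u => Φ (rollout f ψ (k + 1) s u)) (hΦ.comp (hrs ψ _)),
      lintegral_noise_succ σ k (g := fun u => Φ (rollout f 0 (k + 1) s u) *
        ENNReal.ofReal (Real.exp (logLik f σ ψ (k + 1) s u)))
        ((hΦ.comp (hrs 0 _)).mul (by fun_prop))]
    -- The contribution of the remaining steps as a function of the first action. By induction, the
    -- left side integrates `h` against the shifted noise and the right side integrates `h` times
    -- the Cameron–Martin factor of the first step.
    set h : E d → ℝ≥0∞ := fun x =>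
      ∫⁻ a, Φ (Fin.cons (s, x, f (s + x)) (rollout f 0 k (f (s + x)) a))
      * ENNReal.ofReal (Real.exp (logLik f σ ψ k (f (s + x)) a)) ∂(noise d σ k) with hh
    have hfs : Measurable fun x => f (s + x) := hf.comp (measurable_const_add s)
    have hm : Measurable h := by
      have hc : Measurable fun p : E d × (Fin k → E d) =>
          (Fin.cons (s, p.1, f (s + p.1)) (rollout f 0 k (f (s + p.1)) p.2) : Traj d (k + 1)) :=
        (measurable_cons k).comp (((measurable_const.prodMk (measurable_fst.prodMk
          (hfs.comp measurable_fst)))).prodMk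
          ((hr 0 k).comp ((hfs.comp measurable_fst).prodMk measurable_snd)))
      have hc' : Measurable fun p : E d × (Fin k → E d) => logLik f σ ψ k (f (s + p.1)) p.2 :=
        (measurable_logLik hf σ ψ k).comp ((hfs.comp measurable_fst).prodMk measurable_snd)
      exact Measurable.lintegral_prod_right'
        (f := fun p : E d × (Fin k → E d) =>
          Φ (Fin.cons (s, p.1, f (s + p.1)) (rollout f 0 k (f (s + p.1)) p.2))
          * ENNReal.ofReal (Real.exp (logLik f σ ψ k (f (s + p.1)) p.2)))
        ((hΦ.comp hc).mul (by fun_prop))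
    have h1 : ∀ x, ∫⁻ u, Φ (rollout f ψ (k + 1) s (Fin.cons x u)) ∂(noise d σ k) =
        h (act ψ s + x) := fun x => by
      have hΦ' : Measurable fun z : Traj d k =>
          Φ (Fin.cons (s, act ψ s + x, f (s + (act ψ s + x))) z) :=
        hΦ.comp ((measurable_cons k).comp (measurable_const.prodMk measurable_id))
      exact ih (f (s + (act ψ s + x))) hΦ'
    have h2 : ∀ x, ∫⁻ a, Φ (rollout f 0 (k + 1) s (Fin.cons x a)) *
        ENNReal.ofReal (Real.exp (logLik f σ ψ (k + 1) s (Fin.cons x a))) ∂(noise d σ k) =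
        h x * ENNReal.ofReal (Real.exp (cmExp σ (act ψ s) x)) := fun x => by
      rw [hh, ← lintegral_mul_const' _ _ ENNReal.ofReal_ne_top]
      refine lintegral_congr fun a => ?_
      rw [logLik_succ, add_comm (cmExp _ _ _), Real.exp_add, ENNReal.ofReal_mul (Real.exp_pos _).le,
        ← mul_assoc]
      simp [rollout]
    simp_rw [h1, h2]
    exact lintegral_gaussianNoise_shift hσ _ hm

/-- A change of measure that holds for nonnegative functions holds for real functions. -/
theorem integral_eq_of_lintegral_eq {Ω Ω' Z : Type*} [MeasurableSpace Ω] [MeasurableSpace Ω']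
    [MeasurableSpace Z]
    {P : Measure Ω} {P' : Measure Ω'} {X : Ω → Z} {X' : Ω' → Z} {g : Ω' → ℝ} (hX : Measurable X)
    (hX' : Measurable X') (hg : Measurable g)
    (h : ∀ Φ : Z → ℝ≥0∞, Measurable Φ →
      ∫⁻ ω, Φ (X ω) ∂P = ∫⁻ ω, Φ (X' ω) * ENNReal.ofReal (Real.exp (g ω)) ∂P')
    {Φ : Z → ℝ} (hΦ : Measurable Φ) :
    ∫ ω, Φ (X ω) ∂P = ∫ ω, Φ (X' ω) * Real.exp (g ω) ∂P' := by
  have hmap : P.map X = (P'.withDensity fun ω => ENNReal.ofReal (Real.exp (g ω))).map X' := by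
    refine Measure.ext_of_lintegral _ fun Φ hΦ => ?_
    rw [lintegral_map hΦ hX, lintegral_map hΦ hX', h Φ hΦ]
    refine Eq.trans ?_ (lintegral_withDensity_eq_lintegral_mul _ (by fun_prop)
      (hΦ.comp hX')).symm
    refine lintegral_congr fun ω => ?_
    rw [Pi.mul_apply, mul_comm, Function.comp_apply]
  rw [← integral_map (φ := X) (f := Φ) hX.aemeasurable hΦ.aestronglyMeasurable, hmap,
    integral_map hX'.aemeasurable hΦ.aestronglyMeasurable,
    integral_withDensity_eq_integral_toReal_smul (by fun_prop) (by simp)]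
  refine integral_congr_ae (.of_forall fun ω => ?_)
  simp only [ENNReal.toReal_ofReal (Real.exp_pos _).le, smul_eq_mul]
  ring

end ModelRL

namespace ModelRL

variable {d : ℕ} {f : E d → E d} {σ : ℝ} {c : E d → E d → ℝ} {K : ℝ}

attribute [local irreducible] act gaussianNoise cmExp

/-! ### Expected costs of trajectories -/

/-- The total cost of a trajectory. -/
def trajCost (c : E d → E d → ℝ) {k : ℕ} (z : Traj d k) : ℝ := ∑ i, c (z i).1 (z i).2.1

theorem measurable_trajCost (hc : Measurable (Function.uncurry c)) (k : ℕ) :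
    Measurable (trajCost (d := d) c (k := k)) :=
  Finset.measurable_sum _ fun i _ =>
    hc.comp ((measurable_fst.comp (measurable_pi_apply i)).prodMk
      (measurable_fst.comp (measurable_snd.comp (measurable_pi_apply i))))

theorem abs_trajCost_le (hK : ∀ s a, |c s a| ≤ K) {k : ℕ} (z : Traj d k) :
    |trajCost c z| ≤ k * K := by
  refine (Finset.abs_sum_le_sum_abs _ _).trans ((Finset.sum_le_sum fun i _ => hK _ _).trans ?_)
  simp

theorem measurable_rollout_apply (hf : Measurable f) (ψ : Param d) (k : ℕ) :
    Measurable fun p : E d × (Fin k → E d) => rollout f ψ k p.1 p.2 :=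
  (measurable_rollout hf k).comp (measurable_const.prodMk measurable_id)

theorem measurable_rollout_apply_apply (hf : Measurable f) (ψ : Param d) (k : ℕ) (s : E d) :
    Measurable fun u : Fin k → E d => rollout f ψ k s u :=
  (measurable_rollout_apply hf ψ k).comp (measurable_const.prodMk measurable_id)

/-- The expected total cost of `k` steps. -/
noncomputable def expCost (f : E d → E d) (σ : ℝ) (c : E d → E d → ℝ) (ψ : Param d) (k : ℕ)
    (s : E d) : ℝ :=
  ∫ u, trajCost c (rollout f ψ k s u) ∂(noise d σ k)

theorem integrable_of_abs_le {Ω : Type*} [MeasurableSpace Ω] {P : Measure Ω} [IsFiniteMeasure P]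
    {g : Ω → ℝ} (hg : Measurable g) {K : ℝ} (h : ∀ ω, |g ω| ≤ K) : Integrable g P :=
  Integrable.of_bound hg.aestronglyMeasurable K (.of_forall h)

theorem abs_integral_le_of_abs_le {Ω : Type*} [MeasurableSpace Ω] {P : Measure Ω}
    [IsProbabilityMeasure P] {g : Ω → ℝ} {K : ℝ} (h : ∀ ω, |g ω| ≤ K) : |∫ ω, g ω ∂P| ≤ K := by
  have := norm_integral_le_of_norm_le_const (μ := P) (f := g) (C := K) (.of_forall h)
  simpa using this

theorem abs_expCost_le (hK : ∀ s a, |c s a| ≤ K) (ψ : Param d) (k : ℕ) (s : E d) :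
    |expCost f σ c ψ k s| ≤ k * K :=
  abs_integral_le_of_abs_le fun _ => abs_trajCost_le hK _

theorem measurable_expCost (hf : Measurable f) (hc : Measurable (Function.uncurry c))
    (ψ : Param d) (k : ℕ) : Measurable (expCost f σ c ψ k) := by
  have h : StronglyMeasurable fun p : E d × (Fin k → E d) => trajCost c (rollout f ψ k p.1 p.2) :=
    ((measurable_trajCost hc k).comp (measurable_rollout_apply hf ψ k)).stronglyMeasurable
  exact (h.integral_prod_right (ν := noise d σ k)).measurable

theorem integral_noise_succ (σ : ℝ) (k : ℕ) {g : (Fin (k + 1) → E d) → ℝ}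
    (hg : Measurable g) {K : ℝ} (hK : ∀ u, |g u| ≤ K) :
    ∫ u, g u ∂(noise d σ (k + 1)) =
      ∫ x, ∫ u, g (Fin.cons x u) ∂(noise d σ k) ∂(gaussianNoise d σ) := by
  have h := (measurePreserving_piFinSuccAbove (fun _ : Fin (k + 1) => gaussianNoise d σ) 0).symm
  rw [← h.integral_comp' g]
  refine (integral_prod (μ := gaussianNoise d σ) (ν := noise d σ k) _
    (integrable_of_abs_le (hg.comp h.measurable) fun p => hK _)).trans ?_
  refine integral_congr_ae (.of_forall fun x => integral_congr_ae (.of_forall fun u => ?_))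
  change g (Fin.insertNth 0 x u) = _
  rw [Fin.insertNth_zero']

theorem trajCost_cons (c : E d → E d → ℝ) {k : ℕ} (x : E d × E d × E d) (z : Traj d k) :
    trajCost c (Fin.cons x z : Traj d (k + 1)) = c x.1 x.2.1 + trajCost c z := by
  simp [trajCost, Fin.sum_univ_succ]

/-- The Bellman equation. -/
theorem expCost_succ (hf : Measurable f) (hc : Measurable (Function.uncurry c))
    (hK : ∀ s a, |c s a| ≤ K) (ψ : Param d) (k : ℕ) (s : E d) :
    expCost f σ c ψ (k + 1) s = ∫ x, c s (act ψ s + x) +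
      expCost f σ c ψ k (f (s + (act ψ s + x))) ∂(gaussianNoise d σ) := by
  refine (integral_noise_succ σ k ((measurable_trajCost hc _).comp
    (measurable_rollout_apply_apply hf ψ _ s)) fun u => abs_trajCost_le hK _).trans ?_
  refine integral_congr_ae (.of_forall fun x => ?_)
  have h : ∀ u : Fin k → E d, (trajCost c ∘ fun u => rollout f ψ (k + 1) s u)
      (Fin.cons x u : Fin (k + 1) → E d) = c s (act ψ s + x) +
        trajCost c (rollout f ψ k (f (s + (act ψ s + x))) u) := fun u => trajCost_cons _ _ _
  simp only [h]
  have hi : Integrable (fun u => trajCost c (rollout f ψ k (f (s + (act ψ s + x))) u))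
      (noise d σ k) := integrable_of_abs_le
    ((measurable_trajCost hc _).comp (measurable_rollout_apply_apply hf ψ _ _))
      fun u => abs_trajCost_le hK _
  rw [integral_add (integrable_const _) hi]
  simp [expCost]

/-- Change of measure for one Gaussian step. -/
theorem integral_gaussianNoise_shift (hσ : 0 < σ) (m : E d) {Φ : E d → ℝ} (hΦ : Measurable Φ) :
    ∫ x, Φ (m + x) ∂(gaussianNoise d σ) =
      ∫ x, Φ x * Real.exp (cmExp σ m x) ∂(gaussianNoise d σ) :=
  integral_eq_of_lintegral_eq (X := fun x => m + x) (X' := fun x => x) (measurable_const_add m)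
    measurable_id ((continuous_cmExp σ).measurable.comp (measurable_const.prodMk measurable_id))
    (fun _ h => lintegral_gaussianNoise_shift hσ m h) hΦ

/-- Change of measure for trajectories. -/
theorem integral_rollout (hf : Measurable f) (hσ : 0 < σ) (ψ : Param d) (k : ℕ) (s : E d)
    {Φ : Traj d k → ℝ} (hΦ : Measurable Φ) :
    ∫ u, Φ (rollout f ψ k s u) ∂(noise d σ k) =
      ∫ u, Φ (rollout f 0 k s u) * Real.exp (logLik f σ ψ k s u) ∂(noise d σ k) :=
  integral_eq_of_lintegral_eq (measurable_rollout_apply_apply hf ψ k s)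
    (measurable_rollout_apply_apply hf 0 k s)
    ((measurable_logLik hf σ ψ k).comp (measurable_const.prodMk measurable_id))
    (fun _ h => lintegral_rollout hf hσ ψ k s h) hΦ

theorem lintegral_exp_logLik (hf : Measurable f) (hσ : 0 < σ) (ψ : Param d) (k : ℕ) (s : E d) :
    ∫⁻ u, ENNReal.ofReal (Real.exp (logLik f σ ψ k s u)) ∂(noise d σ k) = 1 := by
  have h := lintegral_rollout hf hσ ψ k s (Φ := fun _ => 1) measurable_const
  simpa using h.symm

theorem lintegral_exp_cmExp (hσ : 0 < σ) (m : E d) :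
    ∫⁻ x, ENNReal.ofReal (Real.exp (cmExp σ m x)) ∂(gaussianNoise d σ) = 1 := by
  have h := lintegral_gaussianNoise_shift hσ m (f := fun _ => 1) measurable_const
  simpa using h.symm

/-! ### The exponential families of the policies -/

/-- One Gaussian step. -/
noncomputable def stepFamily {Y : Type*} [NormedAddCommGroup Y] [NormedSpace ℝ Y] (hσ : 0 < σ)
    (L : Y →L[ℝ] E d) (hL : ‖L‖ ≤ 1) :
    QuadFamily Y (gaussianNoise d σ) (((1 : ℕ) + 1) / σ) :=
  QuadFamily.ofSteps hσ (n := 1) (fun _ _ => L) (fun x _ => x)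
    (fun _ => stronglyMeasurable_const) (fun _ => measurable_id) (fun _ _ => hL)
    (fun y => by simpa using lintegral_exp_cmExp hσ (L y))

theorem stepFamily_rho {Y : Type*} [NormedAddCommGroup Y] [NormedSpace ℝ Y] (hσ : 0 < σ)
    (L : Y →L[ℝ] E d) (hL : ‖L‖ ≤ 1) (x : E d) (y : Y) :
    (stepFamily hσ L hL).rho x y = Real.exp (cmExp σ (L y) x) := by
  rw [stepFamily, QuadFamily.ofSteps_rho]
  simp

theorem measurable_rollout_state (hf : Measurable f) (ψ : Param d) (k : ℕ) (i : Fin k) :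
    Measurable fun p : E d × (Fin k → E d) => (rollout f ψ k p.1 p.2 i).1 :=
  measurable_fst.comp ((measurable_pi_apply i).comp (measurable_rollout_apply hf ψ k))

theorem norm_evalAt_le_one {s : E d} (hs : s ∈ stateSpace d) : ‖evalAt s‖ ≤ 1 :=
  (norm_evalAt_le s).trans (mem_closedBall_zero_iff.1 hs)

/-- The steps of a trajectory whose initial state is random. -/
noncomputable def trajFamily (hf : Measurable f) (hfS : ∀ x, f x ∈ stateSpace d) (hσ : 0 < σ)
    (k : ℕ) {μ : Measure (E d)} [IsProbabilityMeasure μ] {g : E d → E d} (hg : Measurable g)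
    (hgS : ∀ x, g x ∈ stateSpace d) :
    QuadFamily (Param d) (μ.prod (noise d σ k)) ((k + 1) / σ) :=
  QuadFamily.ofSteps hσ (fun ω i => evalAt (rollout f 0 k (g ω.1) ω.2 i).1) (fun ω i => ω.2 i)
    (fun i => continuous_evalAt.comp_stronglyMeasurable ((measurable_rollout_state hf 0 k i).comp
      ((hg.comp measurable_fst).prodMk measurable_snd)).stronglyMeasurable)
    (fun i => (measurable_pi_apply i).comp measurable_snd)
    (fun ω i => norm_evalAt_le_one (rollout_mem hfS 0 k (hgS _) _ i).1)
    (fun ψ => by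
      have hm : Measurable fun ω : E d × (Fin k → E d) =>
          ENNReal.ofReal (Real.exp (logLik f σ ψ k (g ω.1) ω.2)) :=
        ENNReal.measurable_ofReal.comp (Real.measurable_exp.comp ((measurable_logLik hf σ ψ k).comp
          ((hg.comp measurable_fst).prodMk measurable_snd)))
      refine (lintegral_prod _ hm.aemeasurable).trans ?_
      simp [lintegral_exp_logLik hf hσ])

theorem trajFamily_rho (hf : Measurable f) (hfS : ∀ x, f x ∈ stateSpace d) (hσ : 0 < σ)
    (k : ℕ) {μ : Measure (E d)} [IsProbabilityMeasure μ] {g : E d → E d} (hg : Measurable g)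
    (hgS : ∀ x, g x ∈ stateSpace d) (ω : E d × (Fin k → E d)) (ψ : Param d) :
    (trajFamily (μ := μ) hf hfS hσ k hg hgS).rho ω ψ =
      Real.exp (logLik f σ ψ k (g ω.1) ω.2) := by
  exact QuadFamily.ofSteps_rho ..

/-- The steps of a trajectory after a Gaussian step whose mean is a further parameter. -/
noncomputable def tailFamily (hf : Measurable f) (hfS : ∀ x, f x ∈ stateSpace d) (hσ : 0 < σ)
    (k : ℕ) :
    QuadFamily (Param d × E d) ((gaussianNoise d σ).prod (noise d σ k)) (((k + 1 : ℕ) + 1) / σ) :=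
  QuadFamily.ofSteps hσ (n := k + 1)
    -- The mean of the first Gaussian is the second parameter. In the application this Gaussian is
    -- `s + a`, so the later steps start from `f` of it.
    (fun ω => Fin.cons (ContinuousLinearMap.snd ℝ (Param d) (E d)) fun i =>
      (evalAt (rollout f 0 k (f ω.1) ω.2 i).1).comp (ContinuousLinearMap.fst ℝ (Param d) (E d)))
    (fun ω => Fin.cons ω.1 ω.2)
    (Fin.cases stronglyMeasurable_const fun i => by
      have h : Continuous fun s : E d =>
          (evalAt s).comp (ContinuousLinearMap.fst ℝ (Param d) (E d)) :=
        continuous_evalAt.clm_comp continuous_const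
      exact h.comp_stronglyMeasurable ((measurable_rollout_state hf 0 k i).comp
        ((hf.comp measurable_fst).prodMk measurable_snd)).stronglyMeasurable)
    (Fin.cases measurable_fst fun i => (measurable_pi_apply i).comp measurable_snd)
    (fun ω => Fin.cases (ContinuousLinearMap.norm_snd_le ℝ _ _) fun i =>
      (ContinuousLinearMap.opNorm_comp_le _ _).trans (mul_le_one₀
        (norm_evalAt_le_one (rollout_mem hfS 0 k (hfS _) _ i).1) (norm_nonneg _)
        (ContinuousLinearMap.norm_fst_le ℝ _ _)))
    (fun y => by
      have hm : Measurable fun ω : E d × (Fin k → E d) =>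
          ENNReal.ofReal (Real.exp (cmExp σ y.2 ω.1 + logLik f σ y.1 k (f ω.1) ω.2)) :=
        ENNReal.measurable_ofReal.comp (Real.measurable_exp.comp
          (((continuous_cmExp σ).measurable.comp (measurable_const.prodMk measurable_fst)).add
            ((measurable_logLik hf σ y.1 k).comp
              ((hf.comp measurable_fst).prodMk measurable_snd))))
      simp only [Fin.sum_univ_succ, Fin.cons_zero, Fin.cons_succ]
      refine (lintegral_prod _ hm.aemeasurable).trans ?_
      simp only [Real.exp_add, ENNReal.ofReal_mul (Real.exp_pos _).le]
      rw [← lintegral_exp_cmExp hσ y.2]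
      refine lintegral_congr fun x => ?_
      rw [lintegral_const_mul' _ _ ENNReal.ofReal_ne_top, lintegral_exp_logLik hf hσ, mul_one])

theorem tailFamily_rho (hf : Measurable f) (hfS : ∀ x, f x ∈ stateSpace d) (hσ : 0 < σ)
    (k : ℕ) (ω : E d × (Fin k → E d)) (y : Param d × E d) :
    (tailFamily hf hfS hσ k).rho ω y =
      Real.exp (cmExp σ y.2 ω.1 + logLik f σ y.1 k (f ω.1) ω.2) := by
  rw [tailFamily, QuadFamily.ofSteps_rho, Fin.sum_univ_succ]
  rfl

/-- The expected cost of the first step as a function of the mean of the action. -/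
noncomputable def headCost (σ : ℝ) (g : E d → ℝ) (m : E d) : ℝ :=
  ∫ x, g x * Real.exp (cmExp σ m x) ∂(gaussianNoise d σ)

/-- The expected cost of the later steps as a function of the policy and of the mean of the sum of
the first state and the first action. -/
noncomputable def tailCost (f : E d → E d) (σ : ℝ) (c : E d → E d → ℝ) (k : ℕ)
    (y : Param d × E d) : ℝ :=
  ∫ ω, trajCost c (rollout f 0 k (f ω.1) ω.2) *
    Real.exp (cmExp σ y.2 ω.1 + logLik f σ y.1 k (f ω.1) ω.2)
      ∂((gaussianNoise d σ).prod (noise d σ k))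

theorem smoothBound_headCost (hσ : 0 < σ) {g : E d → ℝ} (hg : Measurable g) (hK0 : 0 ≤ K)
    (hK : ∀ x, |g x| ≤ K) :
    SmoothBound (headCost σ g) (36 * K * (((1 : ℕ) + 1) / σ)) (36 * K * (((1 : ℕ) + 1) / σ) ^ 2)
      (36 * K * (((1 : ℕ) + 1) / σ) ^ 3) := by
  have h := (stepFamily hσ (ContinuousLinearMap.id ℝ (E d))
    ContinuousLinearMap.norm_id_le).smoothBound_integral hg.stronglyMeasurable hK0 hK
  simp only [stepFamily_rho] at h
  exact h

theorem smoothBound_tailCost (hf : Measurable f) (hfS : ∀ x, f x ∈ stateSpace d) (hσ : 0 < σ)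
    (hc : Measurable (Function.uncurry c)) (hK0 : 0 ≤ K) (hK : ∀ s a, |c s a| ≤ K) (k : ℕ) :
    SmoothBound (tailCost f σ c k) (36 * (k * K) * (((k + 1 : ℕ) + 1) / σ))
      (36 * (k * K) * (((k + 1 : ℕ) + 1) / σ) ^ 2)
      (36 * (k * K) * (((k + 1 : ℕ) + 1) / σ) ^ 3) := by
  have hm : Measurable fun ω : E d × (Fin k → E d) => trajCost c (rollout f 0 k (f ω.1) ω.2) :=
    (measurable_trajCost hc k).comp ((measurable_rollout_apply hf 0 k).comp
      ((hf.comp measurable_fst).prodMk measurable_snd))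
  have h := (tailFamily hf hfS hσ k).smoothBound_integral hm.stronglyMeasurable (K := k * K)
    (by positivity) fun ω => abs_trajCost_le hK _
  simp only [tailFamily_rho] at h
  exact h

theorem abs_headCost_le (hσ : 0 < σ) {g : E d → ℝ} (hg : Measurable g)
    (hK : ∀ x, |g x| ≤ K) (m : E d) : |headCost σ g m| ≤ K := by
  rw [headCost, ← integral_gaussianNoise_shift hσ m hg]
  exact abs_integral_le_of_abs_le fun x => hK _

theorem headCost_sub (hσ : 0 < σ) {g g' : E d → ℝ} (hg : Measurable g) (hg' : Measurable g')
    (hK : ∀ x, |g x| ≤ K) (hK' : ∀ x, |g' x| ≤ K) (m : E d) :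
    headCost σ (fun x => g x - g' x) m = headCost σ g m - headCost σ g' m := by
  have h := fun (g : E d → ℝ) (hg : Measurable g) => integral_gaussianNoise_shift hσ m hg
  rw [headCost, headCost, headCost, ← h g hg, ← h g' hg', ← h (fun x => g x - g' x) (hg.sub hg')]
  exact integral_sub (integrable_of_abs_le (hg.comp (measurable_const_add m)) fun x => hK _)
    (integrable_of_abs_le (hg'.comp (measurable_const_add m)) fun x => hK' _)

/-- Since the next state depends on `s + a` only, the later costs see `s` only through the mean `s +
ψ s` of a Gaussian. This is why values are regular in the state although `f` is merely measurable.
-/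
theorem expCost_succ_eq (hf : Measurable f) (hfS : ∀ x, f x ∈ stateSpace d) (hσ : 0 < σ)
    (hc : Measurable (Function.uncurry c))
    (hK : ∀ s a, |c s a| ≤ K) (ψ : Param d) (k : ℕ) (s : E d) :
    expCost f σ c ψ (k + 1) s =
      headCost σ (c s) (act ψ s) + tailCost f σ c k (ψ, s + act ψ s) := by
  have hcs : Measurable (c s) := hc.comp (measurable_const.prodMk measurable_id)
  have hV : Measurable fun x => expCost f σ c ψ k (f x) := (measurable_expCost hf hc ψ k).comp hf
  have hVs : Measurable fun x => expCost f σ c ψ k (f (s + (act ψ s + x))) :=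
    hV.comp ((measurable_const_add s).comp (measurable_const_add _))
  have hi : Integrable (fun x => c s (act ψ s + x)) (gaussianNoise d σ) :=
    integrable_of_abs_le (hcs.comp (measurable_const_add _)) fun x => hK _ _
  rw [expCost_succ hf hc hK, integral_add hi
    (integrable_of_abs_le hVs fun x => abs_expCost_le hK _ _ _)]
  congr 1
  · exact integral_gaussianNoise_shift hσ _ hcs
  · simp_rw [← add_assoc]
    refine (integral_gaussianNoise_shift hσ (s + act ψ s) hV).trans ?_
    have hint := (tailFamily hf hfS hσ k).integrable_rho (ψ, s + act ψ s)
    simp only [tailFamily_rho] at hint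
    have hm : Measurable fun ω : E d × (Fin k → E d) => trajCost c (rollout f 0 k (f ω.1) ω.2) :=
      (measurable_trajCost hc k).comp ((measurable_rollout_apply hf 0 k).comp
        ((hf.comp measurable_fst).prodMk measurable_snd))
    rw [tailCost, integral_prod _ (hint.bdd_mul (c := k * K) hm.aestronglyMeasurable
      (.of_forall fun ω => abs_trajCost_le hK _))]
    refine integral_congr_ae (.of_forall fun x => ?_)
    simp only [expCost]
    rw [integral_rollout hf hσ ψ k (f x) (measurable_trajCost hc k), ← integral_mul_const]
    refine integral_congr_ae (.of_forall fun u => ?_)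
    simp only [Real.exp_add]
    ring

end ModelRL

namespace ModelRL

/-! ### Bounds for derivatives at a point -/

/-- `f` is `C²`, and its value and first two derivatives at `y` satisfy the given bounds. -/
structure JetBound {Y : Type*} [NormedAddCommGroup Y] [NormedSpace ℝ Y] (f : Y → ℝ) (y : Y)
    (b0 b1 b2 : ℝ) : Prop where
  contDiff : ContDiff ℝ 2 f
  d0 : |f y| ≤ b0
  d1 : ‖fderiv ℝ f y‖ ≤ b1
  d2 : ‖fderiv ℝ (fderiv ℝ f) y‖ ≤ b2

section

variable {Y Y' : Type*} [NormedAddCommGroup Y] [NormedSpace ℝ Y] [NormedAddCommGroup Y']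
  [NormedSpace ℝ Y'] {f g : Y → ℝ}

theorem differentiable_of_contDiff_two (h : ContDiff ℝ 2 f) : Differentiable ℝ f :=
  h.differentiable (by norm_num)

theorem differentiable_fderiv_of_contDiff_two (h : ContDiff ℝ 2 f) :
    Differentiable ℝ (fderiv ℝ f) :=
  (h.fderiv_right (m := 1) (by norm_num)).differentiable (by norm_num)

theorem fderiv_sub_of_contDiff (hf : ContDiff ℝ 2 f) (hg : ContDiff ℝ 2 g) (y : Y) :
    fderiv ℝ (fun y => f y - g y) y = fderiv ℝ f y - fderiv ℝ g y :=
  fderiv_fun_sub (differentiable_of_contDiff_two hf y) (differentiable_of_contDiff_two hg y)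

theorem fderiv_fderiv_sub_of_contDiff (hf : ContDiff ℝ 2 f) (hg : ContDiff ℝ 2 g) (y : Y) :
    fderiv ℝ (fderiv ℝ fun y => f y - g y) y =
      fderiv ℝ (fderiv ℝ f) y - fderiv ℝ (fderiv ℝ g) y := by
  rw [funext (fderiv_sub_of_contDiff hf hg)]
  exact fderiv_fun_sub (differentiable_fderiv_of_contDiff_two hf y)
    (differentiable_fderiv_of_contDiff_two hg y)

theorem fderiv_add_of_contDiff (hf : ContDiff ℝ 2 f) (hg : ContDiff ℝ 2 g) (y : Y) :
    fderiv ℝ (fun y => f y + g y) y = fderiv ℝ f y + fderiv ℝ g y :=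
  fderiv_fun_add (differentiable_of_contDiff_two hf y) (differentiable_of_contDiff_two hg y)

theorem fderiv_fderiv_add_of_contDiff (hf : ContDiff ℝ 2 f) (hg : ContDiff ℝ 2 g) (y : Y) :
    fderiv ℝ (fderiv ℝ fun y => f y + g y) y =
      fderiv ℝ (fderiv ℝ f) y + fderiv ℝ (fderiv ℝ g) y := by
  rw [funext (fderiv_add_of_contDiff hf hg)]
  exact fderiv_fun_add (differentiable_fderiv_of_contDiff_two hf y)
    (differentiable_fderiv_of_contDiff_two hg y)

theorem JetBound.add {y : Y} {a0 a1 a2 b0 b1 b2 : ℝ} (hf : JetBound f y a0 a1 a2)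
    (hg : JetBound g y b0 b1 b2) :
    JetBound (fun y => f y + g y) y (a0 + b0) (a1 + b1) (a2 + b2) where
  contDiff := hf.contDiff.add hg.contDiff
  d0 := (abs_add_le _ _).trans (add_le_add hf.d0 hg.d0)
  d1 := by
    rw [fderiv_add_of_contDiff hf.contDiff hg.contDiff]
    exact (norm_add_le _ _).trans (add_le_add hf.d1 hg.d1)
  d2 := by
    rw [fderiv_fderiv_add_of_contDiff hf.contDiff hg.contDiff]
    exact (norm_add_le _ _).trans (add_le_add hf.d2 hg.d2)

namespace SmoothBound

variable {B1 B2 B3 : ℝ}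

theorem nonneg (h : SmoothBound f B1 B2 B3) : 0 ≤ B1 ∧ 0 ≤ B2 :=
  ⟨(norm_nonneg _).trans (h.d1 0), (norm_nonneg _).trans (h.d2 0)⟩

theorem norm_pull_le (L : Y' →L[ℝ] Y) (hL : ‖L‖ ≤ 1) (D : Y →L[ℝ] Y →L[ℝ] ℝ) :
    ‖pull L D‖ ≤ ‖D‖ := by
  refine opNorm_le_of_le_one (norm_nonneg _) fun v hv =>
    opNorm_le_of_le_one (norm_nonneg _) fun w hw => ?_
  rw [pull_apply]
  refine (D.le_opNorm₂ _ _).trans ?_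
  have h1 : ‖L v‖ ≤ 1 := (L.le_opNorm v).trans (mul_le_one₀ hL (norm_nonneg _) hv)
  have h2 : ‖L w‖ ≤ 1 := (L.le_opNorm w).trans (mul_le_one₀ hL (norm_nonneg _) hw)
  calc ‖D‖ * ‖L v‖ * ‖L w‖ ≤ ‖D‖ * 1 * 1 := by gcongr
    _ = ‖D‖ := by ring

theorem norm_pull_sub_le (L L' : Y' →L[ℝ] Y) (hL : ‖L‖ ≤ 1) (hL' : ‖L'‖ ≤ 1)
    (D : Y →L[ℝ] Y →L[ℝ] ℝ) : ‖pull L D - pull L' D‖ ≤ 2 * ‖D‖ * ‖L - L'‖ := by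
  refine opNorm_le_of_le_one (by positivity) fun v hv =>
    opNorm_le_of_le_one (by positivity) fun w hw => ?_
  have e : (pull L D - pull L' D) v w = D ((L - L') v) (L w) + D (L' v) ((L - L') w) := by
    simp
  rw [e]
  have h1 : ‖(L - L') v‖ ≤ ‖L - L'‖ :=
    ((L - L').le_opNorm v).trans (mul_le_of_le_one_right (norm_nonneg _) hv)
  have h2 : ‖(L - L') w‖ ≤ ‖L - L'‖ :=
    ((L - L').le_opNorm w).trans (mul_le_of_le_one_right (norm_nonneg _) hw)
  have h3 : ‖L' v‖ ≤ 1 := (L'.le_opNorm v).trans (mul_le_one₀ hL' (norm_nonneg _) hv)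
  have h4 : ‖L w‖ ≤ 1 := (L.le_opNorm w).trans (mul_le_one₀ hL (norm_nonneg _) hw)
  refine (norm_add_le _ _).trans ?_
  have h5 : ‖D ((L - L') v) (L w)‖ ≤ ‖D‖ * ‖L - L'‖ * 1 :=
    (D.le_opNorm₂ _ _).trans (by gcongr)
  have h6 : ‖D (L' v) ((L - L') w)‖ ≤ ‖D‖ * 1 * ‖L - L'‖ :=
    (D.le_opNorm₂ _ _).trans (by gcongr)
  linarith

theorem jetBound (h : SmoothBound f B1 B2 B3) {B0 : ℝ} (h0 : ∀ y, |f y| ≤ B0) (L : Y' →L[ℝ] Y)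
    (hL : ‖L‖ ≤ 1) (c : Y) (y : Y') : JetBound (fun y => f (L y + c)) y B0 B1 B2 where
  contDiff := h.contDiff_comp_affine L c
  d0 := h0 _
  d1 := by
    rw [h.fderiv_comp_affine]
    exact (ContinuousLinearMap.opNorm_comp_le _ _).trans
      ((mul_le_of_le_one_right (norm_nonneg _) hL).trans (h.d1 _))
  d2 := by
    rw [h.fderiv_fderiv_comp_affine]
    exact (norm_pull_le L hL _).trans (h.d2 _)

/-- Two affine pullbacks differ in base point and in linear part. Moving the base point by `δ1`
costs one more derivative of `f`; changing the linear part by `δ2` enters the gradient once and the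
Hessian twice. -/
theorem jetBound_sub (h : SmoothBound f B1 B2 B3) (hB3 : 0 ≤ B3) {L L' : Y' →L[ℝ] Y}
    (hL : ‖L‖ ≤ 1) (hL' : ‖L'‖ ≤ 1) (c c' : Y) (y : Y') {δ1 δ2 : ℝ}
    (h1 : ‖(L y + c) - (L' y + c')‖ ≤ δ1) (h2 : ‖L - L'‖ ≤ δ2) :
    JetBound (fun y => f (L y + c) - f (L' y + c')) y (B1 * δ1) (B2 * δ1 + B1 * δ2)
      (B3 * δ1 + 2 * B2 * δ2) := by
  obtain ⟨hB1, hB2⟩ := h.nonneg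
  refine ⟨(h.contDiff_comp_affine L c).sub (h.contDiff_comp_affine L' c'), ?_, ?_, ?_⟩
  · exact (h.lip _ _).trans (by gcongr)
  · rw [fderiv_sub_of_contDiff (h.contDiff_comp_affine L c) (h.contDiff_comp_affine L' c'),
      h.fderiv_comp_affine, h.fderiv_comp_affine]
    set D := fderiv ℝ f (L y + c)
    set D' := fderiv ℝ f (L' y + c')
    have e : D.comp L - D'.comp L' = (D - D').comp L + D'.comp (L - L') := by
      ext v; simp
    rw [e]
    refine (norm_add_le _ _).trans (add_le_add ?_ ?_)
    · refine (ContinuousLinearMap.opNorm_comp_le _ _).trans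
        ((mul_le_of_le_one_right (norm_nonneg _) hL).trans ((h.lip_fderiv _ _).trans ?_))
      gcongr
    · refine (ContinuousLinearMap.opNorm_comp_le _ _).trans ?_
      exact mul_le_mul (h.d1 _) h2 (norm_nonneg _) hB1
  · rw [fderiv_fderiv_sub_of_contDiff (h.contDiff_comp_affine L c) (h.contDiff_comp_affine L' c'),
      h.fderiv_fderiv_comp_affine, h.fderiv_fderiv_comp_affine]
    set D := fderiv ℝ (fderiv ℝ f) (L y + c) with hD
    set D' := fderiv ℝ (fderiv ℝ f) (L' y + c') with hD'
    have e : pull L D - pull L' D' = pull L (D - D') + (pull L D' - pull L' D') := by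
      ext v w; simp
    rw [e]
    refine (norm_add_le _ _).trans (add_le_add ?_ ?_)
    · refine (norm_pull_le L hL _).trans ((h.d3 _ _).trans ?_)
      gcongr
    · refine (norm_pull_sub_le L L' hL hL' _).trans ?_
      have := h.d2 (L' y + c')
      gcongr

end SmoothBound

end

/-! ### Gradients and Hessians -/

section

variable {d : ℕ}

attribute [local irreducible] act gaussianNoise cmExp

theorem gradient_eq (f : Param d → ℝ) (ψ : Param d) :
    gradient f ψ = (InnerProductSpace.toDual ℝ (Param d)).symm (fderiv ℝ f ψ) := rfl

theorem norm_gradient_sub (f g : Param d → ℝ) (ψ φ : Param d) :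
    ‖gradient f ψ - gradient g φ‖ = ‖fderiv ℝ f ψ - fderiv ℝ g φ‖ := by
  rw [gradient_eq, gradient_eq, ← map_sub, LinearIsometryEquiv.norm_map]

theorem norm_gradient (f : Param d → ℝ) (ψ : Param d) : ‖gradient f ψ‖ = ‖fderiv ℝ f ψ‖ := by
  rw [gradient_eq, LinearIsometryEquiv.norm_map]

theorem inner_gradient (f : Param d → ℝ) (ψ v : Param d) :
    ⟪gradient f ψ, v⟫ = fderiv ℝ f ψ v := by
  rw [gradient_eq, InnerProductSpace.toDual_symm_apply]

/-- The Riesz isometry is linear, so it commutes with differentiation; all bounds can be proved for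
Fréchet derivatives. -/
theorem hessian_apply {f : Param d → ℝ} (hf : ContDiff ℝ 2 f) (ψ v : Param d) :
    hessian f ψ v =
      (InnerProductSpace.toDual ℝ (Param d)).symm (fderiv ℝ (fderiv ℝ f) ψ v) := by
  let L := (InnerProductSpace.toDual ℝ (Param d)).symm.toContinuousLinearEquiv
  have h := L.toContinuousLinearMap.hasFDerivAt.comp ψ
    (differentiable_fderiv_of_contDiff_two hf ψ).hasFDerivAt
  have h2 : HasFDerivAt (gradient f) _ ψ := h
  rw [hessian, h2.fderiv]
  rfl

theorem inner_hessian {f : Param d → ℝ} (hf : ContDiff ℝ 2 f) (ψ v w : Param d) :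
    ⟪hessian f ψ v, w⟫ = fderiv ℝ (fderiv ℝ f) ψ v w := by
  rw [hessian_apply hf, InnerProductSpace.toDual_symm_apply]

theorem norm_hessian_sub_le {f g : Param d → ℝ} (hf : ContDiff ℝ 2 f) (hg : ContDiff ℝ 2 g)
    (ψ φ : Param d) :
    ‖hessian f ψ - hessian g φ‖ ≤ ‖fderiv ℝ (fderiv ℝ f) ψ - fderiv ℝ (fderiv ℝ g) φ‖ := by
  refine ContinuousLinearMap.opNorm_le_bound _ (norm_nonneg _) fun v => ?_
  rw [sub_apply, hessian_apply hf, hessian_apply hg, ← map_sub, LinearIsometryEquiv.norm_map,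
    ← sub_apply]
  exact ContinuousLinearMap.le_opNorm _ _

theorem norm_hessian_le {f : Param d → ℝ} (hf : ContDiff ℝ 2 f) (ψ : Param d) :
    ‖hessian f ψ‖ ≤ ‖fderiv ℝ (fderiv ℝ f) ψ‖ := by
  refine ContinuousLinearMap.opNorm_le_bound _ (norm_nonneg _) fun v => ?_
  rw [hessian_apply hf, LinearIsometryEquiv.norm_map]
  exact ContinuousLinearMap.le_opNorm _ _

/-! ### Regularity of expected costs -/

variable {f : E d → E d} {σ : ℝ} {c : E d → E d → ℝ}

/-- The linear part of the parameters of `tailCost` along a policy. -/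
noncomputable def tailParam (s : E d) : Param d →L[ℝ] Param d × E d :=
  (ContinuousLinearMap.id ℝ (Param d)).prod (evalAt s)

theorem norm_tailParam_le {s : E d} (hs : s ∈ stateSpace d) : ‖tailParam s‖ ≤ 1 :=
  ContinuousLinearMap.opNorm_le_bound _ zero_le_one fun ψ => by
    have h : ‖evalAt s ψ‖ ≤ 1 * ‖ψ‖ :=
      ((evalAt s).le_opNorm ψ).trans (by gcongr; exact norm_evalAt_le_one hs)
    exact max_le (by simp [tailParam]) h

theorem norm_evalAt_sub_le (s s' : E d) : ‖evalAt s - evalAt s'‖ ≤ ‖s - s'‖ := by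
  have : evalAt s - evalAt s' = evalAt (s - s') := by
    ext ψ; simp
  rw [this]; exact norm_evalAt_le _

theorem norm_tailParam_sub_le (s s' : E d) : ‖tailParam s - tailParam s'‖ ≤ ‖s - s'‖ :=
  ContinuousLinearMap.opNorm_le_bound _ (norm_nonneg _) fun ψ => by
    have h : ‖(evalAt s - evalAt s') ψ‖ ≤ ‖s - s'‖ * ‖ψ‖ :=
      ((evalAt s - evalAt s').le_opNorm ψ).trans (by gcongr; exact norm_evalAt_sub_le s s')
    have e : (tailParam s - tailParam s') ψ = (0, (evalAt s - evalAt s') ψ) := by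
      simp [tailParam]
    rw [e]
    exact max_le (by rw [norm_zero]; positivity) h

theorem contDiff_expCost (hf : Measurable f) (hfS : ∀ x, f x ∈ stateSpace d) (hσ : 0 < σ)
    (hc : Measurable (Function.uncurry c)) (hK : ∀ s a, |c s a| ≤ 1) (k : ℕ) (s : E d) :
    ContDiff ℝ 2 fun ψ => expCost f σ c ψ k s := by
  cases k with
  | zero =>
    have : (fun ψ => expCost f σ c ψ 0 s) = fun _ => 0 := by
      funext ψ; simp [expCost, trajCost]
    rw [this]; exact contDiff_const
  | succ k =>
    have hcs : Measurable (c s) := hc.comp (measurable_const.prodMk measurable_id)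
    simp_rw [expCost_succ_eq hf hfS hσ hc hK]
    have h1 := (smoothBound_headCost hσ hcs zero_le_one (hK s)).contDiff_comp_affine (evalAt s) 0
    have h2 := (smoothBound_tailCost hf hfS hσ hc zero_le_one hK k).contDiff_comp_affine
      (tailParam s) (0, s)
    have e : (fun ψ => headCost σ (c s) (act ψ s) + tailCost f σ c k (ψ, s + act ψ s)) =
        fun ψ => headCost σ (c s) (evalAt s ψ + 0) + tailCost f σ c k (tailParam s ψ + (0, s)) := by
      funext ψ
      simp [tailParam, add_comm]
    rw [e]
    exact h1.add h2

/-- The differences in the state of an expected cost, of its gradient and of its Hessian. -/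
theorem jetBound_expCost_sub (hf : Measurable f) (hfS : ∀ x, f x ∈ stateSpace d) (hσ : 0 < σ)
    (hc : Measurable (Function.uncurry c)) (hK : ∀ s a, |c s a| ≤ 1) {Lr : ℝ} (hLr : 0 ≤ Lr)
    (hlip : ∀ s ∈ stateSpace d, ∀ s' ∈ stateSpace d, ∀ a, |c s a - c s' a| ≤ Lr * ‖s - s'‖)
    {k H : ℕ} (hk : k ≤ H) {ψ : Param d} (hψ : ‖act ψ‖ ≤ 2) {s s' : E d} (hs : s ∈ stateSpace d)
    (hs' : s' ∈ stateSpace d) {lam : ℝ} (hlam : ((H : ℝ) + 2) / σ ≤ lam) :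
    JetBound (fun ψ => expCost f σ c ψ k s - expCost f σ c ψ k s') ψ
      ((Lr + 72 * lam + 108 * H * lam) * ‖s - s'‖)
      ((36 * Lr * lam + 72 * lam ^ 2 + 36 * lam + 108 * H * lam ^ 2 + 36 * H * lam) * ‖s - s'‖)
      ((36 * Lr * lam ^ 2 + 72 * lam ^ 3 + 72 * lam ^ 2 + 108 * H * lam ^ 3 + 72 * H * lam ^ 2) *
        ‖s - s'‖) := by
  have hlam0 : 0 < lam := lt_of_lt_of_le (by positivity) hlam
  cases k with
  | zero =>
    have e : (fun ψ => expCost f σ c ψ 0 s - expCost f σ c ψ 0 s') = fun _ => 0 := by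
      funext ψ; simp [expCost, trajCost]
    rw [e]
    refine ⟨contDiff_const, ?_, ?_, ?_⟩
    · rw [abs_zero]; positivity
    · rw [fderiv_fun_const, Pi.zero_apply, norm_zero]; positivity
    · rw [fderiv_fun_const, fderiv_zero, Pi.zero_apply, norm_zero]; positivity
  | succ k =>
    have hm : ∀ s, Measurable (c s) := fun s => hc.comp (measurable_const.prodMk measurable_id)
    set Δ := ‖s - s'‖ with hΔ
    -- The inverse length scales are `2 / σ` for the first step and `(k + 2) / σ` for the later
    -- ones; `(H + 2) / σ` dominates both.
    have hl1 : (((1 : ℕ) : ℝ) + 1) / σ ≤ lam := by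
      refine le_trans (div_le_div_of_nonneg_right ?_ hσ.le) hlam
      rw [Nat.cast_one]
      linarith [(Nat.cast_nonneg H : (0 : ℝ) ≤ H)]
    have hkH : ((k : ℝ) + 1) ≤ H := by exact_mod_cast hk
    have hl2 : (((k + 1 : ℕ) : ℝ) + 1) / σ ≤ lam :=
      le_trans (by gcongr; linarith) hlam
    have hl1' : 0 ≤ (((1 : ℕ) : ℝ) + 1) / σ := by positivity
    have hl2' : 0 ≤ (((k + 1 : ℕ) : ℝ) + 1) / σ := by positivity
    -- The change of the reward function with the state: the difference of the two rewards is a cost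
    -- bounded by `Lr * Δ`.
    have r1 := (smoothBound_headCost hσ ((hm s).sub (hm s')) (K := Lr * Δ) (by positivity)
      (hlip s hs s' hs')).jetBound (abs_headCost_le hσ ((hm s).sub (hm s')) (hlip s hs s' hs'))
        (evalAt s) (norm_evalAt_le_one hs) 0 ψ
    have hψs : ‖act ψ (s - s')‖ ≤ 2 * Δ := ((act ψ).le_opNorm _).trans (by gcongr)
    -- The change of the mean of the action, at most `2 * Δ` as `‖act ψ‖ ≤ 2`; below, the mean of `s
    -- + a` moves by at most `3 * Δ`.
    have r2 := (smoothBound_headCost hσ (hm s') zero_le_one (hK s')).jetBound_sub (by positivity)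
      (norm_evalAt_le_one hs) (norm_evalAt_le_one hs') 0 0 ψ (δ1 := 2 * Δ)
      (by rw [add_zero, add_zero, evalAt_apply, evalAt_apply, ← map_sub]; exact hψs)
      (norm_evalAt_sub_le s s')
    have r3 := (smoothBound_tailCost hf hfS hσ hc zero_le_one hK k).jetBound_sub (by positivity)
      (norm_tailParam_le hs) (norm_tailParam_le hs') (0, s) (0, s') ψ (δ1 := 3 * Δ)
      (by
        have e : tailParam s ψ + (0, s) - (tailParam s' ψ + (0, s')) =
            (0, act ψ (s - s') + (s - s')) := by
          simp [tailParam]; abel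
        rw [e]
        refine max_le (by rw [norm_zero]; positivity) ((norm_add_le _ _).trans ?_)
        linarith)
      (norm_tailParam_sub_le s s')
    have r := (r1.add r2).add r3
    have e : (fun ψ => expCost f σ c ψ (k + 1) s - expCost f σ c ψ (k + 1) s') = fun ψ =>
        headCost σ (fun x => c s x - c s' x) (evalAt s ψ + 0) +
          (headCost σ (c s') (evalAt s ψ + 0) - headCost σ (c s') (evalAt s' ψ + 0)) +
        (tailCost f σ c k (tailParam s ψ + (0, s)) -
          tailCost f σ c k (tailParam s' ψ + (0, s'))) := by
      funext ψ
      have e2 : ∀ s, tailParam s ψ + (0, s) = (ψ, s + act ψ s) := fun s => by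
        simp [tailParam, add_comm]
      rw [expCost_succ_eq hf hfS hσ hc hK, expCost_succ_eq hf hfS hσ hc hK, e2, e2,
        headCost_sub hσ (hm s) (hm s') (hK s) (hK s'), add_zero, add_zero, evalAt_apply,
        evalAt_apply]
      ring
    rw [e]
    have hk0 : (k : ℝ) ≤ H := by linarith
    have hΔ0 : 0 ≤ Δ := norm_nonneg _
    refine ⟨r.contDiff, r.d0.trans ?_, r.d1.trans ?_, r.d2.trans ?_⟩
    · calc _ ≤ Lr * Δ + 36 * 1 * lam * (2 * Δ) + 36 * (H * 1) * lam * (3 * Δ) := by gcongr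
        _ = _ := by ring
    · calc _ ≤ 36 * (Lr * Δ) * lam + (36 * 1 * lam ^ 2 * (2 * Δ) + 36 * 1 * lam * Δ) +
          (36 * (H * 1) * lam ^ 2 * (3 * Δ) + 36 * (H * 1) * lam * Δ) := by gcongr
        _ = _ := by ring
    · calc _ ≤ 36 * (Lr * Δ) * lam ^ 2 + (36 * 1 * lam ^ 3 * (2 * Δ) + 2 * (36 * 1 * lam ^ 2) * Δ) +
          (36 * (H * 1) * lam ^ 3 * (3 * Δ) + 2 * (36 * (H * 1) * lam ^ 2) * Δ) := by gcongr
        _ = _ := by ring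

end

end ModelRL

namespace ModelRL

attribute [local irreducible] act gaussianNoise cmExp

section

variable {d : ℕ} {f g : E d → E d} {σ : ℝ} {c : E d → E d → ℝ} {K : ℝ}

/-! ### Comparison of two dynamics -/

/-- The one-step error of the dynamics `f` with respect to the dynamics `g`. -/
noncomputable def stepError (f g : E d → E d) (s a : E d) : ℝ := ‖f (s + a) - g (s + a)‖

theorem measurable_stepError (hf : Measurable f) (hg : Measurable g) :
    Measurable (Function.uncurry (stepError f g)) := by
  have h : Measurable fun p : E d × E d => p.1 + p.2 := measurable_fst.add measurable_snd
  exact ((hf.comp h).sub (hg.comp h)).norm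

theorem stepError_le (hfS : ∀ x, f x ∈ stateSpace d) (hgS : ∀ x, g x ∈ stateSpace d) (s a : E d) :
    |stepError f g s a| ≤ 2 := by
  rw [stepError, abs_norm]
  have h1 := mem_closedBall_zero_iff.1 (hfS (s + a))
  have h2 := mem_closedBall_zero_iff.1 (hgS (s + a))
  linarith [norm_sub_le (f (s + a)) (g (s + a))]

theorem expCost_zero (ψ : Param d) (s : E d) : expCost f σ c ψ 0 s = 0 := by
  simp [expCost, trajCost]

/-- Bellman's equation for both dynamics: after one step, the value under `f` changes between the
two next states by at most `L` times the one-step error, and from the common next state of `g` the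
induction applies. All errors are thus incurred along trajectories of `g`, with the Lipschitz
constant of the values of `f`. -/
theorem abs_expCost_sub_le (hf : Measurable f) (hfS : ∀ x, f x ∈ stateSpace d)
    (hg : Measurable g) (hgS : ∀ x, g x ∈ stateSpace d)
    (hc : Measurable (Function.uncurry c)) (hK : ∀ s a, |c s a| ≤ K) {L : ℝ} {ψ : Param d}
    {k : ℕ} (hL : ∀ j < k, ∀ s ∈ stateSpace d, ∀ s' ∈ stateSpace d,
      |expCost f σ c ψ j s - expCost f σ c ψ j s'| ≤ L * ‖s - s'‖) (s : E d) :
    |expCost f σ c ψ k s - expCost g σ c ψ k s| ≤ L * expCost g σ (stepError f g) ψ k s := by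
  induction k generalizing s with
  | zero => simp [expCost_zero]
  | succ k ih =>
    have hδ := measurable_stepError hf hg
    have hδ2 := stepError_le hfS hgS
    have hadd : Measurable fun x : E d => act ψ s + x := measurable_const_add _
    have hadd2 : Measurable fun x : E d => s + (act ψ s + x) :=
      (measurable_const_add s).comp hadd
    have hcs : Integrable (fun x => c s (act ψ s + x)) (gaussianNoise d σ) :=
      integrable_of_abs_le (hc.comp (measurable_const.prodMk hadd)) fun x => hK _ _
    have hint : ∀ {f : E d → E d} {c : E d → E d → ℝ} {K : ℝ}, Measurable f →
        Measurable (Function.uncurry c) → (∀ s a, |c s a| ≤ K) →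
        Integrable (fun x => c s (act ψ s + x) + expCost f σ c ψ k (f (s + (act ψ s + x))))
          (gaussianNoise d σ) := fun hf hc hK =>
      (integrable_of_abs_le (hc.comp (measurable_const.prodMk hadd)) fun x => hK _ _).add
        (integrable_of_abs_le (((measurable_expCost hf hc ψ k).comp hf).comp hadd2)
          fun x => abs_expCost_le hK _ _ _)
    rw [expCost_succ hf hc hK, expCost_succ hg hc hK, expCost_succ hg hδ hδ2,
      ← integral_sub (hint hf hc hK) (hint hg hc hK), ← integral_const_mul, ← Real.norm_eq_abs]
    refine norm_integral_le_of_norm_le ((hint hg hδ hδ2).const_mul L) (.of_forall fun x => ?_)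
    set y := s + (act ψ s + x)
    rw [Real.norm_eq_abs]
    have h1 := hL k (Nat.lt_succ_self k) (f y) (hfS y) (g y) (hgS y)
    have h2 := ih (fun j hj => hL j (hj.trans (Nat.lt_succ_self k))) (g y)
    calc |c s (act ψ s + x) + expCost f σ c ψ k (f y) -
          (c s (act ψ s + x) + expCost g σ c ψ k (g y))|
        = |(expCost f σ c ψ k (f y) - expCost f σ c ψ k (g y)) +
            (expCost f σ c ψ k (g y) - expCost g σ c ψ k (g y))| := by congr 1; ring
      _ ≤ _ := abs_add_le _ _
      _ ≤ L * ‖f y - g y‖ + L * expCost g σ (stepError f g) ψ k (g y) := add_le_add h1 h2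
      _ = _ := by rw [mul_add]; rfl

/-! ### Random initial states -/

open Classical in
/-- A retraction onto the state space. -/
noncomputable def projState (s : E d) : E d := if s ∈ stateSpace d then s else 0

theorem projState_mem (s : E d) : projState s ∈ stateSpace d := by
  unfold projState
  split_ifs with h
  · exact h
  · exact Metric.mem_closedBall_self zero_le_one

theorem projState_eq {s : E d} (hs : s ∈ stateSpace d) : projState s = s := if_pos hs

theorem measurable_projState : Measurable (projState (d := d)) :=
  Measurable.ite Metric.isClosed_closedBall.measurableSet measurable_id measurable_const

variable {μ : Measure (E d)} [IsProbabilityMeasure μ]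

theorem measurable_rollout_proj (hf : Measurable f) (ψ : Param d) (k : ℕ) :
    Measurable fun ω : E d × (Fin k → E d) => rollout f ψ k (projState ω.1) ω.2 :=
  (measurable_rollout_apply hf ψ k).comp
    ((measurable_projState.comp measurable_fst).prodMk measurable_snd)

/-- The initial state lies in the ball only almost surely, whereas the exponential family needs
bounded states everywhere; hence the retraction. The formula follows by conditioning on the initial
state. -/
theorem integral_rollout_proj (hf : Measurable f) (hfS : ∀ x, f x ∈ stateSpace d) (hσ : 0 < σ)
    (ψ : Param d) (k : ℕ) {Φ : Traj d k → ℝ} (hΦ : Measurable Φ) :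
    ∫ ω, Φ (rollout f ψ k (projState ω.1) ω.2) ∂(μ.prod (noise d σ k)) =
      ∫ ω, Φ (rollout f 0 k (projState ω.1) ω.2) *
        (trajFamily (μ := μ) hf hfS hσ k measurable_projState projState_mem).rho ω ψ
          ∂(μ.prod (noise d σ k)) := by
  simp only [trajFamily_rho]
  have hl : Measurable fun ω : E d × (Fin k → E d) => logLik f σ ψ k (projState ω.1) ω.2 :=
    (measurable_logLik hf σ ψ k).comp
      ((measurable_projState.comp measurable_fst).prodMk measurable_snd)
  refine integral_eq_of_lintegral_eq (measurable_rollout_proj hf ψ k)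
    (measurable_rollout_proj hf 0 k) hl (fun Φ hΦ => ?_) hΦ
  have h1 : Measurable fun ω : E d × (Fin k → E d) => Φ (rollout f ψ k (projState ω.1) ω.2) :=
    hΦ.comp (measurable_rollout_proj hf ψ k)
  have h2 : Measurable fun ω : E d × (Fin k → E d) => Φ (rollout f 0 k (projState ω.1) ω.2) *
      ENNReal.ofReal (Real.exp (logLik f σ ψ k (projState ω.1) ω.2)) :=
    (hΦ.comp (measurable_rollout_proj hf 0 k)).mul
      (ENNReal.measurable_ofReal.comp (Real.measurable_exp.comp hl))
  refine (lintegral_prod _ h1.aemeasurable).trans (Eq.trans ?_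
    (lintegral_prod _ h2.aemeasurable).symm)
  exact lintegral_congr fun s => lintegral_rollout hf hσ ψ k (projState s) hΦ

theorem integral_expCost_proj (hf : Measurable f) (hc : Measurable (Function.uncurry c))
    (hK : ∀ s a, |c s a| ≤ K) (ψ : Param d) (k : ℕ) :
    ∫ s, expCost f σ c ψ k (projState s) ∂μ =
      ∫ ω, trajCost c (rollout f ψ k (projState ω.1) ω.2) ∂(μ.prod (noise d σ k)) := by
  have hm : Measurable fun ω : E d × (Fin k → E d) =>
      trajCost c (rollout f ψ k (projState ω.1) ω.2) :=
    (measurable_trajCost hc k).comp (measurable_rollout_proj hf ψ k)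
  exact (integral_prod _ (integrable_of_abs_le hm fun ω => abs_trajCost_le hK _)).symm

theorem smoothBound_integral_expCost (hf : Measurable f) (hfS : ∀ x, f x ∈ stateSpace d)
    (hσ : 0 < σ) (hc : Measurable (Function.uncurry c)) (hK0 : 0 ≤ K) (hK : ∀ s a, |c s a| ≤ K)
    (k : ℕ) :
    SmoothBound (fun ψ => ∫ s, expCost f σ c ψ k (projState s) ∂μ)
      (36 * (k * K) * ((k + 1) / σ)) (36 * (k * K) * ((k + 1) / σ) ^ 2)
      (36 * (k * K) * ((k + 1) / σ) ^ 3) := by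
  have hm : Measurable fun ω : E d × (Fin k → E d) =>
      trajCost c (rollout f 0 k (projState ω.1) ω.2) :=
    (measurable_trajCost hc k).comp (measurable_rollout_proj hf 0 k)
  have h := (trajFamily (μ := μ) hf hfS hσ k measurable_projState
    projState_mem).smoothBound_integral hm.stronglyMeasurable (K := k * K) (by positivity)
      fun ω => abs_trajCost_le hK _
  have e : (fun ψ => ∫ s, expCost f σ c ψ k (projState s) ∂μ) = _ := funext fun ψ =>
    (integral_expCost_proj hf hc hK ψ k).trans
      (integral_rollout_proj hf hfS hσ ψ k (measurable_trajCost hc k))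
  rw [e]
  exact h

/-- Errors observed under `ψ` control expectations under every policy within the length scale of the
family, at a cost that does not depend on the dimension. -/
theorem sq_integral_rollout_proj_le (hf : Measurable f) (hfS : ∀ x, f x ∈ stateSpace d)
    (hσ : 0 < σ) (k : ℕ) {Φ : Traj d k → ℝ} (hΦ : Measurable Φ) (hK : ∀ z, |Φ z| ≤ K)
    (ψ φ : Param d) :
    (∫ ω, Φ (rollout f φ k (projState ω.1) ω.2) ∂(μ.prod (noise d σ k))) ^ 2 ≤
      Real.exp (((k + 1) / σ) ^ 2 * ‖φ - ψ‖ ^ 2) *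
        ∫ ω, Φ (rollout f ψ k (projState ω.1) ω.2) ^ 2 ∂(μ.prod (noise d σ k)) := by
  have hm : Measurable fun ω : E d × (Fin k → E d) => Φ (rollout f 0 k (projState ω.1) ω.2) :=
    hΦ.comp (measurable_rollout_proj hf 0 k)
  have h := (trajFamily (μ := μ) hf hfS hσ k measurable_projState projState_mem).sq_integral_le
    hm.stronglyMeasurable (fun ω => hK _) ψ (φ - ψ)
  rw [add_sub_cancel] at h
  have e1 := integral_rollout_proj (μ := μ) hf hfS hσ φ k hΦ
  have e2 := integral_rollout_proj (μ := μ) hf hfS hσ ψ k (hΦ.pow_const 2)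
  exact (congrArg (· ^ 2) e1).le.trans (h.trans (le_of_eq (congrArg _ e2.symm)))

/-- The total squared prediction error along a trajectory. -/
noncomputable def sqError (f g : E d → E d) {k : ℕ} (z : Traj d k) : ℝ :=
  trajCost (fun s a => stepError f g s a ^ 2) z

theorem sq_trajCost_le (c : E d → E d → ℝ) {k : ℕ} (z : Traj d k) :
    trajCost c z ^ 2 ≤ k * trajCost (fun s a => c s a ^ 2) z := by
  have h := sq_sum_le_card_mul_sum_sq (s := Finset.univ)
    (f := fun i : Fin k => c (z i).1 (z i).2.1)
  simpa [trajCost] using h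

theorem measurable_sqError (hf : Measurable f) (hg : Measurable g) (k : ℕ) :
    Measurable (sqError f g (k := k)) :=
  measurable_trajCost (c := fun s a => stepError f g s a ^ 2)
    ((measurable_stepError hf hg).pow_const 2) k

theorem sqError_nonneg {k : ℕ} (z : Traj d k) : 0 ≤ sqError f g z := by
  unfold sqError trajCost
  exact Finset.sum_nonneg fun _ _ => sq_nonneg _

theorem abs_sqError_le (hfS : ∀ x, f x ∈ stateSpace d) (hgS : ∀ x, g x ∈ stateSpace d) {k : ℕ}
    (z : Traj d k) : |sqError f g z| ≤ k * 4 :=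
  abs_trajCost_le (fun s a => by
    rw [abs_pow]
    calc |stepError f g s a| ^ 2 ≤ 2 ^ 2 := by gcongr; exact stepError_le hfS hgS s a
      _ = 4 := by norm_num) z

/-- The returns of two models differ by at most the root of the expected squared prediction error
along the trajectories of any nearby policy. -/
theorem abs_integral_expCost_sub_le (hf : Measurable f) (hfS : ∀ x, f x ∈ stateSpace d)
    (hg : Measurable g) (hgS : ∀ x, g x ∈ stateSpace d) (hσ : 0 < σ)
    (hc : Measurable (Function.uncurry c)) (hK : ∀ s a, |c s a| ≤ K) {L : ℝ} (hL0 : 0 ≤ L)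
    {φ ψ : Param d} {k : ℕ} (hL : ∀ j < k, ∀ s ∈ stateSpace d, ∀ s' ∈ stateSpace d,
      |expCost f σ c φ j s - expCost f σ c φ j s'| ≤ L * ‖s - s'‖)
    (hφ : (k + 1) / σ * ‖φ - ψ‖ ≤ 1) :
    |∫ s, expCost f σ c φ k (projState s) ∂μ - ∫ s, expCost g σ c φ k (projState s) ∂μ| ≤
      L * √(3 * k * ∫ ω, sqError f g (rollout g ψ k (projState ω.1) ω.2)
        ∂(μ.prod (noise d σ k))) := by
  have hδ := measurable_stepError hf hg
  have hδ2 := stepError_le hfS hgS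
  have hi : ∀ {f : E d → E d} {c : E d → E d → ℝ} {K : ℝ}, Measurable f →
      Measurable (Function.uncurry c) → (∀ s a, |c s a| ≤ K) →
      Integrable (fun s => expCost f σ c φ k (projState s)) μ := fun hf hc hK =>
    integrable_of_abs_le ((measurable_expCost hf hc φ k).comp measurable_projState)
      fun x => abs_expCost_le hK _ _ _
  have h1 : |∫ s, expCost f σ c φ k (projState s) ∂μ - ∫ s, expCost g σ c φ k (projState s) ∂μ| ≤
      L * ∫ s, expCost g σ (stepError f g) φ k (projState s) ∂μ := by
    rw [← integral_sub (hi hf hc hK) (hi hg hc hK), ← integral_const_mul, ← Real.norm_eq_abs]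
    exact norm_integral_le_of_norm_le ((hi hg hδ hδ2).const_mul L) (.of_forall fun s =>
      abs_expCost_sub_le hf hfS hg hgS hc hK hL _)
  refine h1.trans (mul_le_mul_of_nonneg_left (Real.le_sqrt_of_sq_le ?_) hL0)
  rw [integral_expCost_proj hg hδ hδ2]
  refine (sq_integral_rollout_proj_le hg hgS hσ k (measurable_trajCost hδ k)
    (fun z => abs_trajCost_le hδ2 z) ψ φ).trans ?_
  -- Within the length scale the change of policy costs at most `e`, which is the 3 under the root;
  -- the factor `k` comes from Cauchy–Schwarz over the steps.
  have he : Real.exp (((k + 1) / σ) ^ 2 * ‖φ - ψ‖ ^ 2) ≤ 3 := by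
    rw [← mul_pow]
    calc Real.exp (((k + 1) / σ * ‖φ - ψ‖) ^ 2) ≤ Real.exp 1 :=
          Real.exp_le_exp.2 (pow_le_one₀ (by positivity) hφ)
      _ ≤ 3 := Real.exp_one_lt_three.le
  have hs : Integrable (fun ω : E d × (Fin k → E d) =>
      (k : ℝ) * sqError f g (rollout g ψ k (projState ω.1) ω.2)) (μ.prod (noise d σ k)) :=
    (integrable_of_abs_le ((measurable_sqError hf hg k).comp (measurable_rollout_proj hg ψ k))
      fun ω => abs_sqError_le hfS hgS _).const_mul _
  calc _ ≤ 3 * ∫ ω, (k : ℝ) * sqError f g (rollout g ψ k (projState ω.1) ω.2)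
        ∂(μ.prod (noise d σ k)) := by
        refine mul_le_mul he ?_ (integral_nonneg fun ω => sq_nonneg _) (by norm_num)
        refine integral_mono_of_nonneg (.of_forall fun ω => sq_nonneg _) hs
          (.of_forall fun ω => sq_trajCost_le _ _)
    _ = _ := by rw [integral_const_mul]; ring

end

end ModelRL

namespace ModelRL

namespace Instance

attribute [local irreducible] act gaussianNoise cmExp

/-! ### Regularity of values and returns -/

variable {d : ℕ} {Θ : Type*} (M : Instance d Θ)

instance : IsProbabilityMeasure M.μ₁ := M.μ₁_prob

open Classical in
/-- The reward, extended by zero to all states. -/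
noncomputable def rew (s a : E d) : ℝ := if s ∈ stateSpace d then M.r s a else 0

theorem rew_eq {s : E d} (hs : s ∈ stateSpace d) (a : E d) : M.rew s a = M.r s a := if_pos hs

theorem rew_mem (s a : E d) : M.rew s a ∈ Set.Icc (0 : ℝ) 1 := by
  unfold rew
  split_ifs with h
  · exact M.r_mem s h a
  · exact ⟨le_rfl, zero_le_one⟩

theorem abs_rew_le (s a : E d) : |M.rew s a| ≤ 1 :=
  abs_le.2 ⟨by linarith [(M.rew_mem s a).1], (M.rew_mem s a).2⟩

theorem abs_rew_sub_le (s : E d) (hs : s ∈ stateSpace d) (s' : E d) (hs' : s' ∈ stateSpace d)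
    (a : E d) : |M.rew s a - M.rew s' a| ≤ M.Lr * ‖s - s'‖ := by
  rw [rew_eq M hs, rew_eq M hs']
  simpa using M.r_lip s hs s' hs' a a

/-- The reward is Lipschitz, hence continuous, on the states and unrestricted outside; extending it
by zero makes it measurable everywhere. -/
theorem measurable_rew : Measurable (Function.uncurry M.rew) := by
  classical
  have hS : MeasurableSet (stateSpace d ×ˢ (Set.univ : Set (E d))) :=
    Metric.isClosed_closedBall.measurableSet.prod MeasurableSet.univ
  have hc : ContinuousOn (Function.uncurry M.r) (stateSpace d ×ˢ (Set.univ : Set (E d))) := by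
    refine (LipschitzOnWith.of_dist_le_mul (K := ⟨2 * M.Lr, mul_nonneg zero_le_two M.Lr_nonneg⟩)
      fun p hp q hq => ?_).continuousOn
    have h1 := M.r_lip p.1 hp.1 q.1 hq.1 p.2 q.2
    have h2 : ‖p.1 - q.1‖ ≤ dist p q := by rw [dist_eq_norm]; exact le_max_left _ _
    have h3 : ‖p.2 - q.2‖ ≤ dist p q := by rw [dist_eq_norm]; exact le_max_right _ _
    calc dist (M.r p.1 p.2) (M.r q.1 q.2) ≤ M.Lr * (‖p.1 - q.1‖ + ‖p.2 - q.2‖) := h1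
      _ ≤ M.Lr * (dist p q + dist p q) := by
          have := M.Lr_nonneg
          gcongr
      _ = 2 * M.Lr * dist p q := by ring
  have h := hc.measurable_piecewise (g := fun _ => (0 : ℝ)) continuousOn_const hS
  convert h using 1
  funext p
  simp [Function.uncurry, rew, Set.piecewise]

/-- The bound for `N θ (s + a)` at `s = 0` already covers every argument. -/
theorem N_mem (θ : Θ) (x : E d) : M.N θ x ∈ stateSpace d := by
  have h := M.N_bound θ 0 (Metric.mem_closedBall_self zero_le_one) x
  rw [zero_add] at h
  exact mem_closedBall_zero_iff.2 h

theorem value_eq (θ : Θ) (ψ : Param d) (k : ℕ) {s : E d} (hs : s ∈ stateSpace d) :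
    M.value θ ψ k s = expCost (M.N θ) M.σ M.rew ψ k s := by
  refine integral_congr_ae (.of_forall fun u => Finset.sum_congr rfl fun i _ => ?_)
  exact (M.rew_eq (rollout_mem (M.N_mem θ) ψ k hs u i).1 _).symm

theorem eta_eq (θ : Θ) (ψ : Param d) :
    M.eta θ ψ = ∫ s, expCost (M.N θ) M.σ M.rew ψ M.H (projState s) ∂M.μ₁ := by
  refine integral_congr_ae ?_
  filter_upwards [M.μ₁_supp] with s hs
  rw [M.value_eq θ ψ M.H hs, projState_eq hs]

theorem eta_nonneg (θ : Θ) (ψ : Param d) : 0 ≤ M.eta θ ψ := by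
  rw [eta_eq]
  exact integral_nonneg fun s => integral_nonneg fun u =>
    Finset.sum_nonneg fun i _ => (M.rew_mem _ _).1

theorem eta_le (θ : Θ) (ψ : Param d) : M.eta θ ψ ≤ M.H := by
  rw [eta_eq]
  have h : ∀ s, |expCost (M.N θ) M.σ M.rew ψ M.H (projState s)| ≤ M.H * 1 := fun s =>
    abs_expCost_le M.abs_rew_le _ _ _
  have h2 := (le_abs_self _).trans (abs_integral_le_of_abs_le (P := M.μ₁) h)
  linarith

/-- The inverse length scale of the policy parameters. -/
noncomputable def scale : ℝ := (M.H + 2) / M.σ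

theorem scale_pos : 0 < M.scale := div_pos (by positivity) M.σ_pos

theorem succ_div_le_scale : ((M.H : ℝ) + 1) / M.σ ≤ M.scale :=
  div_le_div_of_nonneg_right (by linarith) M.σ_pos.le

theorem smoothBound_eta (θ : Θ) :
    SmoothBound (M.eta θ) (36 * M.H * M.scale) (36 * M.H * M.scale ^ 2)
      (36 * M.H * M.scale ^ 3) := by
  have h := smoothBound_integral_expCost (μ := M.μ₁) (M.N_meas θ) (M.N_mem θ) M.σ_pos
    M.measurable_rew zero_le_one M.abs_rew_le M.H
  rw [← funext (M.eta_eq θ)] at h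
  have h0 : 0 ≤ ((M.H : ℝ) + 1) / M.σ := div_nonneg (by positivity) M.σ_pos.le
  have h1 := M.succ_div_le_scale
  refine ⟨h.contDiff, fun ψ => (h.d1 ψ).trans ?_, fun ψ => (h.d2 ψ).trans ?_,
    fun ψ φ => (h.d3 ψ φ).trans ?_⟩
  all_goals rw [mul_one]; gcongr

theorem returnLipschitz :
    ReturnLipschitz M.eta (36 * M.H * M.scale) (36 * M.H * M.scale ^ 2)
      (36 * M.H * M.scale ^ 3) where
  contDiff θ := (M.smoothBound_eta θ).contDiff
  grad_le θ ψ := (norm_gradient _ _).trans_le ((M.smoothBound_eta θ).d1 ψ)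
  hess_le θ ψ := (norm_hessian_le (M.smoothBound_eta θ).contDiff ψ).trans
    ((M.smoothBound_eta θ).d2 ψ)
  hess_lip θ ψ φ := (norm_hessian_sub_le (M.smoothBound_eta θ).contDiff
    (M.smoothBound_eta θ).contDiff ψ φ).trans ((M.smoothBound_eta θ).d3 ψ φ)

/-- A Lipschitz constant of the value functions. -/
noncomputable def valueLip : ℝ := M.Lr + 72 * M.scale + 108 * M.H * M.scale

/-- A Lipschitz constant of the gradients of the value functions. -/
noncomputable def valueLip1 : ℝ :=
  36 * M.Lr * M.scale + 72 * M.scale ^ 2 + 36 * M.scale + 108 * M.H * M.scale ^ 2 +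
    36 * M.H * M.scale

/-- A Lipschitz constant of the Hessians of the value functions. -/
noncomputable def valueLip2 : ℝ :=
  36 * M.Lr * M.scale ^ 2 + 72 * M.scale ^ 3 + 72 * M.scale ^ 2 + 108 * M.H * M.scale ^ 3 +
    72 * M.H * M.scale ^ 2

theorem valueLip_nonneg : 0 ≤ M.valueLip := by
  have := M.Lr_nonneg
  have := M.scale_pos
  unfold valueLip
  positivity

/-- The operator norm is allowed up to 2, not 1, because the comparison policies of the ascent
argument may leave the policy class. -/
theorem jetBound_value (θ : Θ) {ψ : Param d} (hψ : ‖act ψ‖ ≤ 2) {k : ℕ} (hk : k ≤ M.H) {s s' : E d}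
    (hs : s ∈ stateSpace d) (hs' : s' ∈ stateSpace d) :
    JetBound (fun ψ => expCost (M.N θ) M.σ M.rew ψ k s - expCost (M.N θ) M.σ M.rew ψ k s') ψ
      (M.valueLip * ‖s - s'‖) (M.valueLip1 * ‖s - s'‖) (M.valueLip2 * ‖s - s'‖) :=
  jetBound_expCost_sub (M.N_meas θ) (M.N_mem θ) M.σ_pos M.measurable_rew M.abs_rew_le
    M.Lr_nonneg M.abs_rew_sub_le hk hψ hs hs' (lam := M.scale) le_rfl

theorem abs_value_sub_le (θ : Θ) {ψ : Param d} (hψ : ‖act ψ‖ ≤ 2) {k : ℕ} (hk : k ≤ M.H)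
    {s s' : E d} (hs : s ∈ stateSpace d) (hs' : s' ∈ stateSpace d) :
    |expCost (M.N θ) M.σ M.rew ψ k s - expCost (M.N θ) M.σ M.rew ψ k s'| ≤
      M.valueLip * ‖s - s'‖ :=
  (M.jetBound_value θ hψ hk hs hs').d0

theorem valueLipschitz :
    ValueLipschitz M.value (policyClass d) (stateSpace d) M.H M.valueLip M.valueLip1
      M.valueLip2 := by
  have hC : ∀ θ k, ∀ s ∈ stateSpace d, ContDiff ℝ 2 fun ψ => M.value θ ψ k s := fun θ k s hs => by
    rw [funext fun ψ => M.value_eq θ ψ k hs]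
    exact contDiff_expCost (M.N_meas θ) (M.N_mem θ) M.σ_pos M.measurable_rew M.abs_rew_le k s
  have hJ : ∀ θ, ∀ ψ ∈ policyClass d, ∀ k ≤ M.H, ∀ s ∈ stateSpace d, ∀ s' ∈ stateSpace d,
      JetBound (fun ψ => M.value θ ψ k s - M.value θ ψ k s') ψ
        (M.valueLip * ‖s - s'‖) (M.valueLip1 * ‖s - s'‖) (M.valueLip2 * ‖s - s'‖) :=
    fun θ ψ hψ k hk s hs s' hs' => by
      have h := M.jetBound_value θ (ψ := ψ) (le_trans hψ one_le_two) hk hs hs'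
      rw [← funext fun ψ => congrArg₂ (· - ·) (M.value_eq θ ψ k hs) (M.value_eq θ ψ k hs')] at h
      exact h
  refine ⟨fun θ k _ s hs => hC θ k s hs, fun θ ψ hψ k hk s hs s' hs' =>
    (hJ θ ψ hψ k hk s hs s' hs').d0, fun θ ψ hψ k hk s hs s' hs' => ?_,
    fun θ ψ hψ k hk s hs s' hs' => ?_⟩
  · rw [norm_gradient_sub, ← fderiv_sub_of_contDiff (hC θ k s hs) (hC θ k s' hs')]
    exact (hJ θ ψ hψ k hk s hs s' hs').d1
  · refine (norm_hessian_sub_le (hC θ k s hs) (hC θ k s' hs') ψ ψ).trans ?_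
    rw [← fderiv_fderiv_sub_of_contDiff (hC θ k s hs) (hC θ k s' hs')]
    exact (hJ θ ψ hψ k hk s hs s' hs').d2

end Instance

end ModelRL

namespace ModelRL

/-! ### Moments of the score of the policies -/

section

variable {d : ℕ} {σ : ℝ}

instance isGaussian_policy (ψ : Param d) (s : E d) : IsGaussian (policy σ ψ s) := by
  unfold policy; infer_instance

attribute [local irreducible] act gaussianNoise cmExp

theorem log_policyDensity (hσ : 0 < σ) (s a : E d) :
    (fun φ : Param d => Real.log (policyDensity σ φ s a)) = fun φ =>
      Real.log ((√(2 * Real.pi * σ ^ 2))⁻¹ ^ d) +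
        -(2 * σ ^ 2)⁻¹ * ‖a - evalAt s φ‖ ^ 2 := by
  have hpi := Real.pi_pos
  funext φ
  rw [policyDensity, Real.log_mul (by positivity) (Real.exp_pos _).ne', Real.log_exp, evalAt_apply]
  ring

theorem contDiff_log_policyDensity (hσ : 0 < σ) (s a : E d) :
    ContDiff ℝ 2 fun φ : Param d => Real.log (policyDensity σ φ s a) := by
  rw [log_policyDensity hσ]
  exact contDiff_const.add (contDiff_const.mul ((contDiff_const.sub (evalAt s).contDiff).norm_sq ℝ))

/-- The score as a continuous linear function of the residual `a - ψ s`. -/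
noncomputable def scoreL (σ : ℝ) (s : E d) : E d →L[ℝ] Param d :=
  (σ ^ 2)⁻¹ • (evalAt s).adjoint

theorem inner_scoreL (s x : E d) (v : Param d) :
    ⟪scoreL σ s x, v⟫ = (σ ^ 2)⁻¹ * ⟪x, evalAt s v⟫ := by
  rw [scoreL, smul_apply, real_inner_smul_left, ContinuousLinearMap.adjoint_inner_left]

theorem hasGradientAt_log_policyDensity (hσ : 0 < σ) (s a : E d) (ψ : Param d) :
    HasGradientAt (fun φ : Param d => Real.log (policyDensity σ φ s a))
      (scoreL σ s (a - evalAt s ψ)) ψ := by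
  rw [log_policyDensity hσ]
  have h := ((((evalAt s).hasFDerivAt (x := ψ)).const_sub a).norm_sq.const_mul
    (-(2 * σ ^ 2)⁻¹)).const_add (Real.log ((√(2 * Real.pi * σ ^ 2))⁻¹ ^ d))
  refine h.congr_fderiv ?_
  ext v
  rw [InnerProductSpace.toDual_apply_apply, inner_scoreL]
  simp
  field_simp
  rw [inner_sub_left]
  ring

theorem score_eq (hσ : 0 < σ) (ψ : Param d) (s a : E d) :
    score σ ψ s a = scoreL σ s (a - evalAt s ψ) :=
  (hasGradientAt_log_policyDensity hσ s a ψ).gradient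

/-- The log-density is quadratic in the parameter, so its Hessian depends neither on the action nor
on the parameter. -/
theorem scoreHessian_eq (hσ : 0 < σ) (ψ : Param d) (s a : E d) :
    scoreHessian σ ψ s a = -(scoreL σ s).comp (evalAt s) := by
  have h : gradient (fun φ : Param d => Real.log (policyDensity σ φ s a)) =
      fun φ => scoreL σ s (a - evalAt s φ) :=
    funext fun φ => (hasGradientAt_log_policyDensity hσ s a φ).gradient
  rw [scoreHessian, hessian, h]
  have h2 := (scoreL σ s).hasFDerivAt.comp ψ (((evalAt s).hasFDerivAt (x := ψ)).const_sub a)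
  refine h2.fderiv.trans ?_
  ext1 v
  simp

theorem norm_scoreHessian_le (hσ : 0 < σ) {s : E d} (hs : s ∈ stateSpace d) (ψ : Param d)
    (a : E d) : ‖scoreHessian σ ψ s a‖ ≤ (σ ^ 2)⁻¹ := by
  have h1 := norm_evalAt_le_one hs
  rw [scoreHessian_eq hσ, norm_neg]
  calc ‖(scoreL σ s).comp (evalAt s)‖ ≤ ‖scoreL σ s‖ * ‖evalAt s‖ :=
        ContinuousLinearMap.opNorm_comp_le _ _
    _ = (σ ^ 2)⁻¹ * ‖evalAt s‖ * ‖evalAt s‖ := by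
        rw [scoreL, norm_smul, Real.norm_of_nonneg (by positivity), LinearIsometryEquiv.norm_map]
    _ ≤ (σ ^ 2)⁻¹ * 1 * 1 := by gcongr
    _ = (σ ^ 2)⁻¹ := by ring

theorem integral_policy (ψ : Param d) (s : E d) {Φ : E d → ℝ} (hΦ : Measurable Φ) :
    ∫ a, Φ a ∂(policy σ ψ s) = ∫ x, Φ (act ψ s + x) ∂(gaussianNoise d σ) := by
  rw [← map_gaussianNoise_eq_policy, integral_map (measurable_const_add _).aemeasurable
    hΦ.aestronglyMeasurable]

theorem continuous_score (hσ : 0 < σ) (ψ : Param d) (s : E d) :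
    Continuous fun a => score σ ψ s a := by
  simp_rw [score_eq hσ]
  exact (scoreL σ s).continuous.comp (continuous_sub_right _)

theorem memLp_score (hσ : 0 < σ) (ψ : Param d) (s : E d) (p : ℕ) :
    MemLp (fun a => score σ ψ s a) p (policy σ ψ s) := by
  simp_rw [score_eq hσ]
  exact (scoreL σ s).comp_memLp'
    ((IsGaussian.memLp_id (policy σ ψ s) p (ENNReal.natCast_ne_top p)).sub (memLp_const _))

/-- After subtracting the mean of the action, the score of the policy is the score at parameter `0`
of the exponential family of one step, where the likelihood ratio is one. -/
theorem integral_abs_inner_score_pow_le (hσ : 0 < σ) {s : E d} (hs : s ∈ stateSpace d)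
    (ψ : Param d) {v : Param d} (hv : ‖v‖ ≤ 1) (n : ℕ) :
    ∫ a, |⟪score σ ψ s a, v⟫| ^ n ∂(policy σ ψ s) ≤ 4 * n.factorial * (2 / σ) ^ n := by
  have h := ((stepFamily hσ (evalAt s) (norm_evalAt_le_one hs)).integral_rho_mul_score_pow_le 0
    hv n).2
  have hm : Measurable fun a => |⟪score σ ψ s a, v⟫| ^ n :=
    ((((continuous_score hσ ψ s).inner continuous_const).abs).pow n).measurable
  rw [integral_policy ψ s hm]
  have e : ∀ x, |⟪score σ ψ s (act ψ s + x), v⟫| ^ n =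
      (stepFamily hσ (evalAt s) (norm_evalAt_le_one hs)).rho x 0 *
        |(stepFamily hσ (evalAt s) (norm_evalAt_le_one hs)).score x 0 v| ^ n := fun x => by
    have e1 : (stepFamily hσ (evalAt s) (norm_evalAt_le_one hs)).rho x 0 = 1 := by
      simp [QuadFamily.rho]
    have e2 : (stepFamily hσ (evalAt s) (norm_evalAt_le_one hs)).score x 0 v =
        (σ ^ 2)⁻¹ * ⟪x, evalAt s v⟫ := by
      simp [QuadFamily.score, stepFamily, QuadFamily.ofSteps, stepB_apply]
    rw [e1, e2, score_eq hσ, evalAt_apply s ψ, add_sub_cancel_left, inner_scoreL, one_mul]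
  simp_rw [e]
  refine h.trans (le_of_eq ?_)
  norm_num

theorem continuous_rankOne_score (hσ : 0 < σ) (ψ : Param d) (s : E d) :
    Continuous fun a => InnerProductSpace.rankOne ℝ (score σ ψ s a) (score σ ψ s a) := by
  have h := continuous_score hσ ψ s
  exact ((InnerProductSpace.rankOne ℝ (E := Param d) (F := Param d)).continuous.comp h).clm_apply h

theorem integrable_rankOne_score (hσ : 0 < σ) (ψ : Param d) (s : E d) :
    Integrable (fun a => InnerProductSpace.rankOne ℝ (score σ ψ s a) (score σ ψ s a))
      (policy σ ψ s) := by
  refine ((memLp_score hσ ψ s 2).integrable_norm_pow two_ne_zero).mono'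
    (continuous_rankOne_score hσ ψ s).aestronglyMeasurable (.of_forall fun a => ?_)
  rw [InnerProductSpace.norm_rankOne, sq]

/-- Tested on two unit directions, the mean of the rank-one operators is a mixed moment, bounded by
the mean of the two second moments; `32 = 4 * 2! * 2 ^ 2`. -/
theorem norm_integral_rankOne_score_le (hσ : 0 < σ) {s : E d} (hs : s ∈ stateSpace d)
    (ψ : Param d) :
    ‖∫ a, InnerProductSpace.rankOne ℝ (score σ ψ s a) (score σ ψ s a) ∂(policy σ ψ s)‖ ≤
      32 / σ ^ 2 := by
  have hi := integrable_rankOne_score hσ ψ s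
  have hsq : ∀ v : Param d, ‖v‖ ≤ 1 →
      Integrable (fun a => |⟪score σ ψ s a, v⟫| ^ 2) (policy σ ψ s) ∧
      ∫ a, |⟪score σ ψ s a, v⟫| ^ 2 ∂(policy σ ψ s) ≤ 32 / σ ^ 2 := fun v hv => by
    refine ⟨((memLp_score hσ ψ s 2).integrable_norm_pow two_ne_zero).mono'
      ((((continuous_score hσ ψ s).inner continuous_const).abs).pow 2).aestronglyMeasurable
      (.of_forall fun a => ?_), (integral_abs_inner_score_pow_le hσ hs ψ hv 2).trans
        (le_of_eq ?_)⟩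
    · rw [norm_pow, Real.norm_eq_abs, abs_abs]
      gcongr
      exact (abs_real_inner_le_norm _ _).trans (mul_le_of_le_one_right (norm_nonneg _) hv)
    · rw [div_pow]; norm_num [Nat.factorial]; ring
  refine opNorm_le_of_le_one (by positivity) fun v hv => ?_
  set A := ∫ a, InnerProductSpace.rankOne ℝ (score σ ψ s a) (score σ ψ s a) ∂(policy σ ψ s)
  have key : ∀ w : Param d, ‖w‖ ≤ 1 → ⟪A v, w⟫ ≤ 32 / σ ^ 2 := fun w hw => by
    obtain ⟨i1, b1⟩ := hsq v hv
    obtain ⟨i2, b2⟩ := hsq w hw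
    have e : ⟪A v, w⟫ = ∫ a, ⟪score σ ψ s a, v⟫ * ⟪score σ ψ s a, w⟫ ∂(policy σ ψ s) := by
      rw [ContinuousLinearMap.integral_apply hi, real_inner_comm, ← integral_inner
        (hi.apply_continuousLinearMap v)]
      refine integral_congr_ae (.of_forall fun a => ?_)
      simp only [InnerProductSpace.rankOne_apply, real_inner_smul_right]
      rw [real_inner_comm w]
    have i3 : Integrable (fun a => 2⁻¹ * (|⟪score σ ψ s a, v⟫| ^ 2 + |⟪score σ ψ s a, w⟫| ^ 2))
      (policy σ ψ s) := (i1.add i2).const_mul _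
    have h : ⟪A v, w⟫ ≤
        ∫ a, 2⁻¹ * (|⟪score σ ψ s a, v⟫| ^ 2 + |⟪score σ ψ s a, w⟫| ^ 2) ∂(policy σ ψ s) := by
      rw [e]
      refine (le_abs_self _).trans ?_
      rw [← Real.norm_eq_abs]
      refine norm_integral_le_of_norm_le i3 (.of_forall fun a => ?_)
      rw [Real.norm_eq_abs, abs_mul]
      nlinarith [sq_nonneg (|⟪score σ ψ s a, v⟫| - |⟪score σ ψ s a, w⟫|)]
    rw [integral_const_mul, integral_add i1 i2] at h
    linarith
  -- The norm of `A v` is recovered by testing against its own direction.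
  rcases eq_or_ne (A v) 0 with h0 | h0
  · rw [h0, norm_zero]; positivity
  · have hn : 0 < ‖A v‖ := norm_pos_iff.2 h0
    have h := key (‖A v‖⁻¹ • A v) (by rw [norm_smul, norm_inv, norm_norm, inv_mul_cancel₀ hn.ne'])
    rwa [real_inner_smul_right, real_inner_self_eq_norm_sq, sq, ← mul_assoc,
      inv_mul_cancel₀ hn.ne', one_mul] at h

theorem integrable_prod_score (hσ : 0 < σ) (ψ : Param d) (s : E d)
    (i : Fin 4 → Fin d × Fin d) :
    Integrable (fun a => ∏ k, score σ ψ s a (i k)) (policy σ ψ s) := by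
  refine ((memLp_score hσ ψ s 4).integrable_norm_pow four_ne_zero).mono'
    (continuous_finsetProd _ fun k _ => (EuclideanSpace.proj (𝕜 := ℝ) (i k)).continuous.comp
      (continuous_score hσ ψ s)).aestronglyMeasurable (.of_forall fun a => ?_)
  rw [norm_prod]
  refine (Finset.prod_le_prod (fun k _ => norm_nonneg _) fun k _ =>
    PiLp.norm_apply_le _ _).trans (le_of_eq ?_)
  rw [Finset.prod_const, Finset.card_univ, Fintype.card_fin]

/-- Expanding the power over index tuples identifies the pairing of the moment tensor with the
fourth tensor power of `u` with a scalar fourth moment. -/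
theorem inner_pow_eq_sum {ι : Type*} [Fintype ι] (g u : EuclideanSpace ℝ ι) (n : ℕ) :
    ⟪g, u⟫ ^ n = ∑ i : Fin n → ι, (∏ k, g (i k)) * ∏ k, u (i k) := by
  rw [← Fin.prod_const, PiLp.inner_apply, Fintype.prod_sum]
  refine Finset.sum_congr rfl fun i _ => ?_
  rw [← Finset.prod_mul_distrib]
  refine Finset.prod_congr rfl fun k _ => ?_
  simp [mul_comm]

theorem injectiveNorm_integral_score_le (hσ : 0 < σ) {s : E d} (hs : s ∈ stateSpace d)
    (ψ : Param d) :
    injectiveNorm (fun i : Fin 4 → Fin d × Fin d =>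
      ∫ a, ∏ k, score σ ψ s a (i k) ∂(policy σ ψ s)) ≤ 1536 / σ ^ 4 := by
  -- Nonnegativity of the bound covers `d = 0`, where the sphere is empty and the supremum is zero.
  refine Real.iSup_le (fun u => ?_) (by positivity)
  have hu : ‖u.1‖ ≤ 1 := (mem_sphere_zero_iff_norm.1 u.2).le
  have h := integral_abs_inner_score_pow_le hσ hs ψ hu 4
  have e : ∑ i : Fin 4 → Fin d × Fin d, (∫ a, ∏ k, score σ ψ s a (i k) ∂(policy σ ψ s)) *
      ∏ k, u.1 (i k) = ∫ a, |⟪score σ ψ s a, u.1⟫| ^ 4 ∂(policy σ ψ s) := by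
    simp_rw [← integral_mul_const]
    rw [← integral_finsetSum _ fun i _ => (integrable_prod_score hσ ψ s i).mul_const _]
    refine integral_congr_ae (.of_forall fun a => ?_)
    simp only
    rw [Even.pow_abs (by decide), inner_pow_eq_sum]
  rw [e]
  refine h.trans (le_of_eq ?_)
  rw [div_pow]; norm_num [Nat.factorial]; ring

theorem policySmooth (hσ : 0 < σ) (Ψ : Set (Param d)) :
    PolicySmooth σ Ψ (stateSpace d) (32 / σ ^ 2) (1536 / σ ^ 4) (1 / σ ^ 4) where
  contDiff s _ a := contDiff_log_policyDensity hσ s a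
  second_integrable ψ _ s _ := integrable_rankOne_score hσ ψ s
  second_le ψ _ s hs := norm_integral_rankOne_score_le hσ hs ψ
  fourth_integrable ψ _ s _ i := integrable_prod_score hσ ψ s i
  fourth_le ψ _ s hs := injectiveNorm_integral_score_le hσ hs ψ
  hess_integrable ψ _ s _ := by
    simp_rw [scoreHessian_eq hσ]
    exact integrable_const _
  hess_le ψ _ s hs := by
    have h := norm_integral_le_of_norm_le_const (μ := policy σ ψ s)
      (f := fun a => scoreHessian σ ψ s a ∘L (scoreHessian σ ψ s a).adjoint)
      (C := 1 / σ ^ 4) (.of_forall fun a => by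
        refine (ContinuousLinearMap.opNorm_comp_le _ _).trans ?_
        rw [LinearIsometryEquiv.norm_map]
        have := norm_scoreHessian_le hσ hs ψ a
        calc ‖scoreHessian σ ψ s a‖ * ‖scoreHessian σ ψ s a‖ ≤ (σ ^ 2)⁻¹ * (σ ^ 2)⁻¹ := by gcongr
          _ = 1 / σ ^ 4 := by rw [← mul_inv, one_div]; ring)
    simpa using h

end

end ModelRL

namespace ModelRL

/-! ### Online learning of a finite class -/

/-- Optimise at `l = √a / √b`. As `a` or `b` may vanish, both are first increased by `e`, and then
`e` tends to zero. -/
theorem le_two_mul_sqrt_of_forall {X a b : ℝ} (ha : 0 ≤ a) (hb : 0 ≤ b)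
    (h : ∀ l : ℝ, 0 < l → X ≤ a / l + l * b) : X ≤ 2 * √(a * b) := by
  have key : ∀ e : ℝ, 0 < e → X ≤ 2 * √((a + e) * (b + e)) := fun e he => by
    have hae : 0 < a + e := by linarith
    have hbe : 0 < b + e := by linarith
    have hl : 0 < √(a + e) / √(b + e) := div_pos (Real.sqrt_pos.2 hae) (Real.sqrt_pos.2 hbe)
    refine (h _ hl).trans ?_
    have h1 : a / (√(a + e) / √(b + e)) ≤ (a + e) / (√(a + e) / √(b + e)) := by
      gcongr; linarith
    have h2 : √(a + e) / √(b + e) * b ≤ √(a + e) / √(b + e) * (b + e) := by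
      gcongr; linarith
    have e1 : (a + e) / (√(a + e) / √(b + e)) = √(a + e) * √(b + e) := by
      rw [div_div_eq_mul_div, mul_comm (a + e), mul_div_assoc, Real.div_sqrt, mul_comm]
    have e2 : √(a + e) / √(b + e) * (b + e) = √(a + e) * √(b + e) := by
      rw [div_mul_eq_mul_div, mul_div_assoc, Real.div_sqrt]
    rw [Real.sqrt_mul hae.le]
    linarith
  have hc : Filter.Tendsto (fun e : ℝ => 2 * √((a + e) * (b + e))) (nhdsWithin 0 (Set.Ioi 0))
      (nhds (2 * √((a + 0) * (b + 0)))) := by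
    have : Continuous fun e : ℝ => 2 * √((a + e) * (b + e)) := by fun_prop
    exact this.continuousAt.mono_left nhdsWithin_le_nhds
  rw [add_zero, add_zero] at hc
  exact ge_of_tendsto hc (Filter.eventually_of_mem self_mem_nhdsWithin fun e he => key e he)

/-! ### Exponential weights. -/

section Hedge

variable {Θ : Type*} [Fintype Θ] [Nonempty Θ]

/-- The exponential weights with learning rate `l` of the cumulative losses `L`. -/
noncomputable def expWeight (l : ℝ) (L : Θ → ℝ) (θ : Θ) : ℝ :=
  Real.exp (-l * L θ) / ∑ θ', Real.exp (-l * L θ')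

theorem sum_exp_pos (l : ℝ) (L : Θ → ℝ) : 0 < ∑ θ, Real.exp (-l * L θ) :=
  Finset.sum_pos (fun _ _ => Real.exp_pos _) Finset.univ_nonempty

theorem expWeight_mem (l : ℝ) (L : Θ → ℝ) : expWeight l L ∈ stdSimplex ℝ Θ := by
  refine ⟨fun θ => div_nonneg (Real.exp_pos _).le (sum_exp_pos l L).le, ?_⟩
  unfold expWeight
  rw [← Finset.sum_div, div_self (sum_exp_pos l L).ne']

theorem continuous_expWeight (l : ℝ) : Continuous (expWeight (Θ := Θ) l) := by
  refine continuous_pi fun θ => Continuous.div (by fun_prop) (by fun_prop) fun L =>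
    (sum_exp_pos l L).ne'

/-- Invert the quadratic lower bound for `exp x`, using `(1 + x ^ 2 / 2) ^ 2 - x ^ 2 ≥ 1`. -/
theorem exp_neg_le {x : ℝ} (hx : 0 ≤ x) : Real.exp (-x) ≤ 1 - x + x ^ 2 / 2 := by
  have h1 := Real.quadratic_le_exp_of_nonneg hx
  have h2 : 0 < 1 + x + x ^ 2 / 2 := by positivity
  rw [Real.exp_neg]
  calc (Real.exp x)⁻¹ ≤ (1 + x + x ^ 2 / 2)⁻¹ := inv_anti₀ h2 h1
    _ ≤ 1 - x + x ^ 2 / 2 := by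
      rw [inv_le_iff_one_le_mul₀ h2]
      nlinarith [sq_nonneg (x ^ 2)]

/-- One round of the potential argument: relative to the current weights the potential shrinks by
the mean of `exp (-l y)`, which is at most the exponential of minus `l` times the mean loss plus a
second-order term. -/
theorem sum_exp_mul_exp_le {l c : ℝ} (hl : 0 ≤ l) (L y : Θ → ℝ)
    (hy : ∀ θ, y θ ∈ Set.Icc 0 c) :
    ∑ θ, Real.exp (-l * (L θ + y θ)) ≤ (∑ θ, Real.exp (-l * L θ)) *
      Real.exp (-l * ∑ θ, expWeight l L θ * y θ + l ^ 2 * c ^ 2 / 2) := by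
  have hW := sum_exp_pos l L
  set W := ∑ θ, Real.exp (-l * L θ)
  have hp : ∀ θ, Real.exp (-l * L θ) = W * expWeight l L θ := fun θ => by
    rw [expWeight, mul_div_cancel₀ _ hW.ne']
  obtain ⟨hp0, hp1⟩ := expWeight_mem l L
  calc ∑ θ, Real.exp (-l * (L θ + y θ))
      = W * ∑ θ, expWeight l L θ * Real.exp (-(l * y θ)) := by
        rw [Finset.mul_sum]
        refine Finset.sum_congr rfl fun θ _ => ?_
        rw [← mul_assoc, ← hp, ← Real.exp_add]
        congr 1; ring
    _ ≤ W * ∑ θ, expWeight l L θ * (1 - l * y θ + l ^ 2 * c ^ 2 / 2) := by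
        refine mul_le_mul_of_nonneg_left (Finset.sum_le_sum fun θ _ =>
          mul_le_mul_of_nonneg_left ?_ (hp0 θ)) hW.le
        have h1 := (hy θ).1
        have h2 := (hy θ).2
        refine (exp_neg_le (mul_nonneg hl h1)).trans ?_
        rw [mul_pow]
        gcongr
    _ = W * ((-l * ∑ θ, expWeight l L θ * y θ + l ^ 2 * c ^ 2 / 2) + 1) := by
        have e : ∀ θ, expWeight l L θ * (1 - l * y θ + l ^ 2 * c ^ 2 / 2) =
            expWeight l L θ * (1 + l ^ 2 * c ^ 2 / 2) - l * (expWeight l L θ * y θ) :=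
          fun θ => by ring
        simp_rw [e]
        rw [Finset.sum_sub_distrib, ← Finset.sum_mul, ← Finset.mul_sum, hp1]
        ring
    _ ≤ _ := mul_le_mul_of_nonneg_left (Real.add_one_le_exp _) hW.le

theorem sum_exp_sum_le {l c : ℝ} (hl : 0 ≤ l) (y : ℕ → Θ → ℝ) (T : ℕ)
    (hy : ∀ t < T, ∀ θ, y t θ ∈ Set.Icc 0 c) :
    ∑ θ, Real.exp (-l * ∑ t ∈ Finset.range T, y t θ) ≤ Fintype.card Θ *
      Real.exp (-l * ∑ t ∈ Finset.range T, ∑ θ,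
        expWeight l (fun θ => ∑ i ∈ Finset.range t, y i θ) θ * y t θ +
          T * (l ^ 2 * c ^ 2 / 2)) := by
  induction T with
  | zero => simp
  | succ T ih =>
    simp_rw [Finset.sum_range_succ]
    refine (sum_exp_mul_exp_le hl (fun θ => ∑ i ∈ Finset.range T, y i θ) (y T)
      (hy T (Nat.lt_succ_self T))).trans ?_
    refine (mul_le_mul_of_nonneg_right (ih fun t ht => hy t (ht.trans (Nat.lt_succ_self T)))
      (Real.exp_pos _).le).trans (le_of_eq ?_)
    rw [mul_assoc, ← Real.exp_add]
    congr 2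
    push_cast
    ring

/-- The potential is at least the term of any single model; taking logarithms compares its loss with
that of the learner. -/
theorem expWeight_regret_le {l c : ℝ} (hl : 0 < l) (y : ℕ → Θ → ℝ) (T : ℕ)
    (hy : ∀ t < T, ∀ θ, y t θ ∈ Set.Icc 0 c) (θ : Θ) :
    ∑ t ∈ Finset.range T, ∑ θ, expWeight l (fun θ => ∑ i ∈ Finset.range t, y i θ) θ * y t θ -
      ∑ t ∈ Finset.range T, y t θ ≤ Real.log (Fintype.card Θ) / l + l * (T * c ^ 2 / 2) := by
  have hN : (0 : ℝ) < Fintype.card Θ := by exact_mod_cast Fintype.card_pos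
  have h := (Finset.single_le_sum (f := fun θ => Real.exp (-l * ∑ t ∈ Finset.range T, y t θ))
    (fun θ _ => (Real.exp_pos _).le) (Finset.mem_univ θ)).trans (sum_exp_sum_le hl.le y T hy)
  have h2 := Real.log_le_log (Real.exp_pos _) h
  rw [Real.log_exp, Real.log_mul hN.ne' (Real.exp_pos _).ne', Real.log_exp] at h2
  set S := ∑ t ∈ Finset.range T, ∑ θ,
    expWeight l (fun θ => ∑ i ∈ Finset.range t, y i θ) θ * y t θ
  refine le_of_mul_le_mul_left ?_ hl
  rw [mul_add, mul_div_cancel₀ _ hl.ne']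
  linarith

variable {Z : Type*} [MeasurableSpace Z]

/-- The exponential weights learner. -/
noncomputable def hedge (ℓ : Θ → Z → ℝ) (hℓ : ∀ θ, Measurable (ℓ θ)) (l : ℝ) : Learner Z Θ where
  dist _ h := expWeight l fun θ => ∑ i, ℓ θ (h i)
  dist_mem _ _ := expWeight_mem _ _
  dist_meas _ := (continuous_expWeight l).measurable.comp (measurable_pi_lambda _ fun θ =>
    Finset.measurable_sum _ fun i _ => (hℓ θ).comp (measurable_pi_apply i))

theorem hedge_regret_le {ℓ : Θ → Z → ℝ} (hℓ : ∀ θ, Measurable (ℓ θ)) {l c : ℝ} (hl : 0 < l)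
    {T : ℕ} {z : Fin T → Z} (hz : ∀ t θ, ℓ θ (z t) ∈ Set.Icc 0 c) :
    (hedge ℓ hℓ l).regret ℓ z ≤ Real.log (Fintype.card Θ) / l + l * (T * c ^ 2 / 2) := by
  let y : ℕ → Θ → ℝ := fun t θ => if h : t < T then ℓ θ (z ⟨t, h⟩) else 0
  have hy : ∀ t : Fin T, ∀ θ, ℓ θ (z t) = y t θ := fun t θ => by simp [y, t.2]
  have hr : (hedge ℓ hℓ l).regret ℓ z =
      ∑ t ∈ Finset.range T, ∑ θ, expWeight l (fun θ => ∑ i ∈ Finset.range t, y i θ) θ * y t θ -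
        ⨅ θ, ∑ t ∈ Finset.range T, y t θ := by
    have e : ∀ θ, ∑ t, ℓ θ (z t) = ∑ t ∈ Finset.range T, y t θ := fun θ => by
      rw [← Fin.sum_univ_eq_sum_range (fun t => y t θ)]
      exact Finset.sum_congr rfl fun t _ => hy t θ
    simp_rw [Learner.regret, e]
    congr 1
    rw [← Fin.sum_univ_eq_sum_range (fun t => ∑ θ,
      expWeight l (fun θ => ∑ i ∈ Finset.range t, y i θ) θ * y t θ)]
    refine Finset.sum_congr rfl fun t _ => Finset.sum_congr rfl fun θ _ => ?_
    have e2 : (fun θ => ∑ i : Fin t, ℓ θ (z (Fin.castLE t.2.le i))) =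
        fun θ => ∑ i ∈ Finset.range t, y i θ := by
      funext θ
      rw [← Fin.sum_univ_eq_sum_range (fun i => y i θ)]
      exact Finset.sum_congr rfl fun i _ => hy _ θ
    change expWeight l (fun θ => ∑ i : Fin t, ℓ θ (z (Fin.castLE t.2.le i))) θ * _ = _
    rw [e2, hy]
  obtain ⟨θ, hθ⟩ := exists_eq_ciInf_of_finite (f := fun θ => ∑ t ∈ Finset.range T, y t θ)
  rw [hr, ← hθ]
  exact expWeight_regret_le hl y T (fun t ht θ => by simpa [y, ht] using hz ⟨t, ht⟩ θ) θ

/-- A single model must be treated apart: its logarithmic cardinality is zero, which would make the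
optimal learning rate vanish. -/
theorem regret_eq_zero_of_subsingleton [Subsingleton Θ] (R : Learner Z Θ) (ℓ : Θ → Z → ℝ) {T : ℕ}
    (z : Fin T → Z) : R.regret ℓ z = 0 := by
  obtain ⟨θ⟩ := ‹Nonempty Θ›
  have : Unique Θ := ⟨⟨θ⟩, fun _ => Subsingleton.elim _ _⟩
  have h : ∀ t h, R.dist t h default = 1 := fun t h => by
    simpa [Fintype.sum_unique] using (R.dist_mem t h).2
  simp [Learner.regret, h]

theorem exists_hedge_regret_le {ℓ : Θ → Z → ℝ} (hℓ : ∀ θ, Measurable (ℓ θ)) (A : Set Z) {c : ℝ}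
    (hc : 0 < c) (hA : ∀ z ∈ A, ∀ θ, ℓ θ z ∈ Set.Icc 0 c) (T : ℕ) :
    ∃ R : Learner Z Θ, ∀ z : Fin T → Z, (∀ t, z t ∈ A) →
      R.regret ℓ z ≤ 2 * c * √(T * Real.log (Fintype.card Θ)) := by
  set a := Real.log (Fintype.card Θ) with ha_def
  have ha : 0 ≤ a := Real.log_natCast_nonneg _
  rcases subsingleton_or_nontrivial Θ with hΘ | hΘ
  · exact ⟨hedge ℓ hℓ 1, fun z _ => by
      rw [regret_eq_zero_of_subsingleton]; positivity⟩
  have ha' : 0 < a := Real.log_pos (by exact_mod_cast Fintype.one_lt_card)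
  rcases Nat.eq_zero_or_pos T with rfl | hT
  · exact ⟨hedge ℓ hℓ 1, fun z _ => by simp [Learner.regret]⟩
  have hT' : (0 : ℝ) < T := by exact_mod_cast hT
  -- This learning rate gives the regret `(3 / 2) c √(T a)`, rounded up to `2 c √(T a)`.
  have hl : 0 < √a / √T / c :=
    div_pos (div_pos (Real.sqrt_pos.2 ha') (Real.sqrt_pos.2 hT')) hc
  refine ⟨hedge ℓ hℓ (√a / √T / c), fun z hz =>
    (hedge_regret_le hℓ hl fun t θ => hA (z t) (hz t) θ).trans ?_⟩
  rw [← ha_def, Real.sqrt_mul hT'.le]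
  have h1 := Real.sq_sqrt ha'.le
  have h2 := Real.sq_sqrt hT'.le
  have h3 : 0 < √a := Real.sqrt_pos.2 ha'
  have h4 : 0 < √(T : ℝ) := Real.sqrt_pos.2 hT'
  calc a / (√a / √T / c) + √a / √T / c * (T * c ^ 2 / 2)
      = √a ^ 2 / (√a / √T / c) + √a / √T / c * (√T ^ 2 * c ^ 2 / 2) := by rw [h1, h2]
    _ = 3 / 2 * (c * (√T * √a)) := by field_simp; ring
    _ ≤ 2 * c * (√T * √a) := by nlinarith [mul_pos hc (mul_pos h4 h3)]

end Hedge

/-! ### Sequential Rademacher complexity of a finite class. -/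

section Rademacher

variable {Θ Z : Type*}

/-- The last tree value depends on the earlier signs only, so summing over the last sign yields `2
cosh (l w)`, at most `2 exp (l ^ 2 c ^ 2 / 2)`; the rounds are peeled off from the end. -/
theorem sum_exp_rademacher_le {c : ℝ} (l : ℝ) (T : ℕ) (x : (t : Fin T) → (Fin t → Bool) → ℝ)
    (hx : ∀ t e, |x t e| ≤ c) :
    ∑ e : Fin T → Bool, Real.exp (l * ∑ t, (if e t then 1 else -1) *
      x t fun i => e (Fin.castLE t.2.le i)) ≤ 2 ^ T * Real.exp (T * (l ^ 2 * c ^ 2 / 2)) := by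
  induction T with
  | zero => simp
  | succ T ih =>
    have ih' := ih (fun t e => x t.castSucc e) fun t e => hx _ _
    rw [← (Fin.snocEquiv fun _ : Fin (T + 1) => Bool).sum_comp, Fintype.sum_prod_type_right]
    have hstep : ∀ e : Fin T → Bool,
        ∑ b : Bool, Real.exp (l * ∑ t : Fin (T + 1),
          (if (Fin.snocEquiv fun _ : Fin (T + 1) => Bool) (b, e) t then 1 else -1) *
            x t fun i => (Fin.snocEquiv fun _ : Fin (T + 1) => Bool) (b, e)
              (Fin.castLE t.2.le i)) ≤
        Real.exp (l * ∑ t : Fin T, (if e t then 1 else -1) *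
          x t.castSucc fun i => e (Fin.castLE t.2.le i)) *
            (2 * Real.exp (l ^ 2 * c ^ 2 / 2)) := fun e => by
      set S := ∑ t : Fin T, (if e t then 1 else -1) *
          x t.castSucc fun i => e (Fin.castLE t.2.le i) with hS
      set w := x (Fin.last T) e with hw
      have hb : ∀ b : Bool, ∑ t : Fin (T + 1),
          (if (Fin.snocEquiv fun _ : Fin (T + 1) => Bool) (b, e) t then (1 : ℝ) else -1) *
            (x t fun i => (Fin.snocEquiv fun _ : Fin (T + 1) => Bool) (b, e)
              (Fin.castLE t.2.le i)) = S + (if b then 1 else -1) * w := fun b => by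
        rw [Fin.sum_univ_castSucc]
        congr 1
        · refine Finset.sum_congr rfl fun t _ => ?_
          have e1 : (Fin.snocEquiv fun _ : Fin (T + 1) => Bool) (b, e) t.castSucc = e t :=
            Fin.snoc_castSucc (α := fun _ => Bool) b e t
          have e2 : (fun i : Fin t.castSucc => (Fin.snocEquiv fun _ : Fin (T + 1) => Bool) (b, e)
              (Fin.castLE t.castSucc.2.le i)) = fun i : Fin t => e (Fin.castLE t.2.le i) :=
            funext fun i => Fin.snoc_castSucc (α := fun _ => Bool) b e (Fin.castLE t.2.le i)
          rw [e1]
          exact congrArg (_ * x t.castSucc ·) e2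
        · have e1 : (Fin.snocEquiv fun _ : Fin (T + 1) => Bool) (b, e) (Fin.last T) = b :=
            Fin.snoc_last (α := fun _ => Bool) b e
          have e2 : (fun i : Fin (Fin.last T) => (Fin.snocEquiv fun _ : Fin (T + 1) => Bool) (b, e)
              (Fin.castLE (Fin.last T).2.le i)) = e :=
            funext fun i => Fin.snoc_castSucc (α := fun _ => Bool) b e i
          rw [e1]
          exact congrArg (_ * x (Fin.last T) ·) e2
      simp_rw [hb]
      rw [Fintype.sum_bool]
      have hcosh := Real.cosh_le_exp_half_sq (l * w)
      rw [Real.cosh_eq] at hcosh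
      have hle : Real.exp ((l * w) ^ 2 / 2) ≤ Real.exp (l ^ 2 * c ^ 2 / 2) := by
        refine Real.exp_le_exp.2 ?_
        rw [mul_pow]
        have : w ^ 2 ≤ c ^ 2 := sq_le_sq' (abs_le.1 (hx _ _)).1 (abs_le.1 (hx _ _)).2
        gcongr
      calc _ = Real.exp (l * S) * (Real.exp (l * w) + Real.exp (-(l * w))) := by
            rw [mul_add (Real.exp _), ← Real.exp_add, ← Real.exp_add]
            congr 2 <;> simp <;> ring
        _ ≤ _ := mul_le_mul_of_nonneg_left (by linarith) (Real.exp_pos _).le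
    refine (Finset.sum_le_sum fun e _ => hstep e).trans ?_
    rw [← Finset.sum_mul]
    refine (mul_le_mul_of_nonneg_right ih' (by positivity)).trans (le_of_eq ?_)
    rw [pow_succ, mul_mul_mul_comm, ← Real.exp_add]
    congr 2
    push_cast
    ring

variable [Fintype Θ] [Nonempty Θ]

theorem seqRademacher_le {ℓ : Θ → Z → ℝ} {A : Set Z} {c : ℝ}
    (hA : ∀ z ∈ A, ∀ θ, |ℓ θ z| ≤ c) (T : ℕ) :
    seqRademacher ℓ A T ≤ 2 * √(Real.log (Fintype.card Θ) * (T * c ^ 2 / 2)) := by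
  refine Real.iSup_le (fun z => le_two_mul_sqrt_of_forall (Real.log_natCast_nonneg _)
    (by positivity) fun l hl => ?_) (by positivity)
  have hN : (0 : ℝ) < Fintype.card Θ := by exact_mod_cast Fintype.card_pos
  set X : Θ → (Fin T → Bool) → ℝ := fun θ e => ∑ t, (if e t then 1 else -1) *
    ℓ θ (z t fun i => e (Fin.castLE t.2.le i)) with hX
  set g : ℝ := Real.log (Fintype.card Θ) + T * (l ^ 2 * c ^ 2 / 2) with hg
  -- The inequality `x + 1 ≤ exp x` replaces Jensen's inequality for the logarithm; `g` is chosen so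
  -- that the mean of the sum of exponentials is at most one.
  have hpt : ∀ e, l * ⨆ θ, X θ e ≤ ∑ θ, Real.exp (l * X θ e - g) - 1 + g := fun e => by
    obtain ⟨θ, hθ⟩ := exists_eq_ciSup_of_finite (f := fun θ => X θ e)
    rw [← hθ]
    have h1 := Finset.single_le_sum (f := fun θ => Real.exp (l * X θ e - g))
      (fun θ _ => (Real.exp_pos _).le) (Finset.mem_univ θ)
    have h2 := Real.add_one_le_exp (l * X θ e - g)
    linarith
  have hsum : ∑ e, ∑ θ, Real.exp (l * X θ e - g) ≤ 2 ^ T := by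
    rw [Finset.sum_comm]
    have h1 : ∀ θ, ∑ e, Real.exp (l * X θ e - g) ≤ 2 ^ T / Fintype.card Θ := fun θ => by
      have h2 := sum_exp_rademacher_le (c := c) l T (fun t e => ℓ θ (z t e))
        fun t e => hA _ (z t e).2 θ
      simp_rw [Real.exp_sub]
      rw [← Finset.sum_div, hg, Real.exp_add, Real.exp_log hN, div_le_div_iff₀ (by positivity) hN]
      calc _ ≤ 2 ^ T * Real.exp (T * (l ^ 2 * c ^ 2 / 2)) * Fintype.card Θ := by gcongr
        _ = _ := by ring
    refine (Finset.sum_le_sum fun θ _ => h1 θ).trans (le_of_eq ?_)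
    rw [Finset.sum_const, Finset.card_univ, nsmul_eq_mul, mul_div_cancel₀ _ hN.ne']
  have h := Finset.sum_le_sum fun e (_ : e ∈ Finset.univ) => hpt e
  rw [← Finset.mul_sum, Finset.sum_add_distrib, Finset.sum_sub_distrib, Finset.sum_const,
    Finset.sum_const, Finset.card_univ, Fintype.card_fun, Fintype.card_bool, Fintype.card_fin,
    nsmul_eq_mul, nsmul_eq_mul] at h
  push_cast at h
  have h2 : l * ∑ e, ⨆ θ, X θ e ≤ 2 ^ T * g := by linarith
  have h3 : ((2 : ℝ) ^ T)⁻¹ * ∑ e, ⨆ θ, X θ e ≤ g / l := by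
    rw [inv_mul_le_iff₀ (by positivity), ← mul_div_assoc, le_div_iff₀ hl]
    linarith
  refine h3.trans (le_of_eq ?_)
  rw [hg]
  field_simp

theorem two_mul_seqRademacher_le {ℓ : Θ → Z → ℝ} {A : Set Z} {c : ℝ} (hc : 0 ≤ c)
    (hA : ∀ z ∈ A, ∀ θ, |ℓ θ z| ≤ c) (T : ℕ) :
    2 * seqRademacher ℓ A T ≤ 4 * c * √(T * Real.log (Fintype.card Θ)) := by
  have h := seqRademacher_le hA T
  have h2 : √(Real.log (Fintype.card Θ) * (T * c ^ 2 / 2)) ≤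
      c * √(T * Real.log (Fintype.card Θ)) := by
    have h0 : 0 ≤ Real.log (Fintype.card Θ) := Real.log_natCast_nonneg _
    refine Real.sqrt_le_iff.2 ⟨by positivity, ?_⟩
    rw [mul_pow, Real.sq_sqrt (by positivity)]
    nlinarith [mul_nonneg h0 (mul_nonneg (Nat.cast_nonneg (α := ℝ) T) (sq_nonneg c))]
  linarith

end Rademacher

end ModelRL

namespace ModelRL

/-! ### Ascent from points that are not approximate local maxima -/

/-- The lower bound for the second derivative is integrated twice, in the form of two monotonicity
statements. -/
theorem taylor_two_le {g g' g'' : ℝ → ℝ} {m t : ℝ} (ht : 0 ≤ t)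
    (h1 : ∀ s, HasDerivAt g (g' s) s) (h2 : ∀ s, HasDerivAt g' (g'' s) s)
    (hm : ∀ s ∈ Set.Icc 0 t, m ≤ g'' s) : g 0 + g' 0 * t + m * t ^ 2 / 2 ≤ g t := by
  have mono : ∀ {k k' : ℝ → ℝ}, (∀ s, HasDerivAt k (k' s) s) → (∀ s ∈ Set.Icc 0 t, 0 ≤ k' s) →
      MonotoneOn k (Set.Icc 0 t) := fun hk hk' =>
    monotoneOn_of_deriv_nonneg (convex_Icc 0 t)
      (fun s _ => (hk s).continuousAt.continuousWithinAt)
      (fun s _ => (hk s).differentiableAt.differentiableWithinAt)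
      fun s hs => by rw [(hk s).deriv]; exact hk' s (interior_subset hs)
  have h0 : (0 : ℝ) ∈ Set.Icc 0 t := ⟨le_rfl, ht⟩
  have k1 : ∀ s, HasDerivAt (fun s => g' s - m * s) (g'' s - m) s := fun s => by
    exact ((h2 s).sub ((hasDerivAt_id s).const_mul m)).congr_deriv (by simp)
  have hg' : ∀ s ∈ Set.Icc 0 t, g' 0 + m * s ≤ g' s := fun s hs => by
    have := mono k1 (fun s hs => sub_nonneg.2 (hm s hs)) h0 hs hs.1
    simp only [mul_zero, sub_zero] at this
    linarith
  have k2 : ∀ s, HasDerivAt (fun s => g s - (g' 0 * s + m * s ^ 2 / 2)) (g' s - (g' 0 + m * s)) s :=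
    fun s => by
      have := (h1 s).sub (((hasDerivAt_id s).const_mul (g' 0)).add
        ((((hasDerivAt_id s).pow 2).const_mul m).div_const 2))
      refine this.congr_deriv ?_
      simp
      ring
  have := mono k2 (fun s hs => sub_nonneg.2 (hg' s hs)) h0 ⟨ht, le_rfl⟩ ht
  norm_num at this
  linarith

section

variable {d : ℕ} {f : Param d → ℝ} {B1 B2 B3 : ℝ}

theorem SmoothBound.le_apply_add_smul (h : SmoothBound f B1 B2 B3) (ψ v : Param d) {m t : ℝ}
    (ht : 0 ≤ t) (hm : ∀ s ∈ Set.Icc 0 t, m ≤ fderiv ℝ (fderiv ℝ f) (ψ + s • v) v v) :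
    f ψ + fderiv ℝ f ψ v * t + m * t ^ 2 / 2 ≤ f (ψ + t • v) := by
  have hline : ∀ s : ℝ, HasDerivAt (fun s : ℝ => ψ + s • v) v s := fun s => by
    simpa using ((hasDerivAt_id s).smul_const v).const_add ψ
  have h1 : ∀ s : ℝ, HasDerivAt (fun s : ℝ => f (ψ + s • v)) (fderiv ℝ f (ψ + s • v) v) s :=
    fun s => (h.hasFDerivAt _).comp_hasDerivAt s (hline s)
  have h2 : ∀ s : ℝ, HasDerivAt (fun s : ℝ => fderiv ℝ f (ψ + s • v) v)
      (fderiv ℝ (fderiv ℝ f) (ψ + s • v) v v) s := fun s => by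
    have := ((h.hasFDerivAt_fderiv _).comp_hasDerivAt s (hline s)).clm_apply (hasDerivAt_const s v)
    simpa using this
  simpa using taylor_two_le ht h1 h2 hm

/-- If the gradient exceeds `ε`, a step `ε / Z` along it gains at least `ε ^ 2 / (2 Z)`. Otherwise
some direction has curvature above `√ε`; oriented so that the slope is nonnegative, a step `√ε / (2
Z)` keeps the curvature above `√ε / 2` and gains `√ε * ε / (16 Z ^ 2)`. Both gains suffice since `ε
≤ 1 ≤ Z`. -/
theorem SmoothBound.exists_ascent (h : SmoothBound f B1 B2 B3) {Z ε : ℝ} (hZ : 1 ≤ Z) (h2 : B2 ≤ Z)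
    (h3 : B3 ≤ Z) (hε : 0 < ε) (hε1 : ε ≤ 1) {ψ : Param d}
    (hψ : ψ ∉ approxLocalMax f ε (√ε)) :
    ∃ φ, ‖φ - ψ‖ ≤ 1 / Z ∧ f ψ + ε ^ 2 / (16 * Z ^ 2) ≤ f φ := by
  have hZ0 : 0 < Z := by linarith
  have hnorm : ∀ (t : ℝ) (v : Param d), 0 ≤ t → ‖v‖ = 1 → t ≤ 1 / Z →
      ‖ψ + t • v - ψ‖ ≤ 1 / Z := fun t v ht hv hle => by
    rwa [add_sub_cancel_left, norm_smul, hv, mul_one, Real.norm_of_nonneg ht]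
  by_cases hg : ‖gradient f ψ‖ ≤ ε
  · have : ∃ v, √ε * ‖v‖ ^ 2 < ⟪hessian f ψ v, v⟫ := by
      by_contra! hcon
      exact hψ ⟨hg, hcon⟩
    obtain ⟨v, hv⟩ := this
    rw [inner_hessian h.contDiff] at hv
    have hv0 : 0 < ‖v‖ := by
      refine norm_pos_iff.2 fun hv0 => ?_
      rw [hv0] at hv
      simp at hv
    obtain ⟨w, hw, hw1, hw2⟩ : ∃ w : Param d, ‖w‖ = 1 ∧ 0 ≤ fderiv ℝ f ψ w ∧
        √ε ≤ fderiv ℝ (fderiv ℝ f) ψ w w := by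
      have key : ∀ c : ℝ, |c| = ‖v‖⁻¹ → √ε ≤ fderiv ℝ (fderiv ℝ f) ψ (c • v) (c • v) :=
          fun c hc => by
        have e : c * c = (‖v‖ ^ 2)⁻¹ := by rw [← abs_mul_abs_self, hc]; ring
        rw [map_smul, map_smul, smul_apply, smul_eq_mul, smul_eq_mul, ← mul_assoc, e,
          le_inv_mul_iff₀ (by positivity), mul_comm]
        exact hv.le
      have hn : ∀ c : ℝ, |c| = ‖v‖⁻¹ → ‖c • v‖ = 1 := fun c hc => by
        rw [norm_smul, Real.norm_eq_abs, hc, inv_mul_cancel₀ hv0.ne']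
      have hpos : |‖v‖⁻¹| = ‖v‖⁻¹ := abs_of_pos (inv_pos.2 hv0)
      rcases le_total 0 (fderiv ℝ f ψ v) with hs | hs
      · refine ⟨‖v‖⁻¹ • v, hn _ hpos, ?_, key _ hpos⟩
        rw [map_smul, smul_eq_mul]
        positivity
      · have hneg : |-‖v‖⁻¹| = ‖v‖⁻¹ := by rw [abs_neg, hpos]
        refine ⟨(-‖v‖⁻¹) • v, hn _ hneg, ?_, key _ hneg⟩
        rw [map_smul, smul_eq_mul]
        exact mul_nonneg_of_nonpos_of_nonpos (neg_nonpos.2 (inv_pos.2 hv0).le) hs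
    have hsε : 0 < √ε := Real.sqrt_pos.2 hε
    have hsε1 : √ε ≤ 1 := Real.sqrt_le_one.2 hε1
    have ht : 0 ≤ √ε / (2 * Z) := by positivity
    refine ⟨ψ + (√ε / (2 * Z)) • w, hnorm _ w ht hw ?_, ?_⟩
    · rw [div_le_div_iff₀ (by positivity) hZ0]
      nlinarith
    · have hc := h.le_apply_add_smul ψ w (m := √ε / 2) ht fun s hs => by
        have h4 := h.d3 (ψ + s • w) ψ
        rw [add_sub_cancel_left, norm_smul, hw, mul_one, Real.norm_of_nonneg hs.1] at h4
        have h5 : |(fderiv ℝ (fderiv ℝ f) (ψ + s • w) - fderiv ℝ (fderiv ℝ f) ψ) w w| ≤ B3 * s := by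
          rw [← Real.norm_eq_abs]
          refine (ContinuousLinearMap.le_opNorm₂ _ _ _).trans ?_
          rw [hw, mul_one, mul_one]
          exact h4
        have h6 : B3 * s ≤ √ε / 2 := by
          calc B3 * s ≤ Z * (√ε / (2 * Z)) := mul_le_mul h3 hs.2 hs.1 hZ0.le
            _ = √ε / 2 := by field_simp
        have h7 := (abs_le.1 h5).1
        rw [sub_apply, sub_apply] at h7
        linarith
      have h8 : 0 ≤ fderiv ℝ f ψ w * (√ε / (2 * Z)) := mul_nonneg hw1 ht
      have h9 : ε ^ 2 / (16 * Z ^ 2) ≤ √ε / 2 * (√ε / (2 * Z)) ^ 2 / 2 := by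
        have e : √ε / 2 * (√ε / (2 * Z)) ^ 2 / 2 = √ε * ε / (16 * Z ^ 2) := by
          rw [div_pow, Real.sq_sqrt hε.le]; field_simp; ring
        rw [e]
        gcongr
        have : ε ≤ √ε := Real.le_sqrt_of_sq_le (by nlinarith)
        nlinarith
      linarith
  · push Not at hg
    have hg0 : 0 < ‖gradient f ψ‖ := hε.trans hg
    set v := ‖gradient f ψ‖⁻¹ • gradient f ψ with hv
    have hv1 : ‖v‖ = 1 := by rw [hv, norm_smul, norm_inv, norm_norm, inv_mul_cancel₀ hg0.ne']
    have hdv : fderiv ℝ f ψ v = ‖gradient f ψ‖ := by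
      rw [← inner_gradient, hv, real_inner_smul_right, real_inner_self_eq_norm_sq, sq, ← mul_assoc,
        inv_mul_cancel₀ hg0.ne', one_mul]
    have ht : 0 ≤ ε / Z := by positivity
    refine ⟨ψ + (ε / Z) • v, hnorm _ v ht hv1 (by gcongr), ?_⟩
    have hc := h.le_apply_add_smul ψ v (m := -Z) ht fun s _ => by
      have h5 : |fderiv ℝ (fderiv ℝ f) (ψ + s • v) v v| ≤ Z := by
        rw [← Real.norm_eq_abs]
        refine (ContinuousLinearMap.le_opNorm₂ _ _ _).trans ?_
        rw [hv1, mul_one, mul_one]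
        exact (h.d2 _).trans h2
      exact (abs_le.1 h5).1
    rw [hdv] at hc
    have h6 : ε * (ε / Z) ≤ ‖gradient f ψ‖ * (ε / Z) := by gcongr
    have h7 : ε ^ 2 / (16 * Z ^ 2) ≤ ε * (ε / Z) + -Z * (ε / Z) ^ 2 / 2 := by
      have e : ε * (ε / Z) + -Z * (ε / Z) ^ 2 / 2 = ε ^ 2 / (2 * Z) := by field_simp; ring
      rw [e]
      gcongr
      · norm_num
      · nlinarith
    linarith

end

/-- With `r = δ / G`, the recursion reads `r g (t + 1) ≤ (1 - r) (g t - g (t + 1)) + err t`, and the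
sum telescopes. -/
theorem sum_gap_le {g err : ℕ → ℝ} {G δ : ℝ} (hδ : 0 < δ) (hδG : δ ≤ G) (T : ℕ) (h0 : g 0 ≤ G)
    (hT : 0 ≤ g T) (hrec : ∀ t < T, g (t + 1) ≤ (1 - δ / G) * g t + err t) :
    ∑ t ∈ Finset.range T, g (t + 1) ≤ G / δ * (G + ∑ t ∈ Finset.range T, err t) := by
  have hG : 0 < G := hδ.trans_le hδG
  have key : δ / G * ∑ t ∈ Finset.range T, g (t + 1) ≤
      (1 - δ / G) * (g 0 - g T) + ∑ t ∈ Finset.range T, err t := by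
    clear hT
    induction T with
    | zero => simp
    | succ T ih =>
      have h1 := ih fun t ht => hrec t (ht.trans (Nat.lt_succ_self T))
      have h2 := hrec T (Nat.lt_succ_self T)
      rw [Finset.sum_range_succ, Finset.sum_range_succ]
      linarith
  have hr0 : 0 < δ / G := div_pos hδ hG
  have hr1 : δ / G ≤ 1 := (div_le_one hG).2 hδG
  have h2 : (1 - δ / G) * (g 0 - g T) ≤ G := by
    have : (1 - δ / G) * (g 0 - g T) ≤ (1 - δ / G) * G :=
      mul_le_mul_of_nonneg_left (by linarith) (by linarith)
    have : 0 ≤ δ / G * G := by positivity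
    linarith
  rw [← inv_div δ G, le_inv_mul_iff₀ hr0]
  linarith

namespace Instance

attribute [local irreducible] act gaussianNoise cmExp

variable {d : ℕ} {Θ : Type*} (M : Instance d Θ)

/-! ### The local regret of a sequence of ascent steps -/

instance : IsProbabilityMeasure M.trajNoiseLaw := by unfold trajNoiseLaw; infer_instance

/-- The expected squared prediction error of the model `θ'` along the trajectories of the model
`θ`. -/
noncomputable def predErr (θ θ' : Θ) (ψ : Param d) : ℝ :=
  ∫ ω, sqError (M.N θ') (M.N θ) (rollout (M.N θ) ψ M.H (projState ω.1) ω.2) ∂M.trajNoiseLaw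

theorem predErr_nonneg (θ θ' : Θ) (ψ : Param d) : 0 ≤ M.predErr θ θ' ψ :=
  integral_nonneg fun _ => sqError_nonneg _

/-- The sensitivity of the return to the root of the prediction error. -/
noncomputable def errLip : ℝ := M.valueLip * √(3 * M.H)

theorem errLip_nonneg : 0 ≤ M.errLip := mul_nonneg M.valueLip_nonneg (Real.sqrt_nonneg _)

/-- Model errors are known only along policies that were run; `φ` may be any policy within the
length scale of such a `ψ`. -/
theorem abs_eta_sub_le (θ θ' : Θ) {φ ψ : Param d} (hφ : ‖act φ‖ ≤ 2)
    (hle : M.scale * ‖φ - ψ‖ ≤ 1) :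
    |M.eta θ' φ - M.eta θ φ| ≤ M.errLip * √(M.predErr θ θ' ψ) := by
  have h := abs_integral_expCost_sub_le (μ := M.μ₁) (M.N_meas θ') (M.N_mem θ') (M.N_meas θ)
    (M.N_mem θ) M.σ_pos M.measurable_rew M.abs_rew_le M.valueLip_nonneg (k := M.H) (φ := φ)
    (ψ := ψ) (fun j hj s hs s' hs' => M.abs_value_sub_le θ' hφ hj.le hs hs')
    (le_trans (by gcongr; exact M.succ_div_le_scale) hle)
  rw [Real.sqrt_mul (by positivity), ← mul_assoc, ← M.eta_eq, ← M.eta_eq] at h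
  exact h

variable [Fintype Θ]

/-- The mean over the models of the roots of the prediction errors in one round. -/
noncomputable def roundErr (θ : Θ) (p : Θ → ℝ) (ψ ψ' : Param d) : ℝ :=
  ∑ θ', p θ' * (√(M.predErr θ θ' ψ') + √(M.predErr θ θ' ψ))

/-- The virtual return is compared with the true one twice: at `φ` through the errors along the
nearby old policy `ψ`, and at the new policy `ψ'` through its own errors. Hence each round samples a
trajectory of both policies. -/
theorem eta_le_of_ascent (θ : Θ) {p : Θ → ℝ} (hp : p ∈ stdSimplex ℝ Θ) {ψ ψ' φ : Param d}
    (hψ : ψ ∈ policyClass d) (hψ' : ψ' ∈ policyClass d) {Z : ℝ} (hZ : 1 ≤ Z) (hZs : M.scale ≤ Z)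
    (hφ : ‖φ - ψ‖ ≤ 1 / Z) (hasc : M.virtualReturn p φ ≤ M.virtualReturn p ψ') :
    M.eta θ φ ≤ M.eta θ ψ' + M.errLip * M.roundErr θ p ψ ψ' := by
  have hZ0 : 0 < Z := by linarith
  have hn : ‖φ - ψ‖ ≤ 1 := hφ.trans ((div_le_one hZ0).2 hZ)
  have hact : ‖act φ‖ ≤ 2 := by
    have e : act φ = act (φ - ψ) + act ψ := by rw [← act_add, sub_add_cancel]
    rw [e]
    have h1 := norm_act_le (φ - ψ)
    have h2 : ‖act ψ‖ ≤ 1 := hψ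
    linarith [norm_add_le (act (φ - ψ)) (act ψ)]
  have hs : M.scale * ‖φ - ψ‖ ≤ 1 := by
    calc M.scale * ‖φ - ψ‖ ≤ Z * (1 / Z) := by gcongr
      _ = 1 := by field_simp
  have h1 : M.eta θ φ - M.errLip * ∑ θ', p θ' * √(M.predErr θ θ' ψ) ≤ M.virtualReturn p φ := by
    have e : M.eta θ φ = ∑ θ', p θ' * M.eta θ φ := by rw [← Finset.sum_mul, hp.2, one_mul]
    rw [e, virtualReturn, Finset.mul_sum, ← Finset.sum_sub_distrib]
    refine Finset.sum_le_sum fun θ' _ => ?_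
    have := mul_le_mul_of_nonneg_left (abs_le.1 (M.abs_eta_sub_le θ θ' hact hs)).1 (hp.1 θ')
    linarith
  have h2 : M.virtualReturn p ψ' ≤ M.eta θ ψ' + M.errLip * ∑ θ', p θ' * √(M.predErr θ θ' ψ') := by
    have e : M.eta θ ψ' = ∑ θ', p θ' * M.eta θ ψ' := by rw [← Finset.sum_mul, hp.2, one_mul]
    rw [e, virtualReturn, Finset.mul_sum, ← Finset.sum_add_distrib]
    refine Finset.sum_le_sum fun θ' _ => ?_
    have h := (abs_le.1 (M.abs_eta_sub_le θ θ' (ψ := ψ') (le_trans hψ' one_le_two) (by simp))).2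
    have := mul_le_mul_of_nonneg_left h (hp.1 θ')
    linarith
  have e : M.roundErr θ p ψ ψ' =
      ∑ θ', p θ' * √(M.predErr θ θ' ψ') + ∑ θ', p θ' * √(M.predErr θ θ' ψ) := by
    rw [roundErr, ← Finset.sum_add_distrib]
    exact Finset.sum_congr rfl fun _ _ => mul_add _ _ _
  rw [e]
  linarith

theorem localRegret_le (θ : Θ) {Z ε : ℝ} (hZ : 1 ≤ Z) (hZs : M.scale ≤ Z)
    (h2 : 36 * M.H * M.scale ^ 2 ≤ Z) (h3 : 36 * M.H * M.scale ^ 3 ≤ Z) (hε : 0 < ε)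
    (hε1 : ε ≤ 1) {D : Set (Param d)} (hD : policyClass d ⊆ D)
    (hne : (approxLocalMax (M.eta θ) ε (√ε) ∩ D).Nonempty) (T : ℕ) (ψ : ℕ → Param d)
    (p : ℕ → Θ → ℝ) (hp : ∀ t < T, p t ∈ stdSimplex ℝ Θ) (hψ : ∀ t ≤ T, ψ t ∈ policyClass d)
    (hasc : ∀ t < T, ∀ φ, M.virtualReturn (p t) φ ≤ M.virtualReturn (p t) (ψ (t + 1))) :
    localRegret (M.eta θ) D ε (√ε) T ψ ≤
      (M.H + 1) / (ε ^ 2 / (16 * Z ^ 2)) * ((M.H + 1) +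
        ∑ t ∈ Finset.range T, M.errLip * M.roundErr θ (p t) (ψ t) (ψ (t + 1))) := by
  set I := sInf (M.eta θ '' (approxLocalMax (M.eta θ) ε (√ε) ∩ D)) with hI
  set δ := ε ^ 2 / (16 * Z ^ 2) with hδ_def
  have hδ : 0 < δ := by positivity
  have hδ1 : δ ≤ 1 := by
    rw [hδ_def, div_le_one (by positivity)]
    nlinarith
  have hH : (0 : ℝ) ≤ M.H := Nat.cast_nonneg _
  have hbdd : BddBelow (M.eta θ '' (approxLocalMax (M.eta θ) ε (√ε) ∩ D)) :=
    ⟨0, by rintro _ ⟨φ, _, rfl⟩; exact M.eta_nonneg θ φ⟩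
  have hIle : ∀ φ ∈ approxLocalMax (M.eta θ) ε (√ε) ∩ D, I ≤ M.eta θ φ := fun φ hφ =>
    csInf_le hbdd ⟨φ, hφ, rfl⟩
  have hIH : I ≤ M.H := by
    obtain ⟨φ, hφ⟩ := hne
    exact (hIle φ hφ).trans (M.eta_le θ φ)
  -- Truncation at zero discards the rounds that already beat the benchmark and keeps the gaps
  -- nonnegative.
  set g : ℕ → ℝ := fun t => max (I - M.eta θ (ψ t)) 0 with hg
  have hgH : ∀ t, g t ≤ M.H + 1 := fun t =>
    max_le (by linarith [M.eta_nonneg θ (ψ t)]) (by linarith)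
  have hrec : ∀ t < T, g (t + 1) ≤ (1 - δ / (M.H + 1)) * g t +
      M.errLip * M.roundErr θ (p t) (ψ t) (ψ (t + 1)) := fun t ht => by
    have hψt := hψ t ht.le
    have hψt' := hψ (t + 1) ht
    have herr : 0 ≤ M.errLip * M.roundErr θ (p t) (ψ t) (ψ (t + 1)) :=
      mul_nonneg M.errLip_nonneg (Finset.sum_nonneg fun θ' _ =>
        mul_nonneg ((hp t ht).1 θ') (by positivity))
    have hr1 : δ / (M.H + 1) ≤ 1 := (div_le_one (by positivity)).2 (by linarith)
    have hg0 : 0 ≤ g t := le_max_right _ _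
    -- The gap is at most `H + 1`, so a fixed gain `δ` is at least the fraction `δ / (H + 1)` of the
    -- gap; an additive gain becomes a contraction.
    have hstep : (δ / (M.H + 1)) * g t ≤ δ := by
      rw [div_mul_eq_mul_div, div_le_iff₀ (by positivity)]
      exact mul_le_mul_of_nonneg_left (hgH t) hδ.le
    refine max_le ?_ (add_nonneg (mul_nonneg (by linarith) hg0) herr)
    -- At an approximate local maximum the gap is zero, and comparing `ψ (t + 1)` with `ψ t` itself
    -- lets it grow by at most the error.
    by_cases hmem : ψ t ∈ approxLocalMax (M.eta θ) ε (√ε)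
    · have h4 := M.eta_le_of_ascent θ (hp t ht) hψt hψt' hZ hZs (φ := ψ t)
        (by simp; linarith) (hasc t ht _)
      have h5 := hIle _ ⟨hmem, hD hψt⟩
      have h6 : g t = 0 := max_eq_right (by linarith)
      rw [h6]
      linarith
    · obtain ⟨φ, hφ, hφ2⟩ := (M.smoothBound_eta θ).exists_ascent hZ h2 h3 hε hε1 hmem
      have h4 := M.eta_le_of_ascent θ (hp t ht) hψt hψt' hZ hZs hφ (hasc t ht _)
      have h5 : I - M.eta θ (ψ t) ≤ g t := le_max_left _ _
      linarith
  have h := sum_gap_le hδ (by linarith : δ ≤ M.H + 1) T (hgH 0) (le_max_right _ _) hrec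
  refine le_trans (Finset.sum_le_sum fun t _ => ?_) h
  exact le_max_left _ _

/-- Linearising the root as `√x ≤ x / τ + τ / 4` stands in for Cauchy–Schwarz and Jensen: the
parameter `τ` is deterministic and is optimised after taking expectations. -/
theorem sum_mul_sqrt_le {p : Θ → ℝ} (hp : p ∈ stdSimplex ℝ Θ) {q q' : Θ → ℝ} (hq : ∀ θ, 0 ≤ q θ)
    (hq' : ∀ θ, 0 ≤ q' θ) {τ : ℝ} (hτ : 0 < τ) :
    ∑ θ, p θ * (√(q' θ) + √(q θ)) ≤ (∑ θ, p θ * (q' θ + q θ)) / τ + τ / 2 := by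
  have key : ∀ x : ℝ, 0 ≤ x → √x ≤ x / τ + τ / 4 := fun x hx => by
    have h1 := Real.sq_sqrt hx
    have : x / τ + τ / 4 - √x = (√x - τ / 2) ^ 2 / τ := by
      field_simp
      nlinarith
    have h2 : 0 ≤ (√x - τ / 2) ^ 2 / τ := by positivity
    linarith
  calc ∑ θ, p θ * (√(q' θ) + √(q θ)) ≤ ∑ θ, (p θ * (q' θ + q θ) / τ + p θ * (τ / 2)) := by
        refine Finset.sum_le_sum fun θ _ => ?_
        have := mul_le_mul_of_nonneg_left (add_le_add (key _ (hq' θ)) (key _ (hq θ))) (hp.1 θ)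
        refine this.trans (le_of_eq ?_)
        ring
    _ = _ := by rw [Finset.sum_add_distrib, ← Finset.sum_div, ← Finset.sum_mul, hp.2, one_mul]

end Instance

end ModelRL

namespace ModelRL

/-! ### Runs of the algorithm -/

/-- Fubini for the product law of past and noise: fresh noise may be integrated out with the past
frozen. -/
theorem integral_comp_prod_of_indep {Ω X Y : Type*} {m : MeasurableSpace Ω}
    [mΩ : MeasurableSpace Ω] [MeasurableSpace X] [MeasurableSpace Y] (hm : m ≤ mΩ) {P : Measure Ω}
    [IsProbabilityMeasure P] {x : Ω → X} {ξ : Ω → Y} (hx : Measurable[m] x) (hξ : Measurable ξ)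
    (hind : Indep (MeasurableSpace.comap ξ inferInstance) m P) {F : X × Y → ℝ}
    (hF : Measurable F) {K : ℝ} (hK : ∀ ω, |F (x ω, ξ ω)| ≤ K) :
    Integrable (fun ω => ∫ y, F (x ω, y) ∂(P.map ξ)) P ∧
    ∫ ω, ∫ y, F (x ω, y) ∂(P.map ξ) ∂P = ∫ ω, F (x ω, ξ ω) ∂P := by
  have hx' : Measurable x := hx.mono hm le_rfl
  have hpair : IndepFun x ξ P := (IndepFun_iff_Indep _ _ _).2
    (indep_of_indep_of_le_left hind.symm hx.comap_le)
  have hmap := (indepFun_iff_map_prod_eq_prod_map_map hx'.aemeasurable hξ.aemeasurable).1 hpair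
  have : IsProbabilityMeasure (P.map ξ) := Measure.isProbabilityMeasure_map hξ.aemeasurable
  have : IsProbabilityMeasure (P.map x) := Measure.isProbabilityMeasure_map hx'.aemeasurable
  have hi : Integrable F ((P.map x).prod (P.map ξ)) := by
    rw [← hmap, integrable_map_measure hF.aestronglyMeasurable (hx'.prodMk hξ).aemeasurable]
    exact integrable_of_abs_le (hF.comp (hx'.prodMk hξ)) hK
  have hi2 : Integrable (fun a => ∫ y, F (a, y) ∂(P.map ξ)) (P.map x) := hi.integral_prod_left
  refine ⟨(integrable_map_measure hi2.aestronglyMeasurable hx'.aemeasurable).1 hi2, ?_⟩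
  rw [← integral_map (f := fun a => ∫ y, F (a, y) ∂(P.map ξ)) hx'.aemeasurable
    hi2.aestronglyMeasurable, ← integral_prod F hi, ← hmap,
    integral_map (hx'.prodMk hξ).aemeasurable hF.aestronglyMeasurable]

namespace Instance

attribute [local irreducible] act gaussianNoise cmExp

variable {d : ℕ} {Θ : Type*} (M : Instance d Θ)

theorem loss_eq (θ : Θ) (z : M.Data) :
    M.loss θ z = ∑ i, ‖M.N θ ((z.1 i).1 + (z.1 i).2.1) - (z.1 i).2.2‖ ^ 2 +
      ∑ i, ‖M.N θ ((z.2 i).1 + (z.2 i).2.1) - (z.2 i).2.2‖ ^ 2 := rfl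

theorem measurable_loss (θ : Θ) : Measurable (M.loss θ) := by
  have h : Measurable fun z : Traj d M.H =>
      ∑ i, ‖M.N θ ((z i).1 + (z i).2.1) - (z i).2.2‖ ^ 2 := by
    refine Finset.measurable_sum _ fun i _ => Measurable.pow_const (Measurable.norm ?_) 2
    have h1 : Measurable fun z : Traj d M.H => z i := measurable_pi_apply i
    have h2 : Measurable fun z : Traj d M.H => (z i).1 + (z i).2.1 :=
      (measurable_fst.comp h1).add (measurable_fst.comp (measurable_snd.comp h1))
    exact ((M.N_meas θ).comp h2).sub (measurable_snd.comp (measurable_snd.comp h1))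
  exact (h.comp measurable_fst).add (h.comp measurable_snd)

/-- Points of the ball are at distance at most 2, so each of the `2 H` transitions costs at most 4.
The bound `8 (H + 1)` is positive even for `H = 0`, as the learning rate requires. -/
theorem loss_mem (z : M.Data) (hz : z ∈ M.dataSet) (θ : Θ) :
    M.loss θ z ∈ Set.Icc (0 : ℝ) (8 * (M.H + 1)) := by
  have key : ∀ x y : E d, y ∈ stateSpace d → ‖M.N θ x - y‖ ^ 2 ≤ 4 := fun x y hy => by
    have h1 := mem_closedBall_zero_iff.1 (M.N_mem θ x)
    have h2 := mem_closedBall_zero_iff.1 hy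
    have h3 := norm_sub_le (M.N θ x) y
    calc ‖M.N θ x - y‖ ^ 2 ≤ 2 ^ 2 := by gcongr; linarith
      _ = 4 := by norm_num
  have hs : ∀ z : Traj d M.H, (∀ i, (z i).2.2 ∈ stateSpace d) →
      ∑ i, ‖M.N θ ((z i).1 + (z i).2.1) - (z i).2.2‖ ^ 2 ≤ M.H * 4 := fun z hz => by
    refine (Finset.sum_le_sum fun i _ => key _ _ (hz i)).trans ?_
    simp
  rw [loss_eq]
  refine ⟨by positivity, ?_⟩
  have h1 := hs z.1 fun i => (hz.1 i).2
  have h2 := hs z.2 fun i => (hz.2 i).2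
  linarith

theorem loss_rollout (θ θ' : Θ) (ψ ψ' : Param d) (s s' : E d) (u u' : Fin M.H → E d) :
    M.loss θ' (rollout (M.N θ) ψ M.H s u, rollout (M.N θ) ψ' M.H s' u') =
      sqError (M.N θ') (M.N θ) (rollout (M.N θ) ψ M.H s u) +
        sqError (M.N θ') (M.N θ) (rollout (M.N θ) ψ' M.H s' u') := by
  simp only [loss_eq, rollout_next]
  rfl

theorem sqError_self (f : E d → E d) {k : ℕ} (z : Traj d k) : sqError f f z = 0 := by
  simp [sqError, trajCost, stepError]

theorem measurable_roundData (θ : Θ) {Ω : Type*} [MeasurableSpace Ω]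
    {ξ : ℕ → Ω → M.TrajNoise × M.TrajNoise} {ψ : ℕ → Ω → Param d} {t : ℕ}
    (hξ : Measurable (ξ t)) (hψ : Measurable (ψ t)) (hψ' : Measurable (ψ (t + 1))) :
    Measurable (M.roundData θ ξ ψ t) :=
  ((measurable_rollout (M.N_meas θ) M.H).comp (hψ'.prodMk (measurable_fst.comp hξ))).prodMk
    ((measurable_rollout (M.N_meas θ) M.H).comp (hψ.prodMk (measurable_snd.comp hξ)))

/-- The squared prediction error of the model `θ'` along one trajectory of the model `θ`. -/
noncomputable def trajErr (θ θ' : Θ) (φ : Param d) (y : M.TrajNoise) : ℝ :=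
  sqError (M.N θ') (M.N θ) (rollout (M.N θ) φ M.H (projState y.1) y.2)

theorem measurable_trajErr (θ θ' : Θ) : Measurable (Function.uncurry (M.trajErr θ θ')) := by
  have h : Measurable fun x : Param d × M.TrajNoise => (x.1, projState x.2.1, x.2.2) :=
    measurable_fst.prodMk ((measurable_projState.comp (measurable_fst.comp measurable_snd)).prodMk
      (measurable_snd.comp measurable_snd))
  exact (measurable_sqError (M.N_meas θ') (M.N_meas θ) M.H).comp
    ((measurable_rollout (M.N_meas θ) M.H).comp h)

theorem abs_trajErr_le (θ θ' : Θ) (φ : Param d) (y : M.TrajNoise) :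
    |M.trajErr θ θ' φ y| ≤ M.H * 4 :=
  abs_sqError_le (M.N_mem θ') (M.N_mem θ) _

theorem trajErr_self (θ : Θ) (φ : Param d) (y : M.TrajNoise) : M.trajErr θ θ φ y = 0 :=
  sqError_self _ _

theorem predErr_eq (θ θ' : Θ) (φ : Param d) :
    M.predErr θ θ' φ = ∫ y, M.trajErr θ θ' φ y ∂M.trajNoiseLaw := rfl

theorem loss_roundData (θ θ' : Θ) {Ω : Type*} {ξ : ℕ → Ω → M.TrajNoise × M.TrajNoise}
    {ψ : ℕ → Ω → Param d} {t : ℕ} {ω : Ω}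
    (h : (ξ t ω).1.1 ∈ stateSpace d ∧ (ξ t ω).2.1 ∈ stateSpace d) :
    M.loss θ' (M.roundData θ ξ ψ t ω) =
      M.trajErr θ θ' (ψ (t + 1) ω) (ξ t ω).1 + M.trajErr θ θ' (ψ t ω) (ξ t ω).2 := by
  refine (M.loss_rollout ..).trans ?_
  simp only [trajErr, projState_eq h.1, projState_eq h.2]

attribute [local irreducible] trajErr rollout

theorem integrable_trajErr (θ θ' : Θ) (φ : Param d) :
    Integrable (M.trajErr θ θ' φ) M.trajNoiseLaw :=
  integrable_of_abs_le (M.measurable_trajErr θ θ').of_uncurry_left (M.abs_trajErr_le θ θ' φ)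

theorem integral_trajErr_add (θ θ' : Θ) (φ ψ : Param d) (b : ℝ) :
    ∫ y, b * (M.trajErr θ θ' φ y.1 + M.trajErr θ θ' ψ y.2)
      ∂(M.trajNoiseLaw.prod M.trajNoiseLaw) = b * (M.predErr θ θ' φ + M.predErr θ θ' ψ) := by
  rw [integral_const_mul, integral_add ((M.integrable_trajErr θ θ' φ).comp_fst _)
    ((M.integrable_trajErr θ θ' ψ).comp_snd _), integral_fun_fst, integral_fun_snd]
  simp only [probReal_univ, one_smul, predErr_eq]

theorem ae_trajNoiseLaw : ∀ᵐ y ∂(M.trajNoiseLaw.prod M.trajNoiseLaw),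
    y.1.1 ∈ stateSpace d ∧ y.2.1 ∈ stateSpace d := by
  have h : ∀ᵐ y ∂M.trajNoiseLaw, y.1 ∈ stateSpace d :=
    Measure.quasiMeasurePreserving_fst.ae M.μ₁_supp
  filter_upwards [Measure.quasiMeasurePreserving_fst.ae h,
    Measure.quasiMeasurePreserving_snd.ae h] with y h1 h2 using ⟨h1, h2⟩

/-! ### From online regret to the expected local regret of a run. -/

section Run

variable [Fintype Θ] {M} {θ : Θ} {R : Learner M.Data Θ} {T : ℕ} {Ω : Type*}
  [mΩ : MeasurableSpace Ω] {P : Measure Ω} {ℱ : Filtration ℕ mΩ}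
  {ξ : ℕ → Ω → M.TrajNoise × M.TrajNoise} {ψ : ℕ → Ω → Param d}

/-- The distribution that the learner computes in a round. -/
noncomputable def IsRun.belief (_ : M.IsRun θ R T P ℱ ξ ψ) (t : ℕ) (ω : Ω) : Θ → ℝ :=
  R.dist t fun i => M.roundData θ ξ ψ i ω

theorem IsRun.measurable_param_of_le (h : M.IsRun θ R T P ℱ ξ ψ) {t : ℕ} (ht : t ≤ T) :
    Measurable[ℱ t] (ψ t) := by
  cases t with
  | zero => exact h.init_meas
  | succ t => exact (h.param_meas t ht).mono (ℱ.mono (Nat.le_succ t)) le_rfl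

theorem IsRun.measurable_belief (h : M.IsRun θ R T P ℱ ξ ψ) {t : ℕ} (ht : t ≤ T) :
    Measurable[ℱ t] (h.belief t) := by
  refine (R.dist_meas t).comp (@measurable_pi_lambda _ _ _ (ℱ t) _ _ fun i => ?_)
  have hi : i.1 < T := i.2.trans_le ht
  have hm := @measurable_roundData d Θ M θ Ω (ℱ t) ξ ψ i
    ((h.noise_meas i hi).mono (ℱ.mono i.2) le_rfl)
    ((h.measurable_param_of_le hi.le).mono (ℱ.mono i.2.le) le_rfl)
    ((h.param_meas i hi).mono (ℱ.mono i.2.le) le_rfl)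
  exact hm

theorem IsRun.ae_roundData_mem (h : M.IsRun θ R T P ℱ ξ ψ) {t : ℕ} (ht : t < T) :
    ∀ᵐ ω ∂P, (ξ t ω).1.1 ∈ stateSpace d ∧ (ξ t ω).2.1 ∈ stateSpace d := by
  have h1 := M.ae_trajNoiseLaw
  rw [← h.noise_law t ht] at h1
  exact ae_of_ae_map ((h.noise_meas t ht).mono (ℱ.le _) le_rfl).aemeasurable h1

theorem IsRun.belief_mem (h : M.IsRun θ R T P ℱ ξ ψ) (t : ℕ) (ω : Ω) :
    h.belief t ω ∈ stdSimplex ℝ Θ := R.dist_mem t _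

theorem IsRun.abs_belief_le (h : M.IsRun θ R T P ℱ ξ ψ) (t : ℕ) (ω : Ω) (θ' : Θ) :
    |h.belief t ω θ'| ≤ 1 := by
  have hm := h.belief_mem t ω
  refine abs_le.2 ⟨by linarith [hm.1 θ'], ?_⟩
  rw [← hm.2]
  exact Finset.single_le_sum (fun i _ => hm.1 i) (Finset.mem_univ θ')

/-- The two policies and the belief of a round are known before its noise is drawn, so averaging the
observed loss over the fresh noise gives the prediction errors. -/
theorem IsRun.integral_predErr [IsProbabilityMeasure P] (h : M.IsRun θ R T P ℱ ξ ψ) {t : ℕ}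
    (ht : t < T) (θ' : Θ) :
    Integrable (fun ω => h.belief t ω θ' *
      (M.predErr θ θ' (ψ (t + 1) ω) + M.predErr θ θ' (ψ t ω))) P ∧
    Integrable (fun ω => h.belief t ω θ' * M.loss θ' (M.roundData θ ξ ψ t ω)) P ∧
    ∫ ω, h.belief t ω θ' * (M.predErr θ θ' (ψ (t + 1) ω) + M.predErr θ θ' (ψ t ω)) ∂P =
      ∫ ω, h.belief t ω θ' * M.loss θ' (M.roundData θ ξ ψ t ω) ∂P := by
  have hξ : Measurable (ξ t) := (h.noise_meas t ht).mono (ℱ.le _) le_rfl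
  let x : Ω → (Param d × Param d) × ℝ := fun ω => ((ψ (t + 1) ω, ψ t ω), h.belief t ω θ')
  have hx : Measurable[ℱ t] x :=
    ((h.param_meas t ht).prodMk (h.measurable_param_of_le ht.le)).prodMk
      ((measurable_pi_apply θ').comp (h.measurable_belief ht.le))
  let F : ((Param d × Param d) × ℝ) × (M.TrajNoise × M.TrajNoise) → ℝ := fun q =>
    q.1.2 * (M.trajErr θ θ' q.1.1.1 q.2.1 + M.trajErr θ θ' q.1.1.2 q.2.2)
  have hF : Measurable F := by
    have h1 : Measurable fun q : ((Param d × Param d) × ℝ) × (M.TrajNoise × M.TrajNoise) =>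
        (q.1.1.1, q.2.1) := (measurable_fst.comp (measurable_fst.comp measurable_fst)).prodMk
          (measurable_fst.comp measurable_snd)
    have h2 : Measurable fun q : ((Param d × Param d) × ℝ) × (M.TrajNoise × M.TrajNoise) =>
        (q.1.1.2, q.2.2) := (measurable_snd.comp (measurable_fst.comp measurable_fst)).prodMk
          (measurable_snd.comp measurable_snd)
    exact (measurable_snd.comp measurable_fst).mul (((M.measurable_trajErr θ θ').comp h1).add
      ((M.measurable_trajErr θ θ').comp h2))
  have hK : ∀ ω, |F (x ω, ξ t ω)| ≤ 1 * (M.H * 4 + M.H * 4) := fun ω => by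
    refine (abs_mul _ _).trans_le (mul_le_mul (h.abs_belief_le t ω θ') ?_ (abs_nonneg _)
      zero_le_one)
    exact (abs_add_le _ _).trans (add_le_add (M.abs_trajErr_le ..) (M.abs_trajErr_le ..))
  obtain ⟨i1, e1⟩ := integral_comp_prod_of_indep (ℱ.le t) hx hξ (h.noise_indep t ht) hF hK
  have hFx : (fun ω => ∫ y, F (x ω, y) ∂(P.map (ξ t))) = fun ω => h.belief t ω θ' *
      (M.predErr θ θ' (ψ (t + 1) ω) + M.predErr θ θ' (ψ t ω)) := funext fun ω => by
    rw [h.noise_law t ht]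
    exact M.integral_trajErr_add θ θ' _ _ _
  have hloss : (fun ω => F (x ω, ξ t ω)) =ᵐ[P]
      fun ω => h.belief t ω θ' * M.loss θ' (M.roundData θ ξ ψ t ω) := by
    filter_upwards [h.ae_roundData_mem ht] with ω hω
    exact congrArg (h.belief t ω θ' * ·) (M.loss_roundData θ θ' hω).symm
  have i2 : Integrable (fun ω => F (x ω, ξ t ω)) P :=
    integrable_of_abs_le (hF.comp ((hx.mono (ℱ.le t) le_rfl).prodMk hξ)) hK
  rw [hFx] at i1
  refine ⟨i1, i2.congr hloss, ?_⟩
  rw [← integral_congr_ae hloss, ← e1]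
  exact integral_congr_ae (.of_forall fun ω => (congrFun hFx ω).symm)

/-- The true model predicts its own data without error, so the best cumulative loss is at most zero
and the regret bound applies to the learner's cumulative loss itself. -/
theorem IsRun.integral_sum_predErr_le [IsProbabilityMeasure P] (h : M.IsRun θ R T P ℱ ξ ψ) {B : ℝ}
    (hR : ∀ z : Fin T → M.Data, (∀ t, z t ∈ M.dataSet) → R.regret M.loss z ≤ B) :
    ∫ ω, ∑ t ∈ Finset.range T, ∑ θ', h.belief t ω θ' *
      (M.predErr θ θ' (ψ (t + 1) ω) + M.predErr θ θ' (ψ t ω)) ∂P ≤ B := by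
  have hi := fun t (ht : t ∈ Finset.range T) θ' =>
    h.integral_predErr (Finset.mem_range.1 ht) θ'
  have e : ∫ ω, ∑ t ∈ Finset.range T, ∑ θ', h.belief t ω θ' *
      (M.predErr θ θ' (ψ (t + 1) ω) + M.predErr θ θ' (ψ t ω)) ∂P =
      ∫ ω, ∑ t ∈ Finset.range T, ∑ θ', h.belief t ω θ' *
        M.loss θ' (M.roundData θ ξ ψ t ω) ∂P := by
    rw [integral_finsetSum _ fun t ht => integrable_finsetSum _ fun θ' _ => (hi t ht θ').1,
      integral_finsetSum _ fun t ht => integrable_finsetSum _ fun θ' _ => (hi t ht θ').2.1]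
    refine Finset.sum_congr rfl fun t ht => ?_
    rw [integral_finsetSum _ fun θ' _ => (hi t ht θ').1,
      integral_finsetSum _ fun θ' _ => (hi t ht θ').2.1]
    exact Finset.sum_congr rfl fun θ' _ => (hi t ht θ').2.2
  have hae : ∀ᵐ ω ∂P, ∀ t : Fin T,
      (ξ t ω).1.1 ∈ stateSpace d ∧ (ξ t ω).2.1 ∈ stateSpace d :=
    ae_all_iff.2 fun t => h.ae_roundData_mem t.2
  have hle : ∀ᵐ ω ∂P, ∑ t ∈ Finset.range T, ∑ θ', h.belief t ω θ' *
      M.loss θ' (M.roundData θ ξ ψ t ω) ≤ B := by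
    filter_upwards [hae] with ω hω
    have hr := hR (fun t => M.roundData θ ξ ψ t ω) fun t =>
      ⟨rollout_mem (M.N_mem θ) _ _ (hω t).1 _, rollout_mem (M.N_mem θ) _ _ (hω t).2 _⟩
    have h0 : ⨅ θ', ∑ t : Fin T, M.loss θ' (M.roundData θ ξ ψ t ω) ≤ 0 := by
      refine (ciInf_le (Set.finite_range _).bddBelow θ).trans (le_of_eq ?_)
      refine Finset.sum_eq_zero fun t _ => ?_
      rw [M.loss_roundData θ θ (hω t), trajErr_self, trajErr_self, add_zero]
    have e2 : ∑ t ∈ Finset.range T, ∑ θ', h.belief t ω θ' *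
        M.loss θ' (M.roundData θ ξ ψ t ω) = ∑ t : Fin T, ∑ θ', h.belief t ω θ' *
          M.loss θ' (M.roundData θ ξ ψ t ω) :=
      (Fin.sum_univ_eq_sum_range (fun t => ∑ θ', h.belief t ω θ' *
        M.loss θ' (M.roundData θ ξ ψ t ω)) T).symm
    rw [e2]
    have e3 : R.regret M.loss (fun t : Fin T => M.roundData θ ξ ψ t ω) =
      ∑ t : Fin T, ∑ θ', h.belief t ω θ' * M.loss θ' (M.roundData θ ξ ψ t ω) -
        ⨅ θ', ∑ t : Fin T, M.loss θ' (M.roundData θ ξ ψ t ω) := rfl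
    linarith
  rw [e]
  have := integral_mono_ae (integrable_finsetSum _ fun t ht =>
    integrable_finsetSum _ fun θ' _ => (hi t ht θ').2.1) (integrable_const B) hle
  simpa using this

theorem IsRun.integrable_localRegret [IsProbabilityMeasure P] (h : M.IsRun θ R T P ℱ ξ ψ)
    (D : Set (Param d)) (ε ε' : ℝ) :
    Integrable (fun ω => localRegret (M.eta θ) D ε ε' T fun t => ψ t ω) P := by
  refine integrable_finsetSum _ fun t ht => (integrable_const _).sub ?_
  have hm : Measurable (ψ (t + 1)) := (h.param_meas t (Finset.mem_range.1 ht)).mono (ℱ.le _) le_rfl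
  refine integrable_of_abs_le (((M.smoothBound_eta θ).contDiff.continuous.measurable).comp hm)
    (K := M.H) fun ω => ?_
  rw [abs_of_nonneg (M.eta_nonneg θ _)]
  exact M.eta_le θ _

/-- For each fixed `τ` the pathwise bound is affine in the cumulative prediction error `S`, so
expectations pass through; optimising `τ` afterwards produces the root of `B * T / 2`. -/
theorem localRegretLE_of_regret_le {Θ : Type u} [Fintype Θ] {M : Instance d Θ}
    {R : Learner M.Data Θ} {T : ℕ} {B : ℝ} (hB : 0 ≤ B)
    (hR : ∀ z : Fin T → M.Data, (∀ t, z t ∈ M.dataSet) → R.regret M.loss z ≤ B) {Z : ℝ}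
    (hZ : 1 ≤ Z) (hZs : M.scale ≤ Z) (h2 : 36 * M.H * M.scale ^ 2 ≤ Z)
    (h3 : 36 * M.H * M.scale ^ 3 ≤ Z) :
    LocalRegretLE.{u, v} M R T fun ε => (M.H + 1) / (ε ^ 2 / (16 * Z ^ 2)) *
      ((M.H + 1) + M.errLip * (2 * √(B * (T / 2)))) := by
  intro θ ε hε hε1 D hD hne Ω mΩ P hP ℱ ξ ψ h
  have hi := h.integrable_localRegret D ε (√ε)
  refine ⟨hi, ?_⟩
  have hδ : 0 < (M.H + 1) / (ε ^ 2 / (16 * Z ^ 2)) := by positivity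
  set S : Ω → ℝ := fun ω => ∑ t ∈ Finset.range T, ∑ θ', h.belief t ω θ' *
      (M.predErr θ θ' (ψ (t + 1) ω) + M.predErr θ θ' (ψ t ω)) with hS
  have hSi : Integrable S P := integrable_finsetSum _ fun t ht => integrable_finsetSum _ fun θ' _ =>
    (h.integral_predErr (Finset.mem_range.1 ht) θ').1
  have hSB : ∫ ω, S ω ∂P ≤ B := h.integral_sum_predErr_le hR
  have hpt : ∀ τ : ℝ, 0 < τ → ∀ ω, localRegret (M.eta θ) D ε (√ε) T (fun t => ψ t ω) ≤
      (M.H + 1) / (ε ^ 2 / (16 * Z ^ 2)) * ((M.H + 1) + M.errLip * (S ω / τ + τ * (T / 2))) := by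
    intro τ hτ ω
    refine (M.localRegret_le θ hZ hZs h2 h3 hε hε1 hD hne T (fun t => ψ t ω)
      (fun t => h.belief t ω) (fun t _ => h.belief_mem t ω) (fun t ht => h.param_mem t ht ω)
      fun t ht => h.ascent t ht ω).trans ?_
    refine mul_le_mul_of_nonneg_left (add_le_add_right ?_ _) hδ.le
    rw [← Finset.mul_sum]
    refine mul_le_mul_of_nonneg_left ((Finset.sum_le_sum fun t _ => sum_mul_sqrt_le
      (h.belief_mem t ω) (fun θ' => M.predErr_nonneg θ θ' _) (fun θ' => M.predErr_nonneg θ θ' _)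
      hτ).trans (le_of_eq ?_)) M.errLip_nonneg
    rw [Finset.sum_add_distrib, ← Finset.sum_div, Finset.sum_const, Finset.card_range, nsmul_eq_mul]
    ring
  have hint : ∀ τ : ℝ, 0 < τ → ∫ ω, localRegret (M.eta θ) D ε (√ε) T (fun t => ψ t ω) ∂P ≤
      (M.H + 1) / (ε ^ 2 / (16 * Z ^ 2)) * ((M.H + 1) + M.errLip * (B / τ + τ * (T / 2))) := by
    intro τ hτ
    have i1 : Integrable (fun ω => M.errLip * (S ω / τ + τ * (T / 2))) P :=
      ((hSi.div_const τ).add (integrable_const _)).const_mul _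
    have h5 := integral_mono hi (((integrable_const _).add i1).const_mul _) (hpt τ hτ)
    refine h5.trans ?_
    have h6 : ∫ ω, (M.H + 1) / (ε ^ 2 / (16 * Z ^ 2)) *
        (((M.H : ℝ) + 1) + M.errLip * (S ω / τ + τ * (T / 2))) ∂P =
        (M.H + 1) / (ε ^ 2 / (16 * Z ^ 2)) * ((M.H + 1) +
          M.errLip * ((∫ ω, S ω ∂P) / τ + τ * (T / 2))) := by
      rw [integral_const_mul, integral_add (integrable_const _) i1, integral_const_mul,
        integral_add (hSi.div_const τ) (integrable_const _), integral_div]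
      simp
    refine h6.le.trans ?_
    have := M.errLip_nonneg
    gcongr
  set A := (M.H + 1) / (ε ^ 2 / (16 * Z ^ 2)) with hA
  have hAL : 0 ≤ A * M.errLip := mul_nonneg hδ.le M.errLip_nonneg
  have hT : (0 : ℝ) ≤ T / 2 := by positivity
  have hfin := le_two_mul_sqrt_of_forall (X := ∫ ω, localRegret (M.eta θ) D ε (√ε) T
    (fun t => ψ t ω) ∂P - A * (M.H + 1)) (mul_nonneg hAL hB) (mul_nonneg hAL hT) fun τ hτ => by
      have e : A * ((M.H + 1) + M.errLip * (B / τ + τ * (T / 2))) - A * (M.H + 1) =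
        A * M.errLip * B / τ + τ * (A * M.errLip * (T / 2)) := by ring
      rw [← e]
      exact sub_le_sub_right (hint τ hτ) _
  have e2 : √(A * M.errLip * B * (A * M.errLip * (T / 2))) = A * M.errLip * √(B * (T / 2)) := by
    rw [mul_mul_mul_comm, Real.sqrt_mul (mul_self_nonneg _), Real.sqrt_mul_self hAL]
  rw [e2] at hfin
  change _ ≤ A * ((M.H + 1) + M.errLip * (2 * √(B * (T / 2))))
  linarith

/-- With one model the virtual return is the true return, so every `ψ (t + 1)` is a global maximiser
and beats any comparison parameter, inside or outside the policy class. -/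
theorem localRegretLE_of_subsingleton {Θ : Type u} [Fintype Θ] [Subsingleton Θ] (M : Instance d Θ)
    (R : Learner M.Data Θ) (T : ℕ) : LocalRegretLE.{u, v} M R T fun _ => 0 := by
  intro θ ε _ _ D _ hne Ω mΩ P hP ℱ ξ ψ h
  refine ⟨h.integrable_localRegret D ε (√ε), integral_nonpos fun ω => ?_⟩
  refine Finset.sum_nonpos fun t ht => sub_nonpos.2 ?_
  have hv : ∀ φ, M.virtualReturn (h.belief t ω) φ = M.eta θ φ := fun φ => by
    have e : ∀ θ', M.eta θ' φ = M.eta θ φ := fun θ' => by rw [Subsingleton.elim θ' θ]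
    simp_rw [virtualReturn, e]
    rw [← Finset.sum_mul, (h.belief_mem t ω).2, one_mul]
  obtain ⟨φ, hφ⟩ := hne
  have hasc : M.virtualReturn (h.belief t ω) φ ≤ M.virtualReturn (h.belief t ω) (ψ (t + 1) ω) :=
    h.ascent t (Finset.mem_range.1 ht) ω φ
  rw [hv, hv] at hasc
  have hbdd : BddBelow (M.eta θ '' (approxLocalMax (M.eta θ) ε (√ε) ∩ D)) :=
    ⟨0, by rintro _ ⟨φ, _, rfl⟩; exact M.eta_nonneg θ φ⟩
  exact (csInf_le hbdd ⟨φ, hφ, rfl⟩).trans hasc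

theorem localRegretLE_zero {Θ : Type u} [Fintype Θ] (M : Instance d Θ) (R : Learner M.Data Θ) :
    LocalRegretLE.{u, v} M R 0 fun _ => 0 := by
  intro θ ε _ _ D _ _ Ω mΩ P hP ℱ ξ ψ h
  exact ⟨h.integrable_localRegret D ε (√ε), by simp [localRegret]⟩

theorem LocalRegretLE.mono {Θ : Type u} [Fintype Θ] {M : Instance d Θ} {R : Learner M.Data Θ}
    {T : ℕ} {B B' : ℝ → ℝ} (h : LocalRegretLE.{u, v} M R T B)
    (hB : ∀ ε, 0 < ε → ε ≤ 1 → B ε ≤ B' ε) : LocalRegretLE.{u, v} M R T B' :=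
  fun θ ε hε hε1 D hD hne Ω _ P _ ℱ ξ ψ hrun =>
    have h1 := h θ ε hε hε1 D hD hne Ω P ℱ ξ ψ hrun
    ⟨h1.1, h1.2.trans (hB ε hε hε1)⟩

end Run

end Instance

end ModelRL

namespace ModelRL

namespace Instance

variable {d : ℕ} {Θ : Type*} (M : Instance d Θ)

/-! ### The constants -/

/-- A common bound for the data of the instance. -/
noncomputable def size : ℝ := (1 + M.σ⁻¹) * (1 + M.H) * (1 + M.Lr)

theorem size_bounds : 1 ≤ M.size ∧ M.σ⁻¹ ≤ M.size ∧ (M.H : ℝ) + 1 ≤ M.size ∧ M.Lr ≤ M.size ∧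
    M.scale ≤ 2 * M.size := by
  have h1 : 0 < M.σ⁻¹ := inv_pos.2 M.σ_pos
  have h2 : (0 : ℝ) ≤ M.H := Nat.cast_nonneg _
  have h3 := M.Lr_nonneg
  have h4 : 0 ≤ M.σ⁻¹ * M.H := by positivity
  have h5 : 0 ≤ (1 + M.σ⁻¹) * (1 + M.H) * M.Lr := by positivity
  have h6 : M.Lr ≤ (1 + M.σ⁻¹) * (1 + M.H) * M.Lr :=
    le_mul_of_one_le_left h3 (one_le_mul_of_one_le_of_one_le (by linarith) (by linarith))
  have e : M.scale = (M.H + 2) * M.σ⁻¹ := div_eq_mul_inv _ _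
  rw [e, size]
  refine ⟨?_, ?_, ?_, ?_, ?_⟩ <;> nlinarith

/-- The constant of the regret bounds. -/
noncomputable def bigConst : ℝ := 10 ^ 11 * M.size ^ 13

theorem mul_pow_le_bigConst {c : ℝ} (hc : c ≤ 10 ^ 11) {k : ℕ} (hk : k ≤ 13) :
    c * M.size ^ k ≤ M.bigConst :=
  mul_le_mul hc (pow_le_pow_right₀ M.size_bounds.1 hk)
    (pow_nonneg (zero_le_one.trans M.size_bounds.1) _) (by positivity)

theorem regularity_constants_le : ∀ c ∈ [36 * M.H * M.scale, 36 * M.H * M.scale ^ 2,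
    36 * M.H * M.scale ^ 3, M.valueLip, M.valueLip1, M.valueLip2, 32 / M.σ ^ 2, 1536 / M.σ ^ 4,
    1 / M.σ ^ 4], c ≤ M.bigConst := by
  obtain ⟨hA, hσA, hHA, hLA, hsA⟩ := M.size_bounds
  have hσ : 0 < M.σ⁻¹ := inv_pos.2 M.σ_pos
  have hH0 : (0 : ℝ) ≤ M.H := Nat.cast_nonneg _
  have hHA' : (M.H : ℝ) ≤ M.size := by linarith
  have hL0 := M.Lr_nonneg
  have hs0 := M.scale_pos.le
  have hA0 : 0 ≤ M.size := by linarith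
  have p1 : M.size ≤ M.size ^ 4 := le_self_pow₀ hA (by norm_num)
  have p2 : M.size ^ 2 ≤ M.size ^ 4 := pow_le_pow_right₀ hA (by norm_num)
  have p3 : M.size ^ 3 ≤ M.size ^ 4 := pow_le_pow_right₀ hA (by norm_num)
  have hbig : 10 ^ 4 * M.size ^ 4 ≤ M.bigConst :=
    M.mul_pow_le_bigConst (by norm_num) (by norm_num)
  simp only [List.mem_cons, List.not_mem_nil, or_false, forall_eq_or_imp, forall_eq]
  refine ⟨?_, ?_, ?_, ?_, ?_, ?_, ?_, ?_, ?_⟩ <;> refine le_trans ?_ hbig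
  · calc _ ≤ 36 * M.size * (2 * M.size) := by gcongr
      _ ≤ _ := by linarith
  · calc _ ≤ 36 * M.size * (2 * M.size) ^ 2 := by gcongr
      _ ≤ _ := by linarith
  · calc _ ≤ 36 * M.size * (2 * M.size) ^ 3 := by gcongr
      _ ≤ _ := by linarith
  · unfold valueLip
    calc _ ≤ M.size + 72 * (2 * M.size) + 108 * M.size * (2 * M.size) := by gcongr
      _ ≤ _ := by linarith
  · unfold valueLip1
    calc _ ≤ 36 * M.size * (2 * M.size) + 72 * (2 * M.size) ^ 2 + 36 * (2 * M.size) +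
          108 * M.size * (2 * M.size) ^ 2 + 36 * M.size * (2 * M.size) := by gcongr
      _ ≤ _ := by linarith
  · unfold valueLip2
    calc _ ≤ 36 * M.size * (2 * M.size) ^ 2 + 72 * (2 * M.size) ^ 3 + 72 * (2 * M.size) ^ 2 +
          108 * M.size * (2 * M.size) ^ 3 + 72 * M.size * (2 * M.size) ^ 2 := by gcongr
      _ ≤ _ := by linarith
  · calc _ = 32 * M.σ⁻¹ ^ 2 := by rw [inv_pow, div_eq_mul_inv]
      _ ≤ 32 * M.size ^ 2 := by gcongr
      _ ≤ _ := by linarith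
  · calc _ = 1536 * M.σ⁻¹ ^ 4 := by rw [inv_pow, div_eq_mul_inv]
      _ ≤ 1536 * M.size ^ 4 := by gcongr
      _ ≤ _ := by linarith
  · calc _ = M.σ⁻¹ ^ 4 := by rw [inv_pow, one_div]
      _ ≤ M.size ^ 4 := by gcongr
      _ ≤ _ := by linarith

theorem valueLip_le : M.valueLip ≤ 361 * M.size ^ 2 := by
  obtain ⟨hA, -, hHA, hLA, hsA⟩ := M.size_bounds
  have hHA' : (M.H : ℝ) ≤ M.size := by linarith
  have p1 : M.size ≤ M.size ^ 2 := le_self_pow₀ hA (by norm_num)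
  have hs0 := M.scale_pos.le
  unfold valueLip
  calc _ ≤ M.size + 72 * (2 * M.size) + 108 * M.size * (2 * M.size) := by gcongr
    _ ≤ _ := by linarith

theorem errLip_le : M.errLip ≤ 722 * M.size ^ 3 := by
  obtain ⟨hA, -, hHA, -, -⟩ := M.size_bounds
  have h1 : √(3 * M.H) ≤ 2 * M.size := Real.sqrt_le_iff.2 ⟨by linarith, by nlinarith⟩
  calc M.errLip ≤ 361 * M.size ^ 2 * (2 * M.size) :=
        mul_le_mul M.valueLip_le h1 (Real.sqrt_nonneg _) (by positivity)
    _ = 722 * M.size ^ 3 := by ring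

theorem sq_rpow_mul_rpow {x y : ℝ} (hx : 0 < x) (hy : 0 ≤ y) :
    (x ^ (3 / 4 : ℝ) * y ^ (1 / 4 : ℝ)) ^ 2 = x * √(x * y) := by
  rw [mul_pow, ← Real.rpow_natCast, ← Real.rpow_natCast, ← Real.rpow_mul hx.le, ← Real.rpow_mul hy,
    Real.sqrt_mul hx.le, Real.sqrt_eq_rpow, Real.sqrt_eq_rpow]
  have e1 : (3 / 4 : ℝ) * (2 : ℕ) = 1 + 1 / 2 := by norm_num
  have e2 : (1 / 4 : ℝ) * (2 : ℕ) = 1 / 2 := by norm_num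
  rw [e1, e2, Real.rpow_add hx, Real.rpow_one, mul_assoc]

/-- The powers of `size` are `9 = 1 + 8` from the prefactor and 4 from the bracket. With `q = T ^
(3/4) L ^ (1/4)`, the root of the regret bound is of order `q`. -/
theorem localRegret_constant_le {T : ℕ} (hT : 0 < T) {L : ℝ} (hL : 1 / 2 ≤ L) {ε : ℝ}
    (hε : 0 < ε) :
    (M.H + 1) / (ε ^ 2 / (16 * (500 * M.size ^ 4) ^ 2)) * ((M.H + 1) +
      M.errLip * (2 * √(32 * (M.H + 1) * √(T * L) * (T / 2)))) ≤
        M.bigConst * (T : ℝ) ^ (3 / 4 : ℝ) * L ^ (1 / 4 : ℝ) / ε ^ 2 := by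
  obtain ⟨hA, -, hHA, -, -⟩ := M.size_bounds
  have hA0 : 0 < M.size := by linarith
  have hH0 : (0 : ℝ) ≤ M.H := Nat.cast_nonneg _
  have hT' : (1 : ℝ) ≤ T := by exact_mod_cast hT
  have hT0 : (0 : ℝ) < T := by linarith
  set q := (T : ℝ) ^ (3 / 4 : ℝ) * L ^ (1 / 4 : ℝ) with hq
  have hq0 : 0 ≤ q := by
    have : 0 ≤ L := by linarith
    positivity
  have hq2 : q ^ 2 = T * √(T * L) := sq_rpow_mul_rpow hT0 (by linarith)
  have hs : 1 / 2 ≤ √(T * L) := Real.le_sqrt_of_sq_le (by nlinarith)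
  -- As `T ≥ 1` and `L ≥ 1 / 2`, the term `H + 1` not involving `T` is absorbed into a multiple of
  -- `q`.
  have hq1 : 1 ≤ 2 * q := by
    by_contra! hcon
    nlinarith
  have h1 : √(32 * (M.H + 1) * √(T * L) * (T / 2)) ≤ 4 * M.size * q := by
    refine Real.sqrt_le_iff.2 ⟨by positivity, ?_⟩
    have e : 32 * (M.H + 1) * √(T * L) * (T / 2) = 16 * (M.H + 1) * q ^ 2 := by rw [hq2]; ring
    rw [e]
    have : (M.H : ℝ) + 1 ≤ M.size ^ 2 := by nlinarith
    calc 16 * (M.H + 1) * q ^ 2 ≤ 16 * M.size ^ 2 * q ^ 2 := by gcongr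
      _ = _ := by ring
  have h2 : (M.H : ℝ) + 1 ≤ 2 * M.size ^ 4 * q := by
    have : M.size ≤ M.size ^ 4 := le_self_pow₀ hA (by norm_num)
    calc (M.H : ℝ) + 1 ≤ M.size ^ 4 * 1 := by linarith
      _ ≤ M.size ^ 4 * (2 * q) := by gcongr
      _ = _ := by ring
  have h3 : M.errLip * (2 * √(32 * (M.H + 1) * √(T * L) * (T / 2))) ≤
      5776 * M.size ^ 4 * q := by
    calc _ ≤ 722 * M.size ^ 3 * (2 * (4 * M.size * q)) := by
          gcongr
          exact M.errLip_le
      _ = _ := by ring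
  have h4 : (M.H + 1) / (ε ^ 2 / (16 * (500 * M.size ^ 4) ^ 2)) ≤
      4 * 10 ^ 6 * M.size ^ 9 / ε ^ 2 := by
    calc (M.H + 1) / (ε ^ 2 / (16 * (500 * M.size ^ 4) ^ 2))
        ≤ M.size / (ε ^ 2 / (16 * (500 * M.size ^ 4) ^ 2)) := by gcongr
      _ = _ := by field_simp; norm_num
  have := M.errLip_nonneg
  calc _ ≤ 4 * 10 ^ 6 * M.size ^ 9 / ε ^ 2 * (2 * M.size ^ 4 * q + 5776 * M.size ^ 4 * q) := by
        gcongr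
    _ = 23112 * 10 ^ 6 * M.size ^ 13 * q / ε ^ 2 := by ring
    _ ≤ 10 ^ 11 * M.size ^ 13 * q / ε ^ 2 := by gcongr; norm_num
    _ = _ := by rw [hq, bigConst]; ring

/-- With losses in `[0, c]`, `c = 8 (H + 1)`, the factor `32 (H + 1) = 4 c` covers both exponential
weights and twice the Rademacher complexity. For `T = 0` or a single model the claimed bound is zero
and is proved directly; otherwise `log |Θ| ≥ log 2 ≥ 1 / 2`. -/
theorem localRegretLE_of_regret_le_sqrt {Θ : Type u} [Fintype Θ] [Nonempty Θ] (M : Instance d Θ)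
    (R : Learner M.Data Θ) (T : ℕ)
    (hR : ∀ z : Fin T → M.Data, (∀ t, z t ∈ M.dataSet) →
      R.regret M.loss z ≤ 32 * (M.H + 1) * √(T * Real.log (Fintype.card Θ))) :
    LocalRegretLE.{u, v} M R T fun ε => M.bigConst * (T : ℝ) ^ (3 / 4 : ℝ) *
      Real.log (Fintype.card Θ) ^ (1 / 4 : ℝ) / ε ^ 2 := by
  rcases Nat.eq_zero_or_pos T with rfl | hT
  · refine (localRegretLE_zero M R).mono fun ε _ _ => le_of_eq ?_
    rw [Nat.cast_zero, Real.zero_rpow (by norm_num)]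
    ring
  rcases subsingleton_or_nontrivial Θ with hΘ | hΘ
  · refine (localRegretLE_of_subsingleton M R T).mono fun ε _ _ => le_of_eq ?_
    have : Fintype.card Θ = 1 := Fintype.card_eq_one_iff_nonempty_unique.2
      ⟨⟨⟨Classical.arbitrary Θ⟩, fun _ => Subsingleton.elim _ _⟩⟩
    rw [this, Nat.cast_one, Real.log_one, Real.zero_rpow (by norm_num)]
    ring
  have hL : 1 / 2 ≤ Real.log (Fintype.card Θ) := by
    have h2 : (2 : ℝ) ≤ Fintype.card Θ := by exact_mod_cast Fintype.one_lt_card (α := Θ)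
    have := Real.log_le_log two_pos h2
    linarith [Real.log_two_gt_d9]
  obtain ⟨hA, -, hHA, -, hsA⟩ := M.size_bounds
  have hHA' : (M.H : ℝ) ≤ M.size := by linarith
  have hs0 := M.scale_pos.le
  have p0 : 1 ≤ M.size ^ 4 := one_le_pow₀ hA
  have p1 : M.size ≤ M.size ^ 4 := le_self_pow₀ hA (by norm_num)
  have p3 : M.size ^ 3 ≤ M.size ^ 4 := pow_le_pow_right₀ hA (by norm_num)
  -- This `Z` dominates the inverse length scale and both derivative bounds, the largest being `36 *
  -- 2 ^ 3 * size ^ 4`.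
  refine (localRegretLE_of_regret_le (by positivity) hR (Z := 500 * M.size ^ 4) (by linarith)
    (by linarith) ?_ ?_).mono fun ε hε _ => M.localRegret_constant_le hT hL hε
  · calc _ ≤ 36 * M.size * (2 * M.size) ^ 2 := by gcongr
      _ ≤ _ := by linarith
  · calc _ ≤ 36 * M.size * (2 * M.size) ^ 3 := by gcongr
      _ ≤ _ := by linarith

end Instance

end ModelRL

open ModelRL
theorem mainTheorem10 :
    ∃ P : MvPolynomial (Fin 4) ℝ,
    ∀ (d : ℕ) (Θ : Type u) [Fintype Θ] [Nonempty Θ] (M : Instance d Θ) (C : ℝ),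
    C = MvPolynomial.eval ![M.σ, M.σ⁻¹, (M.H : ℝ), M.Lr] P →
    (∃ ζg ζh ζ3 L0 L1 L2 χg χf χh : ℝ,
      (∀ c ∈ [ζg, ζh, ζ3, L0, L1, L2, χg, χf, χh], c ≤ C) ∧
      ReturnLipschitz M.eta ζg ζh ζ3 ∧
      ValueLipschitz M.value (policyClass d) (stateSpace d) M.H L0 L1 L2 ∧
      PolicySmooth M.σ (policyClass d) (stateSpace d) χg χf χh) ∧
    ∀ T : ℕ,
      (∃ R : Learner M.Data Θ,
        (∀ z : Fin T → M.Data, (∀ t, z t ∈ M.dataSet) →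
          R.regret M.loss z ≤ C * √((T : ℝ) * Real.log (Fintype.card Θ))) ∧
        Instance.LocalRegretLE.{u, v} M R T fun ε =>
          C * (T : ℝ) ^ (3 / 4 : ℝ) * Real.log (Fintype.card Θ) ^ (1 / 4 : ℝ) / ε ^ 2) ∧
      ∀ R : Learner M.Data Θ, R.RademacherRegret M.loss M.dataSet T →
        Instance.LocalRegretLE.{u, v} M R T fun ε =>
          C * (T : ℝ) ^ (3 / 4 : ℝ) * Real.log (Fintype.card Θ) ^ (1 / 4 : ℝ) / ε ^ 2 := by
  -- The polynomial whose value is `bigConst`; the noise level enters through its inverse only.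
  refine ⟨MvPolynomial.C (10 ^ 11) * ((1 + MvPolynomial.X 1) * (1 + MvPolynomial.X 2) *
    (1 + MvPolynomial.X 3)) ^ 13, fun d Θ _ _ M C hC => ?_⟩
  have hC' : C = M.bigConst := by
    rw [hC]
    simp [Instance.bigConst, Instance.size]
  subst hC'
  clear hC
  refine ⟨⟨_, _, _, _, _, _, _, _, _, M.regularity_constants_le, M.returnLipschitz,
    M.valueLipschitz, policySmooth M.σ_pos _⟩, fun T => ⟨?_, fun R hR => ?_⟩⟩
  · have hc : (0 : ℝ) < 8 * (M.H + 1) := by positivity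
    obtain ⟨R, hR⟩ := exists_hedge_regret_le M.measurable_loss M.dataSet hc M.loss_mem T
    refine ⟨R, fun z hz => (hR z hz).trans ?_,
      M.localRegretLE_of_regret_le_sqrt R T fun z hz => (hR z hz).trans ?_⟩
    · gcongr
      obtain ⟨hA, -, hHA, -, -⟩ := M.size_bounds
      have := M.mul_pow_le_bigConst (c := 16) (k := 1) (by norm_num) (by norm_num)
      linarith
    · exact mul_le_mul_of_nonneg_right (by linarith) (Real.sqrt_nonneg _)
  · have hc : (0 : ℝ) ≤ 8 * (M.H + 1) := by positivity
    have hle := two_mul_seqRademacher_le hc (fun z hz θ => by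
      have := M.loss_mem z hz θ
      rw [abs_of_nonneg this.1]
      exact this.2) T
    exact M.localRegretLE_of_regret_le_sqrt R T fun z hz => (hR z hz).trans (hle.trans
      (mul_le_mul_of_nonneg_right (by linarith) (Real.sqrt_nonneg _)))
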